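/- **Theorem.** Let $\mathcal X,\mathcal P$ be an attribute space and a policy space (sets of bit strings $\mathcal X_\lambda,\mathcal P_\lambda$ with a relation "$P(X)=\top$"), $\mathcal M$ a plaintext space and $\ell=\ell(\lambda)$. Let $\Sigma_{\mathsf{nce}}=\mathsf{NCE}.(\mathsf{Setup},\mathsf{KeyGen},\mathsf{Enc},\mathsf{Dec},\mathsf{FakeSetup},\mathsf{FakeSK},\mathsf{FakeCT},\mathsf{Reveal})$ be a receiver non-committing key-policy ABE scheme (NCABE) of PPT algorithms with plaintext space $\{0,1\}^{\ell}$, attribute space $\mathcal X$ and policy space $\mathcal P$, and let $\Sigma_{\mathsf{skcd}}=\mathsf{SKE}.(\mathsf{Gen},\mathsf{Enc},\mathsf{Dec},\mathsf{Del},\mathsf{Vrfy})$ be a one-time secret key encryption scheme with certified deletion of QPT algorithms, with plaintext space $\mathcal M$, key space $\{0,1\}^{\ell}$, quantum ciphertexts and classical certificates. Every algorithm is given $1^\lambda$. Define $\Sigma_{\mathsf{cd}}=(\mathsf{Setup},\mathsf{KeyGen},\mathsf{Enc},\mathsf{Dec},\mathsf{Del},\mathsf{Vrfy})$ as follows. *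 $\mathsf{Setup}=\mathsf{NCE.Setup}$ and $\mathsf{KeyGen}=\mathsf{NCE.KeyGen}$. * $\mathsf{Enc}(\mathsf{pk},X,m)$: generate $\mathsf{sk}\leftarrow\mathsf{SKE.Gen}(1^\lambda)$, $c\leftarrow\mathsf{NCE.Enc}(\mathsf{pk},X,\mathsf{sk})$, $d\leftarrow\mathsf{SKE.Enc}(\mathsf{sk},m)$; output the verification key $\mathsf{vk}=\mathsf{sk}$ and the ciphertext $\mathsf{CT}=(c,d)$. * $\mathsf{Dec}(\mathsf{sk}_P,(c,d))$: compute $\mathsf{sk}'\leftarrow\mathsf{NCE.Dec}(\mathsf{sk}_P,c)$; output $\mathsf{SKE.Dec}(\mathsf{sk}',d)$, or $\bot$ if $\mathsf{sk}'=\bot$. * $\mathsf{Del}((c,d))=\mathsf{SKE.Del}(d)$ and $\mathsf{Vrfy}(\mathsf{vk},\mathsf{cert})=\mathsf{SKE.Vrfy}(\mathsf{vk},\mathsf{cert})$. If $\Sigma_{\mathsf{nce}}$ is RNC secure and $\Sigma_{\mathsf{skcd}}$ is OT-CD secure, then $\Sigma_{\mathsf{cd}}$ is an ABE scheme with certified deletion,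 with plaintext space $\mathcal M$, attribute space $\mathcal X$ and policy space $\mathcal P$, whose algorithms are QPT and whose keys, verification keys and certificates are classical, and it is IND-CPA-CD secure. Moreover, up to negligible errors, if $\Sigma_{\mathsf{nce}}$ and $\Sigma_{\mathsf{skcd}}$ decrypt correctly then so does $\Sigma_{\mathsf{cd}}$ (whenever $P(X)=\top$), and if honestly generated certificates of $\Sigma_{\mathsf{skcd}}$ are accepted then so are those of $\Sigma_{\mathsf{cd}}$. Here security means that for every (uniform, interactive) QPT adversary the probabilities that it outputs $1$ in the following experiments for $b=0$ and $b=1$ differ by a negligible function of $\lambda$. The running time of the adversary, including the length of the messages it sends, is bounded by a polynomial in $\lambda$ whatever it receives, and the adversary always obeys the rules on its messages. * *OT-CD.* The challenger generates $\mathsf{sk}\leftarrow\mathsf{Gen}(1^\lambda)$. The adversary sends $m_0,m_1\in\mathcal M$ and receives $\mathsf{Enc}(\mathsf{sk},m_b)$. It sends a classical certificate $\mathsf{cert}$ and receives $\mathsf{sk}$ if $\mathsf{Vrfy}(\mathsf{sk},\mathsf{cert})=\top$, and $\bot$ otherwise. It outputs a bit. * *RNC.* For $b=0$ the challenger generates $(\mathsf{pk},\mathsf{msk})\leftarrow\mathsf{Setup}(1^\lambda)$,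 for $b=1$ $(\mathsf{pk},\mathsf{aux})\leftarrow\mathsf{FakeSetup}(1^\lambda)$, and sends $\mathsf{pk}$. The adversary may at any time send key queries $P\in\mathcal P$, answered by $\mathsf{KeyGen}(\mathsf{msk},P)$ if $b=0$ and by $\mathsf{FakeSK}(\mathsf{pk},\mathsf{aux},P)$ if $b=1$. Once, it sends $X^*\in\mathcal X$ and $m\in\{0,1\}^\ell$, and receives $(\mathsf{Enc}(\mathsf{pk},X^*,m),\mathsf{msk})$ if $b=0$, and $(\widetilde{\mathsf{CT}},\widetilde{\mathsf{msk}})$ with $\widetilde{\mathsf{CT}}\leftarrow\mathsf{FakeCT}(\mathsf{pk},\mathsf{aux},X^*)$ and $\widetilde{\mathsf{msk}}\leftarrow\mathsf{Reveal}(\mathsf{pk},\mathsf{aux},\widetilde{\mathsf{CT}},m)$ if $b=1$. All key queries, before and after, must satisfy $P(X^*)=\bot$. It outputs a bit. * *IND-CPA-CD.* The challenger generates $(\mathsf{pk},\mathsf{msk})\leftarrow\mathsf{Setup}(1^\lambda)$ and sends $\mathsf{pk}$. The adversary may at any time send key queries $P\in\mathcal P$, answered by $\mathsf{KeyGen}(\mathsf{msk},P)$.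 Once, it sends $X^*\in\mathcal X$ and $m_0,m_1\in\mathcal M$; the challenger computes $(\mathsf{vk},\mathsf{CT})\leftarrow\mathsf{Enc}(\mathsf{pk},X^*,m_b)$ and sends $\mathsf{CT}$. After that, the adversary sends, once, a classical certificate $\mathsf{cert}$, and receives $\mathsf{msk}$ if $\mathsf{Vrfy}(\mathsf{vk},\mathsf{cert})=\top$, and $\bot$ otherwise. All key queries, at any stage, must satisfy $P(X^*)=\bot$. It outputs a bit. -/

import Mathlib

namespace CertDel

/-! ## Data -/

/-- The values that programs handle: finite binary trees whose leaves are `nil`, a classical bit,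
or a reference to a qubit of the quantum memory. Programs can use a reference to act on the qubit,
but they can neither read nor compute the address that it holds. -/
inductive Val : Type
  | nil : Val
  | bit : Bool → Val
  | qubit : ℕ → Val
  | pair : Val → Val → Val

namespace Val

/-- Left component (`nil` if there is none). -/
def fst : Val → Val
  | pair x _ => x
  | _ => nil

/-- Right component (`nil` if there is none). -/
def snd : Val → Val
  | pair _ y => y
  | _ => nil

/-- Number of nodes of the tree. -/
def size : Val → ℕ
  | pair x y => x.size + y.size + 1
  | _ => 1

/-- Length of the list that the tree represents (`pair` is cons). -/
def len : Val → ℕ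
  | pair _ y => y.len + 1
  | _ => 0

/-- No qubits occur in the value. -/
def IsClassical : Val → Prop
  | qubit _ => False
  | pair x y => x.IsClassical ∧ y.IsClassical
  | _ => True

/-- The value is the bit `1`. This is also how `⊤` is represented; any other value is read as `⊥`
where `⊤` or `⊥` is expected. -/
def isTrue : Val → Bool
  | bit b => b
  | _ => false

/-- The bit string `l` as a value. -/
def str : List Bool → Val
  | [] => nil
  | b :: l => pair (bit b) (str l)

/-- The security parameter in unary, `1ⁿ`. -/
def unary (n : ℕ) : Val := str (List.replicate n true)

/-- Tuples: `(x₁, (x₂, … xₖ))`. -/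
def tuple : List Val → Val
  | [] => nil
  | [x] => x
  | x :: y :: l => pair x (tuple (y :: l))

/-- A proper answer `x`, as opposed to `⊥`. -/
def some (x : Val) : Val := pair (bit true) x

/-- The answer `⊥`. -/
def bot : Val := pair (bit false) nil

/-- The message "key query for the policy `P`". -/
def keyQuery (P : Val) : Val := pair nil P

/-- The message "challenge query with content `x`". -/
def challenge (x : Val) : Val := pair (bit false) x

/-- The message "deletion certificate `c`". -/
def certificate (c : Val) : Val := pair (bit true) c

end Val

/-! ## Quantum memory -/

/-- A (sub-normalised) pure state of the quantum memory, whose qubits are numbered by `ℕ`, all but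
finitely many of them being `|0⟩`. The computational basis vector `s : Finset ℕ` is the one in which
exactly the qubits in `s` are `|1⟩`. -/
abbrev Mem : Type := Finset ℕ →₀ ℂ

/-- The gate set: Hadamard, `T` (phase `exp (iπ/4)`), and controlled NOT. -/
inductive Gate : Type
  | had (q : ℕ)
  | phase (q : ℕ)
  | cnot (control target : ℕ)

/-- Action of a gate on a basis vector. A controlled NOT whose control and target coincide does
nothing. -/
noncomputable def Gate.onBasis : Gate → Finset ℕ → Mem
  | had q, s =>
      if q ∈ s then
        Finsupp.single (s.erase q) ((1 / Real.sqrt 2 : ℝ) : ℂ)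
          - Finsupp.single s ((1 / Real.sqrt 2 : ℝ) : ℂ)
      else
        Finsupp.single s ((1 / Real.sqrt 2 : ℝ) : ℂ)
          + Finsupp.single (insert q s) ((1 / Real.sqrt 2 : ℝ) : ℂ)
  | phase q, s =>
      Finsupp.single s (if q ∈ s then Complex.exp (Real.pi / 4 * Complex.I) else 1)
  | cnot a b, s =>
      Finsupp.single (if a ∈ s ∧ a ≠ b then symmDiff s {b} else s) 1

/-- Action of a gate on a state, by linearity. -/
noncomputable def Gate.act (g : Gate) (ψ : Mem) : Mem :=
  ψ.sum fun s a => a • g.onBasis s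

/-- The projection onto the states in which qubit `q` has the value `b`. -/
noncomputable def Mem.project (q : ℕ) (b : Bool) (ψ : Mem) : Mem :=
  ψ.filter fun s => (decide (q ∈ s)) = b

/-- Squared norm. -/
noncomputable def Mem.normSq (ψ : Mem) : ℝ :=
  ψ.sum fun _ a => ‖a‖ ^ 2

/-! ## Computations -/

/-- Behaviour of a (quantum, probabilistic, interactive) computation with result in `α`:
a tree whose nodes are the elementary events of the computation. -/
inductive Comp (α : Type) : Type
  /-- stop with a result -/
  | ret : α → Comp α
  /-- spend a number of time steps -/
  | tick : ℕ → Comp α → Comp α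
  /-- toss a fair coin -/
  | coin : (Bool → Comp α) → Comp α
  /-- get a reference to a fresh qubit in state `|0⟩` -/
  | new : (ℕ → Comp α) → Comp α
  /-- apply a gate -/
  | gate : Gate → Comp α → Comp α
  /-- measure a qubit in the computational basis -/
  | meas : ℕ → (Bool → Comp α) → Comp α
  /-- send a message to the other party and wait for the reply -/
  | ask : Val → (Val → Comp α) → Comp α

namespace Comp

/-- Sequential composition. -/
def bind {α β : Type} : Comp α → (α → Comp β) → Comp β
  | ret a, f => f a
  | tick c k, f => tick c (k.bind f)
  | coin k, f => coin fun b => (k b).bind f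
  | new k, f => new fun q => (k q).bind f
  | gate g k, f => gate g (k.bind f)
  | meas q k, f => meas q fun b => (k b).bind f
  | ask m k, f => ask m fun r => (k r).bind f

instance : Monad Comp where
  pure := ret
  bind := bind

/-- `k`-fold iteration of `f`. -/
def iterate {α : Type} (f : α → Comp α) : ℕ → α → Comp α
  | 0, a => ret a
  | k + 1, a => (f a).bind (iterate f k)

open Classical in
/-- Probability, times the squared norm of the initial state, that the computation stops with a
result in the event `E`, if it starts when `next` qubits have been handed out and the memory is in
state `ψ`. Unanswered questions contribute nothing. -/
noncomputable def weight {α : Type} (E : α → Prop) : Comp α → (next : ℕ) → (ψ : Mem) → ℝ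
  | ret a, _, ψ => if E a then ψ.normSq else 0
  | tick _ k, next, ψ => k.weight E next ψ
  | coin k, next, ψ => ((k false).weight E next ψ + (k true).weight E next ψ) / 2
  | new k, next, ψ => (k next).weight E (next + 1) ψ
  | gate g k, next, ψ => k.weight E next (g.act ψ)
  | meas q k, next, ψ =>
      (k false).weight E next (ψ.project q false) + (k true).weight E next (ψ.project q true)
  | ask _ _, _, _ => 0

/-- Probability of the event `E` for a computation that starts with all qubits in state `|0⟩`. -/
noncomputable def prob {α : Type} (c : Comp α) (E : α → Prop) : ℝ :=
  c.weight E 0 (Finsupp.single ∅ 1)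

/-- All results that the computation can have, whatever the coin tosses, the measurement outcomes
and the replies, satisfy `E`. -/
def All {α : Type} (E : α → Prop) : Comp α → Prop
  | ret a => E a
  | tick _ k => k.All E
  | coin k => ∀ b, (k b).All E
  | new k => ∀ q, (k q).All E
  | gate _ k => k.All E
  | meas _ k => ∀ b, (k b).All E
  | ask _ k => ∀ r, (k r).All E

/-- The computation takes at most `t` time steps, whatever the coin tosses, the measurement
outcomes and the replies. -/
def TimeLE {α : Type} : Comp α → (t : ℕ) → Prop
  | ret _, _ => True
  | tick c k, t => c ≤ t ∧ k.TimeLE (t - c)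
  | coin k, t => ∀ b, (k b).TimeLE t
  | new k, t => ∀ q, (k q).TimeLE t
  | gate _ k, t => k.TimeLE t
  | meas _ k, t => ∀ b, (k b).TimeLE t
  | ask _ k, t => ∀ r, (k r).TimeLE t

/-- The messages that the computation sends obey the rules of a protocol, whatever the coin tosses,
the measurement outcomes and the replies: `move s m s'` says that in situation `s` the message `m`
is allowed and leads to situation `s'`. -/
def Obeys {α ρ : Type} (move : ρ → Val → ρ → Prop) : Comp α → (s : ρ) → Prop
  | ret _, _ => True
  | tick _ k, s => k.Obeys move s
  | coin k, s => ∀ b, (k b).Obeys move s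
  | new k, s => ∀ q, (k q).Obeys move s
  | gate _ k, s => k.Obeys move s
  | meas _ k, s => ∀ b, (k b).Obeys move s
  | ask m k, s => ∃ s', move s m s' ∧ ∀ r, (k r).Obeys move s'

/-- Interaction with a challenger, who answers the message `m` in state `s` by running
`respond s m`, which yields the reply and the challenger's next state. -/
def interact {α σ : Type} (respond : σ → Val → Comp (Val × σ)) : Comp α → (s : σ) → Comp α
  | ret a, _ => ret a
  | tick c k, s => tick c (k.interact respond s)
  | coin k, s => coin fun b => (k b).interact respond s
  | new k, s => new fun q => (k q).interact respond s
  | gate g k, s => gate g (k.interact respond s)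
  | meas q k, s => meas q fun b => (k b).interact respond s
  | ask m k, s => (respond s m).bind fun r => (k r.1).interact respond r.2

end Comp

/-! ## Programs -/

/-- A small uniform programming language: a classical machine with a cons memory that controls a
quantum memory (a quantum random access machine). A program maps an input value to an output
value. -/
inductive Prog : Type
  /-- return the input -/
  | id : Prog
  /-- left component -/
  | fst : Prog
  /-- right component -/
  | snd : Prog
  /-- the constant `nil` -/
  | nil : Prog
  /-- a constant bit -/
  | bit : Bool → Prog
  /-- is the input `nil`? -/
  | isNil : Prog
  /-- is the input a pair? -/
  | isPair : Prog
  /-- run the first program, and the second one on its output -/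
  | seq : Prog → Prog → Prog
  /-- run the first, then the second program, both on the input, and return the pair of outputs -/
  | fork : Prog → Prog → Prog
  /-- run the second or the third program on the input, as decided by the output of the first -/
  | ite : Prog → Prog → Prog → Prog
  /-- on input `(l, x)`, iterate the program on `x` as many times as the length of the list `l` -/
  | loop : Prog → Prog
  /-- toss a coin -/
  | coin : Prog
  /-- get a fresh qubit in state `|0⟩` -/
  | new : Prog
  /-- apply a Hadamard gate to the input qubit -/
  | had : Prog
  /-- apply a `T` gate to the input qubit -/
  | phase : Prog
  /-- apply a controlled NOT to the input pair of qubits -/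
  | cnot : Prog
  /-- measure the input qubit -/
  | meas : Prog
  /-- send the input to the other party and return the reply -/
  | ask : Prog

namespace Prog

/-- Semantics of programs, with the number of time steps. Every instruction takes one step (trees
are shared, not copied), and sending a message takes additional time equal to its size. Quantum
instructions whose input is not of the required form do nothing. -/
def eval : Prog → Val → Comp Val
  | id, v => .tick 1 (.ret v)
  | fst, v => .tick 1 (.ret v.fst)
  | snd, v => .tick 1 (.ret v.snd)
  | nil, _ => .tick 1 (.ret .nil)
  | bit b, _ => .tick 1 (.ret (.bit b))
  | isNil, .nil => .tick 1 (.ret (.bit true))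
  | isNil, _ => .tick 1 (.ret (.bit false))
  | isPair, .pair _ _ => .tick 1 (.ret (.bit true))
  | isPair, _ => .tick 1 (.ret (.bit false))
  | seq p q, v => .tick 1 ((p.eval v).bind q.eval)
  | fork p q, v => .tick 1 ((p.eval v).bind fun x => (q.eval v).bind fun y => .ret (.pair x y))
  | ite c p q, v => .tick 1 ((c.eval v).bind fun b => if b.isTrue then p.eval v else q.eval v)
  | loop p, v => .tick 1 (Comp.iterate p.eval v.fst.len v.snd)
  | coin, _ => .tick 1 (.coin fun b => .ret (.bit b))
  | new, _ => .tick 1 (.new fun q => .ret (.qubit q))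
  | had, .qubit q => .tick 1 (.gate (.had q) (.ret (.qubit q)))
  | had, v => .tick 1 (.ret v)
  | phase, .qubit q => .tick 1 (.gate (.phase q) (.ret (.qubit q)))
  | phase, v => .tick 1 (.ret v)
  | cnot, .pair (.qubit a) (.qubit b) =>
      .tick 1 (.gate (.cnot a b) (.ret (.pair (.qubit a) (.qubit b))))
  | cnot, v => .tick 1 (.ret v)
  | meas, .qubit q => .tick 1 (.meas q fun b => .ret (.bit b))
  | meas, v => .tick 1 (.ret v)
  | ask, v => .tick (1 + v.size) (.ask v .ret)

/-- Run a program on a tuple of arguments. -/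
def run (p : Prog) (args : List Val) : Comp Val := p.eval (.tuple args)

/-- The program does not communicate. -/
def IsClosed : Prog → Prop
  | ask => False
  | seq p q => p.IsClosed ∧ q.IsClosed
  | fork p q => p.IsClosed ∧ q.IsClosed
  | ite c p q => c.IsClosed ∧ p.IsClosed ∧ q.IsClosed
  | loop p => p.IsClosed
  | _ => True

/-- The program neither communicates nor uses the quantum memory (but it may toss coins). -/
def IsClassical : Prog → Prop
  | ask | new | had | phase | cnot | meas => False
  | seq p q => p.IsClassical ∧ q.IsClassical
  | fork p q => p.IsClassical ∧ q.IsClassical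
  | ite c p q => c.IsClassical ∧ p.IsClassical ∧ q.IsClassical
  | loop p => p.IsClassical
  | _ => True

/-- On all inputs, running time and size of the output are bounded by a polynomial in the size of
the input. (The security parameter is always part of the input, in unary.) -/
def PolyTime (p : Prog) : Prop :=
  ∃ t : Polynomial ℕ, ∀ v : Val,
    (p.eval v).TimeLE (t.eval v.size) ∧ (p.eval v).All fun w => w.size ≤ t.eval v.size

/-- Quantum polynomial time algorithms. -/
def QPT (p : Prog) : Prop := p.IsClosed ∧ p.PolyTime

/-- Classical probabilistic polynomial time algorithms. -/
def PPT (p : Prog) : Prop := p.IsClassical ∧ p.PolyTime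

/-- Interactive quantum polynomial time adversaries. The adversary is run on `1ⁿ` and a first
message of the challenger; its number of steps (which includes the length of the messages that it
sends) is bounded by a polynomial in `n`, whatever it receives. -/
def QPTAdversary (A : Prog) : Prop :=
  ∃ t : Polynomial ℕ, ∀ (n : ℕ) (x : Val), (A.run [.unary n, x]).TimeLE (t.eval n)

/-- Drop the first `k` components of a tuple. -/
def rest : ℕ → Prog
  | 0 => id
  | k + 1 => seq snd (rest k)

/-- The component number `k` (from `0`) of a tuple, if it is not the last one. -/
def arg (k : ℕ) : Prog := seq (rest k) fst

/-- Run programs one after the other on the same input and return the tuple of their outputs. -/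
def tuple : List Prog → Prog
  | [] => nil
  | [p] => p
  | p :: q :: l => fork p (tuple (q :: l))

end Prog

/-! ## Negligible functions, plaintext spaces, policies -/

/-- Negligible functions of the security parameter. -/
def Negligible (f : ℕ → ℝ) : Prop :=
  ∀ c : ℕ, ∃ N : ℕ, ∀ n : ℕ, N < n → f n < ((n : ℝ) ^ c)⁻¹

/-- A plaintext space, for every security parameter. -/
abbrev Space : Type := ℕ → Set (List Bool)

/-- The space `{0,1}^ℓ`. -/
def bitStrings (ℓ : ℕ → ℕ) : Space := fun n => {m | m.length = ℓ n}

/-- An attribute space, a policy space, and the evaluation of policies on attributes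
(`Sat n P X` means `P(X) = ⊤`). -/
structure PolicySystem where
  Attr : Space
  Policy : Space
  Sat : (n : ℕ) → (P X : List Bool) → Prop

/-! ## One-time secret key encryption with certified deletion

All algorithms get `1ⁿ` as first argument. Decryption returns `Val.some m` or, for `⊥`, something
else. Plaintexts, keys and certificates are classical, a ciphertext may contain qubits. -/

structure SKECD where
  /-- `(1ⁿ) ↦ sk` -/
  gen : Prog
  /-- `(1ⁿ, sk, m) ↦ ct` -/
  enc : Prog
  /-- `(1ⁿ, sk, ct) ↦ m or ⊥` -/
  dec : Prog
  /-- `(1ⁿ, ct) ↦ cert` -/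
  del : Prog
  /-- `(1ⁿ, sk, cert) ↦ ⊤ or ⊥` -/
  vrfy : Prog

namespace SKECD

open Val

/-- The algorithms are QPT, keys are in the key space `K`, certificates are classical. -/
structure WellFormed (S : SKECD) (K : Space) : Prop where
  gen : S.gen.QPT
  enc : S.enc.QPT
  dec : S.dec.QPT
  del : S.del.QPT
  vrfy : S.vrfy.QPT
  key : ∀ n, (S.gen.run [unary n]).All fun sk => ∃ k ∈ K n, sk = str k
  cert : ∀ n ct, (S.del.run [unary n, ct]).All fun c => c.IsClassical

def DecCorrect (S : SKECD) (M : Space) : Prop :=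
  ∃ ν : ℕ → ℝ, Negligible ν ∧ ∀ n, ∀ m ∈ M n,
    Comp.prob (do
        let sk ← S.gen.run [unary n]
        let ct ← S.enc.run [unary n, sk, str m]
        S.dec.run [unary n, sk, ct])
      (fun r => r ≠ .some (str m)) ≤ ν n

def VrfyCorrect (S : SKECD) (M : Space) : Prop :=
  ∃ ν : ℕ → ℝ, Negligible ν ∧ ∀ n, ∀ m ∈ M n,
    Comp.prob (do
        let sk ← S.gen.run [unary n]
        let ct ← S.enc.run [unary n, sk, str m]
        let cert ← S.del.run [unary n, ct]
        S.vrfy.run [unary n, sk, cert])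
      (fun r => r.isTrue = false) ≤ ν n

/-- The challenger: encrypts `m_b`; on a valid certificate, reveals the key. -/
def challenger (S : SKECD) (n : ℕ) (b : Bool) (sk : Val) : Unit → Val → Comp (Val × Unit)
  | _, .pair (.bit false) (.pair m₀ m₁) => do
      let ct ← S.enc.run [unary n, sk, if b then m₁ else m₀]
      return (ct, ())
  | _, .pair (.bit true) cert => do
      let v ← S.vrfy.run [unary n, sk, cert]
      return (if v.isTrue then .some sk else .bot, ())
  | _, _ => return (.bot, ())

/-- The one-time certified deletion experiment. -/
def experiment (S : SKECD) (A : Prog) (n : ℕ) (b : Bool) : Comp Bool := do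
  let sk ← S.gen.run [unary n]
  let r ← (A.run [unary n, .nil]).interact (S.challenger n b sk) ()
  return r.isTrue

/-- Phases of the experiment, as far as the adversary is concerned. -/
inductive Phase : Type
  | start
  | holding
  | deleted

/-- What the adversary may send: one challenge query, then one certificate. -/
inductive Move (M : Space) (n : ℕ) : Phase → Val → Phase → Prop
  | challenge (m₀ m₁ : List Bool) : m₀ ∈ M n → m₁ ∈ M n →
      Move M n .start (challenge (Val.tuple [str m₀, str m₁])) .holding
  | certificate (c : Val) : c.IsClassical →
      Move M n .holding (certificate c) .deleted

/-- OT-CD security. -/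
def OTCDSecure (S : SKECD) (M : Space) : Prop :=
  ∀ A : Prog, A.QPTAdversary →
    (∀ n x, (A.run [unary n, x]).Obeys (Move M n) .start) →
    Negligible fun n =>
      |(S.experiment A n false).prob (· = true) - (S.experiment A n true).prob (· = true)|

end SKECD

/-! ## Receiver non-committing attribute-based encryption -/

structure NCABE where
  /-- `(1ⁿ) ↦ (pk, msk)` -/
  setup : Prog
  /-- `(1ⁿ, msk, P) ↦ sk_P` -/
  keyGen : Prog
  /-- `(1ⁿ, pk, X, m) ↦ ct` -/
  enc : Prog
  /-- `(1ⁿ, sk_P, ct) ↦ m or ⊥` -/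
  dec : Prog
  /-- `(1ⁿ) ↦ (pk, aux)` -/
  fakeSetup : Prog
  /-- `(1ⁿ, pk, aux, P) ↦ sk` -/
  fakeSK : Prog
  /-- `(1ⁿ, pk, aux, X) ↦ ct` -/
  fakeCT : Prog
  /-- `(1ⁿ, pk, aux, ct, m) ↦ msk` -/
  reveal : Prog

namespace NCABE

open Val

/-- All algorithms are PPT. -/
structure WellFormed (S : NCABE) : Prop where
  setup : S.setup.PPT
  keyGen : S.keyGen.PPT
  enc : S.enc.PPT
  dec : S.dec.PPT
  fakeSetup : S.fakeSetup.PPT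
  fakeSK : S.fakeSK.PPT
  fakeCT : S.fakeCT.PPT
  reveal : S.reveal.PPT

/-- Correctness up to a negligible error (perfect correctness is the case `ν = 0`). -/
def Correct (S : NCABE) (V : PolicySystem) (M : Space) : Prop :=
  ∃ ν : ℕ → ℝ, Negligible ν ∧ ∀ n, ∀ m ∈ M n, ∀ P ∈ V.Policy n, ∀ X ∈ V.Attr n, V.Sat n P X →
    Comp.prob (do
        let k ← S.setup.run [unary n]
        let sk ← S.keyGen.run [unary n, k.snd, str P]
        let ct ← S.enc.run [unary n, k.fst, str X, str m]
        S.dec.run [unary n, sk, ct])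
      (fun r => r ≠ .some (str m)) ≤ ν n

/-- The challenger in the real experiment. -/
def realChallenger (S : NCABE) (n : ℕ) (pk msk : Val) : Unit → Val → Comp (Val × Unit)
  | _, .pair .nil P => do
      let sk ← S.keyGen.run [unary n, msk, P]
      return (sk, ())
  | _, .pair (.bit false) (.pair X m) => do
      let ct ← S.enc.run [unary n, pk, X, m]
      return (.pair ct msk, ())
  | _, _ => return (.bot, ())

/-- The challenger in the fake experiment. -/
def fakeChallenger (S : NCABE) (n : ℕ) (pk aux : Val) : Unit → Val → Comp (Val × Unit)
  | _, .pair .nil P => do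
      let sk ← S.fakeSK.run [unary n, pk, aux, P]
      return (sk, ())
  | _, .pair (.bit false) (.pair X m) => do
      let ct ← S.fakeCT.run [unary n, pk, aux, X]
      let msk ← S.reveal.run [unary n, pk, aux, ct, m]
      return (.pair ct msk, ())
  | _, _ => return (.bot, ())

/-- The RNC experiment, real for `b = 0` and fake for `b = 1`. -/
def experiment (S : NCABE) (A : Prog) (n : ℕ) : (b : Bool) → Comp Bool
  | false => do
      let k ← S.setup.run [unary n]
      let r ← (A.run [unary n, k.fst]).interact (S.realChallenger n k.fst k.snd) ()
      return r.isTrue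
  | true => do
      let k ← S.fakeSetup.run [unary n]
      let r ← (A.run [unary n, k.fst]).interact (S.fakeChallenger n k.fst k.snd) ()
      return r.isTrue

/-- Phases of the experiment: before the challenge query, with the list of the policies queried so
far, and after it, with the target attribute. -/
inductive Phase : Type
  | start (queried : List (List Bool))
  | challenged (X : List Bool)

/-- What the adversary may send: key queries and one challenge query `(X, m)`, where no queried
policy is satisfied by `X`. -/
inductive Move (V : PolicySystem) (M : Space) (n : ℕ) : Phase → Val → Phase → Prop
  | key₁ (Q : List (List Bool)) (P : List Bool) : P ∈ V.Policy n →
      Move V M n (.start Q) (keyQuery (str P)) (.start (P :: Q))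
  | challenge (Q : List (List Bool)) (X m : List Bool) : X ∈ V.Attr n → m ∈ M n →
      (∀ P ∈ Q, ¬ V.Sat n P X) →
      Move V M n (.start Q) (challenge (Val.tuple [str X, str m])) (.challenged X)
  | key₂ (X P : List Bool) : P ∈ V.Policy n → ¬ V.Sat n P X →
      Move V M n (.challenged X) (keyQuery (str P)) (.challenged X)

/-- RNC security. -/
def RNCSecure (S : NCABE) (V : PolicySystem) (M : Space) : Prop :=
  ∀ A : Prog, A.QPTAdversary →
    (∀ n x, (A.run [unary n, x]).Obeys (Move V M n) (.start [])) →
    Negligible fun n =>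
      |(S.experiment A n false).prob (· = true) - (S.experiment A n true).prob (· = true)|

end NCABE

/-! ## Attribute-based encryption with certified deletion -/

structure ABECD where
  /-- `(1ⁿ) ↦ (pk, msk)` -/
  setup : Prog
  /-- `(1ⁿ, msk, P) ↦ sk_P` -/
  keyGen : Prog
  /-- `(1ⁿ, pk, X, m) ↦ (vk, ct)` -/
  enc : Prog
  /-- `(1ⁿ, sk_P, ct) ↦ m or ⊥` -/
  dec : Prog
  /-- `(1ⁿ, ct) ↦ cert` -/
  del : Prog
  /-- `(1ⁿ, vk, cert) ↦ ⊤ or ⊥` -/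
  vrfy : Prog

namespace ABECD

open Val

/-- The algorithms are QPT; keys, verification keys and certificates are classical. -/
structure WellFormed (S : ABECD) (V : PolicySystem) (M : Space) : Prop where
  setup : S.setup.QPT
  keyGen : S.keyGen.QPT
  enc : S.enc.QPT
  dec : S.dec.QPT
  del : S.del.QPT
  vrfy : S.vrfy.QPT
  keys : ∀ n, (S.setup.run [unary n]).All fun k => k.IsClassical
  policyKey : ∀ n msk, msk.IsClassical → ∀ P ∈ V.Policy n,
    (S.keyGen.run [unary n, msk, str P]).All fun sk => sk.IsClassical
  verificationKey : ∀ n pk, pk.IsClassical → ∀ X ∈ V.Attr n, ∀ m ∈ M n,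
    (S.enc.run [unary n, pk, str X, str m]).All fun r => r.fst.IsClassical
  cert : ∀ n ct, (S.del.run [unary n, ct]).All fun c => c.IsClassical

def DecCorrect (S : ABECD) (V : PolicySystem) (M : Space) : Prop :=
  ∃ ν : ℕ → ℝ, Negligible ν ∧ ∀ n, ∀ m ∈ M n, ∀ P ∈ V.Policy n, ∀ X ∈ V.Attr n, V.Sat n P X →
    Comp.prob (do
        let k ← S.setup.run [unary n]
        let sk ← S.keyGen.run [unary n, k.snd, str P]
        let r ← S.enc.run [unary n, k.fst, str X, str m]
        S.dec.run [unary n, sk, r.snd])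
      (fun r => r ≠ .some (str m)) ≤ ν n

def VrfyCorrect (S : ABECD) (V : PolicySystem) (M : Space) : Prop :=
  ∃ ν : ℕ → ℝ, Negligible ν ∧ ∀ n, ∀ X ∈ V.Attr n, ∀ m ∈ M n,
    Comp.prob (do
        let k ← S.setup.run [unary n]
        let r ← S.enc.run [unary n, k.fst, str X, str m]
        let cert ← S.del.run [unary n, r.snd]
        S.vrfy.run [unary n, r.fst, cert])
      (fun r => r.isTrue = false) ≤ ν n

/-- The challenger: answers key queries, encrypts `m_b` and keeps the verification key; on a valid
certificate, reveals the master secret key. -/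
def challenger (S : ABECD) (n : ℕ) (b : Bool) (pk msk : Val) :
    (vk : Option Val) → Val → Comp (Val × Option Val)
  | s, .pair .nil P => do
      let sk ← S.keyGen.run [unary n, msk, P]
      return (sk, s)
  | _, .pair (.bit false) (.pair X (.pair m₀ m₁)) => do
      let r ← S.enc.run [unary n, pk, X, if b then m₁ else m₀]
      return (r.snd, Option.some r.fst)
  | Option.some vk, .pair (.bit true) cert => do
      let v ← S.vrfy.run [unary n, vk, cert]
      return (if v.isTrue then .some msk else .bot, Option.some vk)
  | s, _ => return (.bot, s)

/-- The IND-CPA-CD experiment. -/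
def experiment (S : ABECD) (A : Prog) (n : ℕ) (b : Bool) : Comp Bool := do
  let k ← S.setup.run [unary n]
  let r ← (A.run [unary n, k.fst]).interact (S.challenger n b k.fst k.snd) none
  return r.isTrue

/-- Phases of the experiment: before the challenge query, with the list of the policies queried so
far; between challenge query and certificate; after the certificate. -/
inductive Phase : Type
  | start (queried : List (List Bool))
  | holding (X : List Bool)
  | deleted (X : List Bool)

/-- What the adversary may send: key queries, one challenge query `(X, m₀, m₁)`, and after it one
certificate, where no queried policy is satisfied by `X`. -/
inductive Move (V : PolicySystem) (M : Space) (n : ℕ) : Phase → Val → Phase → Prop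
  | key₁ (Q : List (List Bool)) (P : List Bool) : P ∈ V.Policy n →
      Move V M n (.start Q) (keyQuery (str P)) (.start (P :: Q))
  | challenge (Q : List (List Bool)) (X m₀ m₁ : List Bool) : X ∈ V.Attr n → m₀ ∈ M n → m₁ ∈ M n →
      (∀ P ∈ Q, ¬ V.Sat n P X) →
      Move V M n (.start Q) (challenge (Val.tuple [str X, str m₀, str m₁])) (.holding X)
  | key₂ (X P : List Bool) : P ∈ V.Policy n → ¬ V.Sat n P X →
      Move V M n (.holding X) (keyQuery (str P)) (.holding X)
  | certificate (X : List Bool) (c : Val) : c.IsClassical →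
      Move V M n (.holding X) (certificate c) (.deleted X)
  | key₃ (X P : List Bool) : P ∈ V.Policy n → ¬ V.Sat n P X →
      Move V M n (.deleted X) (keyQuery (str P)) (.deleted X)

/-- IND-CPA-CD security (adaptive, with any number of key queries that the adversary's running time
allows). -/
def INDCPACDSecure (S : ABECD) (V : PolicySystem) (M : Space) : Prop :=
  ∀ A : Prog, A.QPTAdversary →
    (∀ n x, (A.run [unary n, x]).Obeys (Move V M n) (.start [])) →
    Negligible fun n =>
      |(S.experiment A n false).prob (· = true) - (S.experiment A n true).prob (· = true)|

end ABECD

/-! ## The hybrid construction -/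

open Prog in
/-- Hybrid encryption: the plaintext is encrypted under a fresh key `sk` of the one-time scheme, and
`sk` is encrypted under the non-committing ABE scheme. The verification key is `sk`. -/
def hybrid (nce : NCABE) (ske : SKECD) : ABECD where
  setup := nce.setup
  keyGen := nce.keyGen
  -- input `(1ⁿ, pk, X, m)`; then `(sk, 1ⁿ, pk, X, m)`; then `(sk, (nce.ct, ske.ct))`
  enc := seq (fork (seq (arg 0) ske.gen) id)
    (tuple [arg 0,
      seq (tuple [arg 1, arg 2, arg 3, arg 0]) nce.enc,
      seq (tuple [arg 1, arg 0, rest 4]) ske.enc])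
  -- input `(1ⁿ, sk_P, (nce.ct, ske.ct))`; then `(nce.dec output, 1ⁿ, sk_P, (nce.ct, ske.ct))`
  dec := seq (fork (seq (tuple [arg 0, arg 1, seq (rest 2) fst]) nce.dec) id)
    (ite (seq (arg 0) fst)
      (seq (tuple [arg 1, seq (arg 0) snd, seq (rest 3) snd]) ske.dec)
      (fork (bit false) nil))
  -- input `(1ⁿ, (nce.ct, ske.ct))`
  del := seq (tuple [arg 0, seq (rest 1) snd]) ske.del
  vrfy := ske.vrfy

end CertDel

open CertDel

namespace CertDel

/-! ## Computations: monad laws, time steps, expectations -/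

namespace Comp

variable {α β γ : Type}

/-! Security is a chain of games. Given an adversary `A` against the hybrid scheme and a bit `b`,
`nceAdversary` plays the RNC game: it forwards key queries, samples the one-time key at the
challenge, has that key encrypted by its challenger, encrypts `m_b` under it, checks the certificate
itself and then hands out the master key it was given. Against the real challenger this is exactly
the IND-CPA-CD game (`prob_hybrid_experiment`). RNC security replaces the real challenger by the
fake one, for each of the two bits.

In the fake game the non-committing ciphertext no longer depends on the one-time key. The key enters
only through `Reveal`, whose output is needed only after a valid certificate, which is when the
OT-CD challenger releases the key. Hence `skeAdversary`, which runs the fake algorithms itself and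
leaves encryption and verification to its challenger, produces the same game
(`prob_fake_experiment`). OT-CD security then exchanges `m_0` and `m_1`. The advantage is at most
the sum of two RNC advantages and one OT-CD advantage (`hybrid_secure`).

The second identity needs two changes of order. `Reveal` moves from the challenge to the
certificate; it is classical, so it commutes with everything in between (`Comp.Classic.wp_wp_comm`,
`weight_lazy_holding`, `weight_eager_start`). Key generation moves from the challenge to the very
beginning (`weight_lazy_start`); it may be quantum and leave qubits behind, but its output is a
classical string, so it acts as a mere sampler (`Comp.weight_bind_eq_expect`). The reason is that
programs cannot see addresses (`Prog.ren_eval`): up to a renaming of qubits, the leftovers are a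
tensor factor that the rest of the game never touches (`Comp.Ren.wp_eq`, `Mem.normSq_tens`).

Both reductions must be programs that run in polynomial time whatever they receive. `Prog.sim` turns
`A` and a program answering its messages into one program, and `Prog.timeLE_sim` charges the
overhead to the steps of `A`. Since the one-time key released by an arbitrary interlocutor might be
huge, it is truncated before `Reveal` is run on it (`Prog.exists_copy`).

Correctness of decryption is a union bound over failures of the two schemes. Correctness of
verification holds because the classical steps of the non-committing scheme, whose outputs are
ignored there, can be dropped. -/

@[simp] theorem ret_bind (a : α) (f : α → Comp β) : (ret a).bind f = f a := rfl

@[simp] theorem bind_ret (c : Comp α) : c.bind ret = c := by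
  induction c <;> simp_all [-Bool.forall_bool, bind]

@[simp] theorem bind_assoc (c : Comp α) (f : α → Comp β) (g : β → Comp γ) :
    (c.bind f).bind g = c.bind fun a => (f a).bind g := by
  induction c <;> simp_all [-Bool.forall_bool, bind]

@[simp] theorem monad_bind_eq (c : Comp α) (f : α → Comp β) : (c >>= f) = c.bind f := rfl

@[simp] theorem monad_pure_eq (a : α) : (pure a : Comp α) = ret a := rfl

/-- Remove the time steps. -/
def strip : Comp α → Comp α
  | ret a => ret a
  | tick _ k => k.strip
  | coin k => coin fun b => (k b).strip
  | new k => new fun q => (k q).strip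
  | gate g k => gate g k.strip
  | meas q k => meas q fun b => (k b).strip
  | ask m k => ask m fun r => (k r).strip

@[simp] theorem strip_bind (c : Comp α) (f : α → Comp β) :
    (c.bind f).strip = c.strip.bind fun a => (f a).strip := by
  induction c <;> simp_all [-Bool.forall_bool, bind, strip]

theorem strip_iterate (f : α → Comp α) (k : ℕ) (a : α) :
    (iterate f k a).strip = iterate (fun x => (f x).strip) k a := by
  induction k generalizing a with
  | zero => rfl
  | succ k ih => simp [iterate, ih]

/-- Simulations take more steps than what they simulate, so games can be equal only once the time
steps are removed. -/
theorem strip_interact {σ : Type} (respond : σ → Val → Comp (Val × σ)) (c : Comp α) (s : σ) :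
    (c.interact respond s).strip = c.strip.interact (fun s m => (respond s m).strip) s := by
  induction c generalizing s <;> simp_all [-Bool.forall_bool, interact, strip]

theorem interact_bind_ret {σ : Type} (respond : σ → Val → Comp (Val × σ)) (c : Comp α) (s : σ)
    (f : α → β) :
    (c.bind fun a => ret (f a)).interact respond s
      = (c.interact respond s).bind fun a => ret (f a) := by
  induction c generalizing s <;> simp_all [-Bool.forall_bool, interact, bind]

/-- A challenger with a proper state would have to pass its final state on to `f`; with the trivial
state nothing has to be passed. -/
theorem interact_bind_of_unit (respond : Unit → Val → Comp (Val × Unit)) (c : Comp α)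
    (f : α → Comp β) :
    (c.bind f).interact respond ()
      = (c.interact respond ()).bind fun a => (f a).interact respond () := by
  induction c <;> simp_all [-Bool.forall_bool, interact, bind]

/-- Two layers of interaction, the outer one stateless, amount to a single one. -/
theorem interact_interact {σ : Type} (outer : Unit → Val → Comp (Val × Unit))
    (inner : σ → Val → Comp (Val × σ)) (c : Comp α) (s : σ) :
    (c.interact inner s).interact outer ()
      = c.interact (fun s m => (inner s m).interact outer ()) s := by
  induction c generalizing s <;> simp_all [-Bool.forall_bool, interact, interact_bind_of_unit]

/-- The computation sends no messages. -/
def Silent : Comp α → Prop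
  | ret _ => True
  | tick _ k => k.Silent
  | coin k => ∀ b, (k b).Silent
  | new k => ∀ q, (k q).Silent
  | gate _ k => k.Silent
  | meas _ k => ∀ b, (k b).Silent
  | ask _ _ => False

theorem Silent.bind {c : Comp α} {f : α → Comp β} (hc : c.Silent) (hf : ∀ a, (f a).Silent) :
    (c.bind f).Silent := by
  induction c <;> simp_all [-Bool.forall_bool, Comp.bind, Silent]

theorem Silent.iterate {f : α → Comp α} (hf : ∀ a, (f a).Silent) (k : ℕ) (a : α) :
    (iterate f k a).Silent := by
  induction k generalizing a with
  | zero => trivial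
  | succ k ih => exact (hf a).bind ih

theorem Silent.strip {c : Comp α} (hc : c.Silent) : c.strip.Silent := by
  induction c <;> simp_all [-Bool.forall_bool, Comp.strip, Silent]

theorem Silent.interact_bind {σ : Type} {respond : σ → Val → Comp (Val × σ)} {c : Comp α}
    (hc : c.Silent) (f : α → Comp β) (s : σ) :
    (c.bind f).interact respond s = c.bind fun a => (f a).interact respond s := by
  induction c <;> simp_all [-Bool.forall_bool, interact, Comp.bind, Silent]

/-- The computation is classical: it only tosses coins. -/
def Classic : Comp α → Prop
  | ret _ => True
  | tick _ k => k.Classic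
  | coin k => ∀ b, (k b).Classic
  | _ => False

theorem Classic.silent {c : Comp α} (hc : c.Classic) : c.Silent := by
  induction c <;> simp_all [-Bool.forall_bool, Classic, Silent]

theorem Classic.bind {c : Comp α} {f : α → Comp β} (hc : c.Classic) (hf : ∀ a, (f a).Classic) :
    (c.bind f).Classic := by
  induction c <;> simp_all [-Bool.forall_bool, Comp.bind, Classic]

theorem Classic.iterate {f : α → Comp α} (hf : ∀ a, (f a).Classic) (k : ℕ) (a : α) :
    (iterate f k a).Classic := by
  induction k generalizing a with
  | zero => trivial
  | succ k ih => exact (hf a).bind ih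

theorem Classic.strip {c : Comp α} (hc : c.Classic) : c.strip.Classic := by
  induction c <;> simp_all [-Bool.forall_bool, Comp.strip, Classic]

/-! ### Results -/

theorem All.mono {E F : α → Prop} (h : ∀ a, E a → F a) {c : Comp α} (hc : c.All E) : c.All F := by
  induction c <;> simp_all [All]

theorem All.and {E F : α → Prop} {c : Comp α} (hE : c.All E) (hF : c.All F) :
    c.All fun a => E a ∧ F a := by
  induction c <;> simp_all [All]

theorem All.bind {E : α → Prop} {F : β → Prop} {c : Comp α} {f : α → Comp β} (hc : c.All E)
    (hf : ∀ a, E a → (f a).All F) : (c.bind f).All F := by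
  induction c <;> simp_all [Comp.bind, All]

theorem all_true (c : Comp α) : c.All fun _ => True := by
  induction c <;> simp_all [All]

theorem all_strip {E : α → Prop} {c : Comp α} : c.strip.All E ↔ c.All E := by
  induction c <;> simp_all [All, strip]

theorem All.iterate {E : α → Prop} {f : α → Comp α} (hf : ∀ a, E a → (f a).All E) (k : ℕ) {a : α}
    (ha : E a) : (iterate f k a).All E := by
  induction k generalizing a with
  | zero => exact ha
  | succ k ih => exact (hf a ha).bind fun b hb => ih hb

theorem TimeLE.mono {c : Comp α} {s t : ℕ} (h : s ≤ t) (hc : c.TimeLE s) : c.TimeLE t := by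
  induction c generalizing s t with
  | ret a => trivial
  | tick d k ih => exact ⟨hc.1.trans h, ih (Nat.sub_le_sub_right h d) hc.2⟩
  | coin k ih => exact fun b => ih b h (hc b)
  | new k ih => exact fun b => ih b h (hc b)
  | gate g k ih => exact ih h hc
  | meas q k ih => exact fun b => ih b h (hc b)
  | ask m k ih => exact fun b => ih b h (hc b)

theorem TimeLE.bind {E : α → Prop} {c : Comp α} {f : α → Comp β} {s t : ℕ} (hc : c.TimeLE s)
    (hE : c.All E) (hf : ∀ a, E a → (f a).TimeLE t) : (c.bind f).TimeLE (s + t) := by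
  induction c generalizing s with
  | ret a => exact (hf a hE).mono (by omega)
  | tick d k ih =>
    refine ⟨hc.1.trans (by omega), (ih hc.2 hE).mono ?_⟩
    have := hc.1
    omega
  | coin k ih => exact fun b => ih b (hc b) (hE b)
  | new k ih => exact fun b => ih b (hc b) (hE b)
  | gate g k ih => exact ih hc hE
  | meas q k ih => exact fun b => ih b (hc b) (hE b)
  | ask m k ih => exact fun b => ih b (hc b) (hE b)

/-- Bounds for the running time and for the result of a computation. -/
def Bounded (c : Comp α) (t : ℕ) (E : α → Prop) : Prop := c.TimeLE t ∧ c.All E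

theorem Bounded.mono {c : Comp α} {s t : ℕ} {E F : α → Prop} (hc : c.Bounded s E) (hst : s ≤ t)
    (hEF : ∀ a, E a → F a) : c.Bounded t F :=
  ⟨hc.1.mono hst, hc.2.mono hEF⟩

theorem Bounded.bind {c : Comp α} {f : α → Comp β} {s t : ℕ} {E : α → Prop} {F : β → Prop}
    (hc : c.Bounded s E) (hf : ∀ a, E a → (f a).Bounded t F) : (c.bind f).Bounded (s + t) F :=
  ⟨hc.1.bind hc.2 fun a ha => (hf a ha).1, hc.2.bind fun a ha => (hf a ha).2⟩

theorem Bounded.tick {c : Comp α} {t d : ℕ} {E : α → Prop} (hc : c.Bounded t E) :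
    (Comp.tick d c).Bounded (d + t) E :=
  ⟨⟨by omega, hc.1.mono (by omega)⟩, hc.2⟩

theorem Bounded.ret {a : α} {t : ℕ} {E : α → Prop} (ha : E a) : (Comp.ret a).Bounded t E :=
  ⟨trivial, ha⟩

/-! ### Expectations -/

/-- Expectation (times the squared norm of the initial state) of a function of the result and of the
final quantum memory. -/
noncomputable def wp (post : α → ℕ → Mem → ℝ) : Comp α → (next : ℕ) → (ψ : Mem) → ℝ
  | ret a, next, ψ => post a next ψ
  | tick _ k, next, ψ => k.wp post next ψ
  | coin k, next, ψ => ((k false).wp post next ψ + (k true).wp post next ψ) / 2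
  | new k, next, ψ => (k next).wp post (next + 1) ψ
  | gate g k, next, ψ => k.wp post next (g.act ψ)
  | meas q k, next, ψ =>
      (k false).wp post next (ψ.project q false) + (k true).wp post next (ψ.project q true)
  | ask _ _, _, _ => 0

-- The postcondition of `wp` sees the counter and the final memory as well as the result, so that
-- sequential composition becomes substitution of postconditions (`wp_bind`, `weight_bind`). All
-- rearrangements of games are done in this form.
open Classical in
theorem weight_eq_wp (E : α → Prop) (c : Comp α) (n : ℕ) (ψ : Mem) :
    c.weight E n ψ = c.wp (fun a _ φ => if E a then φ.normSq else 0) n ψ := by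
  induction c generalizing n ψ <;> simp_all [weight, wp]

theorem wp_bind (post : β → ℕ → Mem → ℝ) (c : Comp α) (f : α → Comp β) :
    (c.bind f).wp post = c.wp (fun a => (f a).wp post) := by
  funext n ψ
  induction c generalizing n ψ <;> simp_all [bind, wp]

theorem weight_bind (E : β → Prop) (c : Comp α) (f : α → Comp β) :
    (c.bind f).weight E = c.wp (fun a => (f a).weight E) := by
  funext n ψ
  simp only [weight_eq_wp, wp_bind]
  congr 1
  funext a m φ
  rw [weight_eq_wp]

theorem wp_strip (post : α → ℕ → Mem → ℝ) (c : Comp α) (n : ℕ) (ψ : Mem) :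
    c.strip.wp post n ψ = c.wp post n ψ := by
  induction c generalizing n ψ <;> simp_all [strip, wp]

theorem weight_strip (E : α → Prop) (c : Comp α) (n : ℕ) (ψ : Mem) :
    c.strip.weight E n ψ = c.weight E n ψ := by
  simp only [weight_eq_wp, wp_strip]

theorem prob_strip (E : α → Prop) (c : Comp α) : c.strip.prob E = c.prob E :=
  weight_strip ..

theorem wp_add (f g : α → ℕ → Mem → ℝ) (c : Comp α) (n : ℕ) (ψ : Mem) :
    c.wp (fun a m φ => f a m φ + g a m φ) n ψ = c.wp f n ψ + c.wp g n ψ := by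
  induction c generalizing n ψ <;> simp_all [wp] <;> ring

theorem wp_mul_left (x : ℝ) (f : α → ℕ → Mem → ℝ) (c : Comp α) (n : ℕ) (ψ : Mem) :
    c.wp (fun a m φ => x * f a m φ) n ψ = x * c.wp f n ψ := by
  induction c generalizing n ψ <;> simp_all [wp] <;> ring

theorem wp_zero (c : Comp α) (n : ℕ) (ψ : Mem) : c.wp (fun _ _ _ => 0) n ψ = 0 := by
  induction c generalizing n ψ <;> simp_all [wp]

theorem wp_div_two (f : α → ℕ → Mem → ℝ) (c : Comp α) (n : ℕ) (ψ : Mem) :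
    c.wp (fun a m φ => f a m φ / 2) n ψ = c.wp f n ψ / 2 := by
  simpa [div_eq_inv_mul] using wp_mul_left 2⁻¹ f c n ψ

/-- Independent computations can be exchanged. -/
theorem wp_comm (f : α → ℕ → Mem → β → ℕ → Mem → ℝ) (c : Comp α) (d : Comp β) (n m : ℕ)
    (ψ χ : Mem) :
    c.wp (fun a i φ => d.wp (f a i φ) m χ) n ψ
      = d.wp (fun b j φ => c.wp (fun a i ξ => f a i ξ b j φ) n ψ) m χ := by
  induction c generalizing n ψ <;> simp_all [wp, wp_add, wp_div_two, wp_zero]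

theorem wp_mono_of_all {E : α → Prop} {f g : α → ℕ → Mem → ℝ}
    (h : ∀ a n ψ, E a → f a n ψ ≤ g a n ψ) {c : Comp α} (hc : c.All E) (n : ℕ) (ψ : Mem) :
    c.wp f n ψ ≤ c.wp g n ψ := by
  induction c generalizing n ψ with
  | ret a => exact h _ _ _ hc
  | tick d k ih => exact ih hc n ψ
  | coin k ih =>
    have h1 := ih false (hc false) n ψ
    have h2 := ih true (hc true) n ψ
    simp only [wp]
    linarith
  | new k ih => exact ih n (hc n) (n + 1) ψ
  | gate g k ih => exact ih hc n _
  | meas q k ih => exact add_le_add (ih false (hc false) n _) (ih true (hc true) n _)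
  | ask m k ih => exact le_rfl

theorem wp_mono {f g : α → ℕ → Mem → ℝ} (h : ∀ a n ψ, f a n ψ ≤ g a n ψ) (c : Comp α) (n : ℕ)
    (ψ : Mem) : c.wp f n ψ ≤ c.wp g n ψ :=
  wp_mono_of_all (fun a n ψ _ => h a n ψ) c.all_true n ψ

/-- A classical computation is independent of the quantum memory. -/
theorem Classic.wp_eq {c : Comp α} (hc : c.Classic) (post : α → ℕ → Mem → ℝ) (n m : ℕ)
    (ψ χ : Mem) : c.wp post n ψ = c.wp (fun a _ _ => post a n ψ) m χ := by
  induction c <;> simp_all [wp, Classic]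

theorem Classic.wp_const {c : Comp α} (hc : c.Classic) (x : ℝ) (n : ℕ) (ψ : Mem) :
    c.wp (fun _ _ _ => x) n ψ = x := by
  induction c <;> simp_all [wp, Classic]

/-- A classical computation can be moved past any computation. -/
theorem Classic.wp_wp_comm {c : Comp α} (hc : c.Classic) (d : Comp β)
    (f : α → β → ℕ → Mem → ℝ) (n : ℕ) (ψ : Mem) :
    c.wp (fun a => d.wp (f a)) n ψ = d.wp (fun b m φ => c.wp (fun a => f a b) m φ) n ψ := by
  -- Being classical, `c` may be run on the dummy memory `0`; then it shares nothing with `d` and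
  -- the two expectations can be exchanged.
  have h : ∀ b m φ, c.wp (fun a => f a b) m φ = c.wp (fun a _ _ => f a b m φ) 0 0 :=
    fun b m φ => hc.wp_eq _ m 0 φ 0
  simp only [h]
  rw [hc.wp_eq _ n 0 ψ 0]
  exact wp_comm (fun a _ _ b m φ => f a b m φ) c d 0 n 0 ψ

end Comp

/-! ## Quantum memory: norms and tensor products -/

theorem Gate.act_eq (g : Gate) (ψ : Mem) : g.act ψ = Finsupp.linearCombination ℂ g.onBasis ψ := rfl

@[simp] theorem Gate.act_single (g : Gate) (s : Finset ℕ) (a : ℂ) :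
    g.act (Finsupp.single s a) = a • g.onBasis s := by
  simp [Gate.act_eq]

@[simp] theorem Gate.act_add (g : Gate) (ψ φ : Mem) : g.act (ψ + φ) = g.act ψ + g.act φ := by
  simp [Gate.act_eq]

@[simp] theorem Gate.act_zero (g : Gate) : g.act 0 = 0 := by
  simp [Gate.act_eq]

@[simp] theorem Gate.act_smul (g : Gate) (a : ℂ) (ψ : Mem) : g.act (a • ψ) = a • g.act ψ := by
  simp [Gate.act_eq]

namespace Mem

@[simp] theorem project_add (q : ℕ) (b : Bool) (ψ φ : Mem) :
    (ψ + φ).project q b = ψ.project q b + φ.project q b := Finsupp.filter_add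

@[simp] theorem project_smul (q : ℕ) (b : Bool) (a : ℂ) (ψ : Mem) :
    project q b (a • ψ) = a • ψ.project q b := Finsupp.filter_smul

@[simp] theorem project_zero (q : ℕ) (b : Bool) : project q b 0 = 0 := Finsupp.filter_zero _

theorem project_single (q : ℕ) (b : Bool) (s : Finset ℕ) (a : ℂ) :
    project q b (Finsupp.single s a) = if decide (q ∈ s) = b then Finsupp.single s a else 0 := by
  split_ifs with h
  · exact Finsupp.filter_single_of_pos _ h
  · exact Finsupp.filter_single_of_neg _ h

theorem normSq_eq_sum {F : Finset (Finset ℕ)} {ψ : Mem} (h : ψ.support ⊆ F) :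
    ψ.normSq = ∑ s ∈ F, ‖ψ s‖ ^ 2 :=
  Finsupp.sum_of_support_subset _ h _ (by simp)

theorem normSq_nonneg (ψ : Mem) : 0 ≤ ψ.normSq := Finset.sum_nonneg fun _ _ => by positivity

theorem normSq_single (s : Finset ℕ) (a : ℂ) : normSq (Finsupp.single s a) = ‖a‖ ^ 2 := by
  simp [normSq]

@[simp] theorem normSq_zero : normSq 0 = 0 := by simp [normSq]

theorem normSq_add_of_disjoint {ψ φ : Mem} (h : Disjoint ψ.support φ.support) :
    (ψ + φ).normSq = ψ.normSq + φ.normSq :=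
  Finsupp.sum_add_index_of_disjoint h _

theorem normSq_smul (a : ℂ) (ψ : Mem) : normSq (a • ψ) = ‖a‖ ^ 2 * ψ.normSq := by
  rw [normSq_eq_sum (F := ψ.support) Finsupp.support_smul, normSq_eq_sum (subset_refl ψ.support),
    Finset.mul_sum]
  simp [mul_pow]

theorem normSq_mapDomain {e : Finset ℕ → Finset ℕ} (he : Function.Injective e) (ψ : Mem) :
    normSq (Finsupp.mapDomain e ψ) = ψ.normSq :=
  Finsupp.sum_mapDomain_index_inj he

theorem normSq_project (q : ℕ) (ψ : Mem) :
    (ψ.project q false).normSq + (ψ.project q true).normSq = ψ.normSq := by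
  rw [← normSq_add_of_disjoint]
  · congr 1
    ext s
    by_cases h : q ∈ s <;> simp [project, h]
  · refine Finset.disjoint_left.2 fun s hs ht => ?_
    simp only [project, Finsupp.support_filter, Finset.mem_filter] at hs ht
    simp_all

end Mem

/-! ### Bit flips and unitarity of the gates -/

/-- Flip the value of a qubit in a basis vector. -/
def flip (q : ℕ) (s : Finset ℕ) : Finset ℕ := symmDiff s {q}

theorem mem_flip {q r : ℕ} {s : Finset ℕ} : r ∈ flip q s ↔ (r ∈ s ↔ r ≠ q) := by
  simp only [flip, Finset.mem_symmDiff, Finset.mem_singleton]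
  tauto

theorem flip_flip (q : ℕ) (s : Finset ℕ) : flip q (flip q s) = s := by
  ext r
  simp only [mem_flip]
  tauto

theorem flip_eq_iff {q : ℕ} {s t : Finset ℕ} : flip q s = t ↔ s = flip q t := by
  constructor <;> rintro rfl <;> simp [flip_flip]

theorem erase_eq_flip {q : ℕ} {s : Finset ℕ} (h : q ∈ s) : s.erase q = flip q s := by
  ext r
  by_cases hr : r = q <;> simp_all [mem_flip]

theorem insert_eq_flip {q : ℕ} {s : Finset ℕ} (h : q ∉ s) : insert q s = flip q s := by
  ext r
  by_cases hr : r = q <;> simp_all [mem_flip]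

theorem Gate.onBasis_had (q : ℕ) (s : Finset ℕ) :
    (Gate.had q).onBasis s = Finsupp.single (flip q s) ((1 / Real.sqrt 2 : ℝ) : ℂ)
      + (if q ∈ s then -1 else 1 : ℂ) • Finsupp.single s ((1 / Real.sqrt 2 : ℝ) : ℂ) := by
  by_cases h : q ∈ s
  · simp only [Gate.onBasis, h, if_true, erase_eq_flip h, sub_eq_add_neg, neg_one_smul]
  · simp only [Gate.onBasis, h, if_false, insert_eq_flip h, one_smul, add_comm]

theorem Gate.act_had_apply (q : ℕ) (ψ : Mem) (s : Finset ℕ) :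
    (Gate.had q).act ψ s
      = ((1 / Real.sqrt 2 : ℝ) : ℂ) * (ψ (flip q s) + (if q ∈ s then -1 else 1) * ψ s) := by
  induction ψ using Finsupp.induction_linear with
  | zero => simp
  | add ψ φ hψ hφ => rw [Gate.act_add, Finsupp.add_apply, hψ, hφ]; split_ifs <;> simp <;> ring
  | single t a =>
    rw [Gate.act_single, Gate.onBasis_had]
    simp only [Finsupp.smul_apply, Finsupp.add_apply, Finsupp.single_apply, smul_eq_mul,
      flip_eq_iff]
    by_cases h : t = s
    · subst h
      ring_nf
      split_ifs <;> ring
    · simp only [h, if_false]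
      split_ifs <;> ring

theorem Gate.act_phase_apply (q : ℕ) (ψ : Mem) (s : Finset ℕ) :
    (Gate.phase q).act ψ s = (if q ∈ s then Complex.exp (Real.pi / 4 * Complex.I) else 1) * ψ s := by
  induction ψ using Finsupp.induction_linear with
  | zero => simp
  | add ψ φ hψ hφ => rw [Gate.act_add, Finsupp.add_apply, hψ, hφ]; split_ifs <;> simp <;> ring
  | single t a =>
    rw [Gate.act_single]
    by_cases h : t = s
    · subst h
      simp [Gate.onBasis, mul_comm]
    · simp [Gate.onBasis, h]

theorem Gate.act_cnot (a b : ℕ) (ψ : Mem) :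
    (Gate.cnot a b).act ψ
      = Finsupp.mapDomain (fun s => if a ∈ s ∧ a ≠ b then flip b s else s) ψ := by
  induction ψ using Finsupp.induction_linear with
  | zero => simp
  | add ψ φ hψ hφ => rw [Gate.act_add, hψ, hφ, Finsupp.mapDomain_add]
  | single t x =>
    rw [Gate.act_single, Finsupp.mapDomain_single]
    simp [Gate.onBasis, flip]

theorem cnot_injective (a b : ℕ) :
    Function.Injective fun s : Finset ℕ => if a ∈ s ∧ a ≠ b then flip b s else s := by
  refine Function.LeftInverse.injective
    (g := fun s : Finset ℕ => if a ∈ s ∧ a ≠ b then flip b s else s) fun s => ?_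
  by_cases h : a ∈ s ∧ a ≠ b
  · simp [h, mem_flip, flip_flip]
  · simp [h]

/-- Gates preserve the norm. -/
theorem Gate.normSq_act (g : Gate) (ψ : Mem) : (g.act ψ).normSq = ψ.normSq := by
  cases g with
  | had q =>
    set φ := (Gate.had q).act ψ with hφ
    -- A finite set containing both supports and closed under flipping `q`, so that both norms are
    -- sums over `F` and these sums can be reindexed by the flip.
    set F := (ψ.support ∪ φ.support) ∪ (ψ.support ∪ φ.support).image (flip q) with hF
    have hflip : ∀ s ∈ F, flip q s ∈ F := by
      intro s hs
      rw [hF, Finset.mem_union] at hs ⊢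
      rcases hs with hs | hs
      · exact Or.inr (Finset.mem_image_of_mem _ hs)
      · obtain ⟨t, ht, rfl⟩ := Finset.mem_image.1 hs
        rw [flip_flip]
        exact Or.inl ht
    have hsum : ∀ f : Finset ℕ → ℝ, ∑ s ∈ F, f (flip q s) = ∑ s ∈ F, f s := fun f =>
      Finset.sum_bij' (fun s _ => flip q s) (fun s _ => flip q s) hflip hflip
        (fun s _ => flip_flip q s) (fun s _ => flip_flip q s) fun _ _ => rfl
    have hψ : ψ.support ⊆ F := fun s hs =>
      Finset.mem_union_left _ (Finset.mem_union_left _ hs)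
    have hφF : φ.support ⊆ F := fun s hs =>
      Finset.mem_union_left _ (Finset.mem_union_right _ hs)
    rw [Mem.normSq_eq_sum hψ, Mem.normSq_eq_sum hφF]
    -- A Hadamard gate mixes only `s` and `flip q s`; on each such pair norm preservation is the
    -- parallelogram law.
    have key : ∀ s, ‖φ s‖ ^ 2 + ‖φ (flip q s)‖ ^ 2 = ‖ψ s‖ ^ 2 + ‖ψ (flip q s)‖ ^ 2 := by
      intro s
      rw [hφ, Gate.act_had_apply, Gate.act_had_apply, flip_flip]
      have h2 : ‖((1 / Real.sqrt 2 : ℝ) : ℂ)‖ ^ 2 = 1 / 2 := by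
        rw [Complex.norm_real, Real.norm_eq_abs, sq_abs, div_pow, Real.sq_sqrt (by norm_num)]
        norm_num
      have hpar : ∀ x y : ℂ, ‖x + y‖ ^ 2 + ‖x - y‖ ^ 2 = 2 * (‖x‖ ^ 2 + ‖y‖ ^ 2) := fun x y => by
        have := parallelogram_law_with_norm ℝ x y
        nlinarith
      by_cases h : q ∈ s
      · have h' : q ∉ flip q s := by simp [mem_flip, h]
        simp only [h, h', if_true, if_false, norm_mul, mul_pow, h2]
        have := hpar (ψ s) (ψ (flip q s))
        rw [show ψ (flip q s) + -1 * ψ s = -(ψ s - ψ (flip q s)) by ring, norm_neg, one_mul]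
        linarith
      · have h' : q ∈ flip q s := by simp [mem_flip, h]
        simp only [h, h', if_true, if_false, norm_mul, mul_pow, h2]
        have := hpar (ψ s) (ψ (flip q s))
        rw [show ψ (flip q s) + 1 * ψ s = ψ s + ψ (flip q s) by ring,
          show ψ s + -1 * ψ (flip q s) = ψ s - ψ (flip q s) by ring]
        linarith
    have h1 := Finset.sum_congr rfl fun s (_ : s ∈ F) => key s
    rw [Finset.sum_add_distrib, Finset.sum_add_distrib, hsum fun s => ‖φ s‖ ^ 2,
      hsum fun s => ‖ψ s‖ ^ 2] at h1
    linarith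
  | phase q =>
    have hn : ∀ s, ‖(Gate.phase q).act ψ s‖ = ‖ψ s‖ := by
      intro s
      rw [Gate.act_phase_apply, norm_mul]
      have : ‖Complex.exp (Real.pi / 4 * Complex.I)‖ = 1 := by
        have := Complex.norm_exp_ofReal_mul_I (Real.pi / 4)
        push_cast at this
        exact this
      split_ifs <;> simp [this]
    have hs : ((Gate.phase q).act ψ).support ⊆ ψ.support := by
      intro s
      rw [Finsupp.mem_support_iff, Finsupp.mem_support_iff, ← norm_ne_zero_iff, hn,
        norm_ne_zero_iff]
      exact id
    rw [Mem.normSq_eq_sum hs, Mem.normSq_eq_sum subset_rfl]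
    simp only [hn]
  | cnot a b =>
    rw [Gate.act_cnot, Mem.normSq_mapDomain (cnot_injective a b)]

/-! ### Total probability -/

namespace Comp

variable {α : Type}

/-- The expectation of the squared norm is the squared norm. -/
theorem Silent.wp_normSq {c : Comp α} (hc : c.Silent) (n : ℕ) (ψ : Mem) :
    c.wp (fun _ _ φ => φ.normSq) n ψ = ψ.normSq := by
  induction c generalizing n ψ <;>
    simp_all [wp, Silent, Gate.normSq_act, Mem.normSq_project]

theorem wp_normSq_le (c : Comp α) (n : ℕ) (ψ : Mem) :
    c.wp (fun _ _ φ => φ.normSq) n ψ ≤ ψ.normSq := by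
  induction c generalizing n ψ with
  | ret a => exact le_rfl
  | tick d k ih => exact ih n ψ
  | coin k ih =>
    have h1 := ih false n ψ
    have h2 := ih true n ψ
    simp only [wp]
    linarith
  | new k ih => exact ih n (n + 1) ψ
  | gate g k ih => exact (ih n _).trans (g.normSq_act ψ).le
  | meas q k ih =>
    exact (add_le_add (ih false n _) (ih true n _)).trans (ψ.normSq_project q).le
  | ask m k ih => exact ψ.normSq_nonneg

theorem weight_le_normSq (E : α → Prop) (c : Comp α) (n : ℕ) (ψ : Mem) :
    c.weight E n ψ ≤ ψ.normSq := by
  classical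
  rw [weight_eq_wp]
  refine (wp_mono (fun a m φ => ?_) c n ψ).trans (wp_normSq_le c n ψ)
  split_ifs
  · exact le_rfl
  · exact φ.normSq_nonneg

theorem weight_nonneg (E : α → Prop) (c : Comp α) (n : ℕ) (ψ : Mem) : 0 ≤ c.weight E n ψ := by
  classical
  rw [weight_eq_wp]
  refine (wp_zero c n ψ).symm.trans_le (wp_mono (fun a m φ => ?_) c n ψ)
  split_ifs
  · exact φ.normSq_nonneg
  · exact le_rfl

end Comp

/-! ### Adjoining qubits -/

/-- Renaming of the qubits that a gate acts on. -/
def Gate.map (σ : ℕ → ℕ) : Gate → Gate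
  | had q => had (σ q)
  | phase q => phase (σ q)
  | cnot a b => cnot (σ a) (σ b)

namespace Mem

/-- The basis vector `s`, with qubits renamed by `σ`, next to the basis vector `t`. -/
def join (σ : ℕ → ℕ) (t s : Finset ℕ) : Finset ℕ := s.image σ ∪ t

/-- The state `ψ`, with qubits renamed by `σ`, next to the state `χ` of other qubits. -/
noncomputable def tens (σ : ℕ → ℕ) (χ ψ : Mem) : Mem :=
  χ.sum fun t b => b • Finsupp.mapDomain (join σ t) ψ

variable {σ : ℕ → ℕ}

theorem mem_join {t s : Finset ℕ} (hσ : σ.Injective) (ht : ∀ q, σ q ∉ t) (q : ℕ) :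
    σ q ∈ join σ t s ↔ q ∈ s := by
  simp [join, ht, hσ.eq_iff]

theorem join_flip {t s : Finset ℕ} (hσ : σ.Injective) (ht : ∀ q, σ q ∉ t) (q : ℕ) :
    flip (σ q) (join σ t s) = join σ t (flip q s) := by
  ext r
  by_cases hr : ∃ p, σ p = r
  · obtain ⟨p, rfl⟩ := hr
    rw [mem_flip, mem_join hσ ht, mem_join hσ ht, mem_flip, hσ.ne_iff]
  · push Not at hr
    have h1 : ∀ s : Finset ℕ, r ∈ join σ t s ↔ r ∈ t := fun s => by simp [join, hr]
    rw [mem_flip, h1, h1]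
    have := (hr q).symm
    tauto

theorem join_injective {t : Finset ℕ} (hσ : σ.Injective) (ht : ∀ q, σ q ∉ t) :
    (join σ t).Injective := fun s s' h => by
  ext q
  rw [← mem_join hσ ht (s := s), h, mem_join hσ ht]

theorem act_mapDomain_join {t : Finset ℕ} (hσ : σ.Injective) (ht : ∀ q, σ q ∉ t) (g : Gate)
    (ψ : Mem) :
    (g.map σ).act (Finsupp.mapDomain (join σ t) ψ) = Finsupp.mapDomain (join σ t) (g.act ψ) := by
  induction ψ using Finsupp.induction_linear with
  | zero => simp
  | add ψ φ hψ hφ => simp [Finsupp.mapDomain_add, hψ, hφ]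
  | single s a =>
    rw [Finsupp.mapDomain_single, Gate.act_single, Gate.act_single, Finsupp.mapDomain_smul]
    congr 1
    cases g with
    | had q =>
      by_cases h : q ∈ s
      · have h' := (mem_join (s := s) hσ ht q).2 h
        simp [Gate.map, Gate.onBasis, h, h', erase_eq_flip, join_flip hσ ht, sub_eq_add_neg,
          Finsupp.mapDomain_add, Finsupp.mapDomain_single, ← Finsupp.single_neg]
      · have h' := (mem_join (s := s) hσ ht q).not.2 h
        simp [Gate.map, Gate.onBasis, h, h', insert_eq_flip, join_flip hσ ht,
          Finsupp.mapDomain_add, Finsupp.mapDomain_single]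
    | phase q =>
      simp [Gate.map, Gate.onBasis, mem_join hσ ht, Finsupp.mapDomain_single]
    | cnot a b =>
      have h := join_flip (s := s) hσ ht b
      simp only [flip] at h
      simp only [Gate.map, Gate.onBasis, mem_join hσ ht, hσ.ne_iff, Finsupp.mapDomain_single, h]
      split_ifs <;> rfl

theorem project_mapDomain_join {t : Finset ℕ} (hσ : σ.Injective) (ht : ∀ q, σ q ∉ t) (q : ℕ)
    (b : Bool) (ψ : Mem) :
    project (σ q) b (Finsupp.mapDomain (join σ t) ψ)
      = Finsupp.mapDomain (join σ t) (ψ.project q b) := by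
  induction ψ using Finsupp.induction_linear with
  | zero => simp
  | add ψ φ hψ hφ => simp [Finsupp.mapDomain_add, hψ, hφ]
  | single s a =>
    rw [Finsupp.mapDomain_single, project_single, project_single]
    simp only [mem_join hσ ht]
    split_ifs <;> simp [Finsupp.mapDomain_single]

theorem act_sum (g : Gate) {ι : Type} (F : Finset ι) (f : ι → Mem) :
    g.act (∑ i ∈ F, f i) = ∑ i ∈ F, g.act (f i) := by
  simp [Gate.act_eq]

theorem project_sum (q : ℕ) (b : Bool) {ι : Type} (F : Finset ι) (f : ι → Mem) :
    project q b (∑ i ∈ F, f i) = ∑ i ∈ F, project q b (f i) := by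
  classical
  induction F using Finset.induction_on with
  | empty => simp
  | insert i F hi ih => simp [Finset.sum_insert hi, ih]

/-- No qubit in the range of `σ` is `1` in the state `χ`. -/
def Avoids (χ : Mem) (σ : ℕ → ℕ) : Prop := ∀ t ∈ χ.support, ∀ q, σ q ∉ t

theorem act_tens {χ : Mem} (hσ : σ.Injective) (hχ : χ.Avoids σ) (g : Gate) (ψ : Mem) :
    (g.map σ).act (tens σ χ ψ) = tens σ χ (g.act ψ) := by
  simp only [tens, Finsupp.sum, act_sum]
  refine Finset.sum_congr rfl fun t ht => ?_
  rw [Gate.act_smul, act_mapDomain_join hσ (hχ t ht)]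

theorem project_tens {χ : Mem} (hσ : σ.Injective) (hχ : χ.Avoids σ) (q : ℕ) (b : Bool) (ψ : Mem) :
    project (σ q) b (tens σ χ ψ) = tens σ χ (ψ.project q b) := by
  simp only [tens, Finsupp.sum, project_sum]
  refine Finset.sum_congr rfl fun t ht => ?_
  rw [project_smul, project_mapDomain_join hσ (hχ t ht)]

theorem normSq_tens {χ : Mem} (hσ : σ.Injective) (hχ : χ.Avoids σ) (ψ : Mem) :
    (tens σ χ ψ).normSq = χ.normSq * ψ.normSq := by
  -- Induction over sets of basis vectors of `χ`, with the coefficients kept fixed.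
  suffices H : ∀ F : Finset (Finset ℕ), (∀ t ∈ F, ∀ q, σ q ∉ t) →
      normSq (∑ t ∈ F, χ t • Finsupp.mapDomain (join σ t) ψ)
        = (∑ t ∈ F, ‖χ t‖ ^ 2) * ψ.normSq from H χ.support hχ
  intro F hF
  induction F using Finset.induction_on with
  | empty => simp
  | insert t F ht ih =>
    have h1 := hF t (Finset.mem_insert_self t F)
    have h2 := fun t' h => hF t' (Finset.mem_insert_of_mem h)
    rw [Finset.sum_insert ht, Finset.sum_insert ht, normSq_add_of_disjoint, ih h2, normSq_smul,
      normSq_mapDomain (join_injective hσ h1)]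
    · ring
    · rw [Finset.disjoint_left]
      intro u hu hv
      obtain ⟨s, -, rfl⟩ := Finset.mem_image.1 (Finsupp.mapDomain_support (Finsupp.support_smul hu))
      obtain ⟨t', ht', hv⟩ := Finset.mem_biUnion.1 (Finsupp.support_finsetSum hv)
      obtain ⟨s', -, he⟩ := Finset.mem_image.1 (Finsupp.mapDomain_support (Finsupp.support_smul hv))
      refine ht (?_ : t ∈ F)
      -- The environment part is determined by the joint vector: inside the range of `σ` it is
      -- empty, and outside it agrees with the joint vector.
      have : t = t' := by
        ext r
        by_cases hr : ∃ p, σ p = r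
        · obtain ⟨p, rfl⟩ := hr
          simp [h1 p, h2 t' ht' p]
        · push Not at hr
          have h3 : ∀ t s : Finset ℕ, r ∈ join σ t s ↔ r ∈ t := fun t s => by simp [join, hr]
          rw [← h3 t s, ← he, h3]
      exact this ▸ ht'

theorem tens_single_empty (ψ : Mem) : tens _root_.id (Finsupp.single ∅ 1) ψ = ψ := by
  have : join _root_.id ∅ = _root_.id := by
    funext s
    simp [join]
  simp [tens, this]

/-- Only qubits below `n` are in use. -/
def Below (n : ℕ) (ψ : Mem) : Prop := ∀ s ∈ ψ.support, ∀ q ∈ s, q < n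

theorem below_iff {n : ℕ} {ψ : Mem} :
    ψ.Below n ↔ ψ ∈ Finsupp.supported ℂ ℂ {s : Finset ℕ | ∀ q ∈ s, q < n} :=
  Iff.rfl

theorem Below.mono {n m : ℕ} {ψ : Mem} (h : ψ.Below n) (hnm : n ≤ m) : ψ.Below m :=
  fun s hs q hq => (h s hs q hq).trans_le hnm

theorem Below.project {n : ℕ} {ψ : Mem} (h : ψ.Below n) (q : ℕ) (b : Bool) :
    (ψ.project q b).Below n := fun s hs =>
  h s (by
    rw [Mem.project, Finsupp.support_filter] at hs
    exact (Finset.mem_filter.1 hs).1)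

theorem below_initial (n : ℕ) : Below n (Finsupp.single ∅ 1) := fun s hs q hq => by
  rw [Finset.mem_singleton.1 (Finsupp.support_single_subset hs)] at hq
  simp at hq

/-- The qubits that a gate acts on are below `n`. -/
def _root_.CertDel.Gate.Below (n : ℕ) : Gate → Prop
  | .had q => q < n
  | .phase q => q < n
  | .cnot a b => a < n ∧ b < n

theorem Below.act {n : ℕ} {ψ : Mem} (h : ψ.Below n) {g : Gate} (hg : g.Below n) :
    (g.act ψ).Below n := by
  rw [below_iff, Gate.act, Finsupp.sum]
  refine Submodule.sum_mem _ fun s hs => Submodule.smul_mem _ _ ?_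
  have hs := h s hs
  have hflip : ∀ q, q < n → flip q s ∈ {s : Finset ℕ | ∀ q ∈ s, q < n} := by
    intro q hq r hr
    by_cases h : r = q
    · exact h ▸ hq
    · exact hs r (by simp_all [mem_flip])
  have hsingle : ∀ {t : Finset ℕ} (a : ℂ), t ∈ {s : Finset ℕ | ∀ q ∈ s, q < n} →
      Finsupp.single t a ∈ Finsupp.supported ℂ ℂ {s : Finset ℕ | ∀ q ∈ s, q < n} :=
    fun a ht => Finsupp.single_mem_supported ℂ a ht
  cases g with
  | had q =>
    simp only [Gate.onBasis]
    split_ifs with hq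
    · rw [erase_eq_flip hq]
      exact Submodule.sub_mem _ (hsingle _ (hflip q hg)) (hsingle _ hs)
    · rw [insert_eq_flip hq]
      exact Submodule.add_mem _ (hsingle _ hs) (hsingle _ (hflip q hg))
  | phase q => exact hsingle _ hs
  | cnot a b =>
    simp only [Gate.onBasis]
    split_ifs
    · exact hsingle _ (hflip b hg.2)
    · exact hsingle _ hs

/-- The renaming that leaves `n` qubits in place and makes room for `j` further ones. -/
def skip (n j q : ℕ) : ℕ := if q < n then q else q + j

theorem skip_injective (n j : ℕ) : (skip n j).Injective := fun a b h => by
  simp only [skip] at h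
  split_ifs at h <;> omega

/-- On both sides `ψ` occupies the qubits below `n` and `χ` is shifted above them; `skip n j` fixes
every qubit that is `1` in `ψ`. The two forms exchange the roles of running state and idle
environment, and `j` is free to match the number of qubits allocated for `χ`. -/
theorem tens_comm {n : ℕ} {ψ : Mem} (h : ψ.Below n) (j : ℕ) (χ : Mem) :
    tens (· + n) ψ χ
      = tens (skip n j) (Finsupp.mapDomain (Finset.image (· + n)) χ) ψ := by
  rw [tens, tens, Finsupp.sum_mapDomain_index (by simp) (by simp [add_smul])]
  simp only [Finsupp.mapDomain, Finsupp.smul_sum]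
  rw [Finsupp.sum_comm]
  refine Finsupp.sum_congr fun t _ => Finsupp.sum_congr fun s hs => ?_
  have h1 : s.image (skip n j) = s := by
    refine (Finset.image_congr fun q hq => ?_).trans Finset.image_id
    simp [skip, h s hs q hq]
  have h2 : join (· + n) s t = join (skip n j) (t.image (· + n)) s := by
    simp [join, h1, Finset.union_comm]
  rw [h2]
  simp [mul_comm]

end Mem

/-! ## Renaming of qubits -/

/-- Renaming of the qubits in a value. -/
def Val.rename (σ : ℕ → ℕ) : Val → Val
  | nil => nil
  | bit b => bit b
  | qubit q => qubit (σ q)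
  | pair x y => pair (x.rename σ) (y.rename σ)

/-- The qubits in the value are below `n`: renamings of the other qubits do not affect it. -/
def Val.Below (n : ℕ) (v : Val) : Prop := ∀ ρ : ℕ → ℕ, (∀ q < n, ρ q = q) → v.rename ρ = v

namespace Val

theorem IsClassical.rename {v : Val} (h : v.IsClassical) (σ : ℕ → ℕ) : v.rename σ = v := by
  induction v <;> simp_all [IsClassical, Val.rename]

theorem IsClassical.below {v : Val} (h : v.IsClassical) (n : ℕ) : v.Below n :=
  fun ρ _ => h.rename ρ

theorem Below.mono {n m : ℕ} {v : Val} (h : v.Below n) (hnm : n ≤ m) : v.Below m :=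
  fun ρ hρ => h ρ fun q hq => hρ q (hq.trans_le hnm)

theorem isClassical_str (l : List Bool) : (str l).IsClassical := by
  induction l with
  | nil => trivial
  | cons b l ih => exact ⟨trivial, ih⟩

theorem isClassical_unary (n : ℕ) : (unary n).IsClassical := isClassical_str _

@[simp] theorem rename_unary (n : ℕ) (σ : ℕ → ℕ) : (unary n).rename σ = unary n :=
  (isClassical_unary n).rename σ

theorem rename_tuple (σ : ℕ → ℕ) (l : List Val) :
    (tuple l).rename σ = tuple (l.map (rename σ)) := by
  induction l with
  | nil => rfl
  | cons x l ih =>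
    cases l with
    | nil => rfl
    | cons y l => simp only [tuple, List.map, rename] at ih ⊢; rw [ih]

theorem isTrue_rename (σ : ℕ → ℕ) (v : Val) : (v.rename σ).isTrue = v.isTrue := by
  cases v <;> rfl

theorem fst_rename (σ : ℕ → ℕ) (v : Val) : (v.rename σ).fst = v.fst.rename σ := by
  cases v <;> rfl

theorem snd_rename (σ : ℕ → ℕ) (v : Val) : (v.rename σ).snd = v.snd.rename σ := by
  cases v <;> rfl

theorem len_rename (σ : ℕ → ℕ) (v : Val) : (v.rename σ).len = v.len := by
  induction v <;> simp_all [rename, len]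

end Val

/-! ### Computations up to renaming of qubits -/

namespace Comp

variable {α β γ δ : Type}

/-- The second computation is the first one with its qubits renamed by `σ`, up to the relation `S`
on the results. -/
def Ren (σ : ℕ → ℕ) (S : α → β → Prop) : Comp α → Comp β → Prop
  | ret a, ret b => S a b
  | tick c k, tick d l => c = d ∧ Ren σ S k l
  | coin k, coin l => ∀ b, Ren σ S (k b) (l b)
  | new k, new l => ∀ q, Ren σ S (k q) (l (σ q))
  | gate g k, gate h l => h = g.map σ ∧ Ren σ S k l
  | meas q k, meas r l => r = σ q ∧ ∀ b, Ren σ S (k b) (l b)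
  | ask m k, ask n l => n = m.rename σ ∧ ∀ r, Ren σ S (k r) (l (r.rename σ))
  | _, _ => False

theorem Ren.mono {σ : ℕ → ℕ} {S T : α → β → Prop} (h : ∀ a b, S a b → T a b) {c : Comp α}
    {d : Comp β} (hc : Ren σ S c d) : Ren σ T c d := by
  induction c generalizing d <;> cases d <;> simp_all [-Bool.forall_bool, Ren]

theorem Ren.bind {σ : ℕ → ℕ} {S : α → β → Prop} {T : γ → δ → Prop} {c : Comp α} {d : Comp β}
    {f : α → Comp γ} {g : β → Comp δ} (hc : Ren σ S c d)
    (hf : ∀ a b, S a b → Ren σ T (f a) (g b)) : Ren σ T (c.bind f) (d.bind g) := by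
  induction c generalizing d <;> cases d <;> simp_all [-Bool.forall_bool, Ren, Comp.bind]

theorem Ren.strip {σ : ℕ → ℕ} {S : α → β → Prop} {c : Comp α} {d : Comp β} (hc : Ren σ S c d) :
    Ren σ S c.strip d.strip := by
  induction c generalizing d <;> cases d <;> simp_all [-Bool.forall_bool, Ren, Comp.strip]

theorem Ren.and_all {σ : ℕ → ℕ} {S : α → β → Prop} {E : α → Prop} {c : Comp α} {d : Comp β}
    (hc : Ren σ S c d) (hE : c.All E) : Ren σ (fun a b => S a b ∧ E a) c d := by
  induction c generalizing d <;> cases d <;> simp_all [-Bool.forall_bool, Ren, All]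

theorem Ren.iterate {σ : ℕ → ℕ} {S : α → β → Prop} {f : α → Comp α} {g : β → Comp β}
    (h : ∀ a b, S a b → Ren σ S (f a) (g b)) (k : ℕ) {a : α} {b : β} (hab : S a b) :
    Ren σ S (iterate f k a) (iterate g k b) := by
  induction k generalizing a b with
  | zero => exact hab
  | succ k ih => exact (h a b hab).bind fun a b hab => ih hab

theorem Ren.interact {σ : ℕ → ℕ} {S : α → β → Prop} {τ τ' : Type} {T : τ → τ' → Prop}
    {R : τ → Val → Comp (Val × τ)} {R' : τ' → Val → Comp (Val × τ')}
    (hR : ∀ s s' m, T s s' →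
      Ren σ (fun x y => y.1 = x.1.rename σ ∧ T x.2 y.2) (R s m) (R' s' (m.rename σ)))
    {c : Comp α} {d : Comp β} (hc : Ren σ S c d) {s : τ} {s' : τ'} (hs : T s s') :
    Ren σ S (c.interact R s) (d.interact R' s') := by
  induction c generalizing d s s' <;> cases d <;>
    try simp_all [-Bool.forall_bool, Ren, Comp.interact]
  case ask.ask m k ih n l =>
    exact (hR s s' m hs).bind fun x y hxy => by
      rw [hxy.1]
      exact ih _ (hc.2 _) hxy.2

/-- The computation is oblivious of the addresses of its qubits, and of its free qubits only those
below `n` occur. -/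
def Scoped (S : (ℕ → ℕ) → α → α → Prop) (n : ℕ) (c : Comp α) : Prop :=
  ∀ ρ : ℕ → ℕ, (∀ q < n, ρ q = q) → Ren ρ (S ρ) c c

theorem skip_one_eq_iff {n q : ℕ} : Mem.skip n 1 q = q ↔ q < n := by
  simp only [Mem.skip]
  split_ifs <;> omega

theorem skip_one_eq {n q : ℕ} (h : q < n) : Mem.skip n 1 q = q := skip_one_eq_iff.2 h

/-- The test renaming `skip n 1` fixes exactly the addresses below `n`, so invariance under it
bounds the qubits that the gate acts on. -/
theorem Scoped.gate {S : (ℕ → ℕ) → α → α → Prop} {n : ℕ} {g : Gate} {k : Comp α}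
    (hc : (Comp.gate g k).Scoped S n) : g.Below n ∧ k.Scoped S n := by
  refine ⟨?_, fun ρ hρ => (hc ρ hρ).2⟩
  have h := (hc (Mem.skip n 1) fun q => skip_one_eq).1
  cases g <;>
    simp only [Gate.map, Gate.had.injEq, Gate.phase.injEq, Gate.cnot.injEq] at h
  · exact skip_one_eq_iff.1 h.symm
  · exact skip_one_eq_iff.1 h.symm
  · exact ⟨skip_one_eq_iff.1 h.1.symm, skip_one_eq_iff.1 h.2.symm⟩

theorem Scoped.new {S : (ℕ → ℕ) → α → α → Prop} {n : ℕ} {k : ℕ → Comp α}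
    (hc : (Comp.new k).Scoped S n) : (k n).Scoped S (n + 1) := fun ρ hρ => by
  have h := hc ρ (fun q hq => hρ q (by omega)) n
  rwa [hρ n (by omega)] at h

/-- The reply may refer to qubits allocated by the other party in the meantime, hence the larger
bound `j`. -/
theorem Scoped.ask {S : (ℕ → ℕ) → α → α → Prop} {n : ℕ} {m : Val} {k : Val → Comp α}
    (hc : (Comp.ask m k).Scoped S n) :
    m.Below n ∧ ∀ j r, n ≤ j → r.Below j → (k r).Scoped S j := by
  refine ⟨fun ρ hρ => (hc ρ hρ).1.symm, fun j r hj hr ρ hρ => ?_⟩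
  have h := (hc ρ fun q hq => hρ q (hq.trans_le hj)).2 r
  rwa [hr ρ hρ] at h

/-- Expectations are invariant under renaming of the qubits, and under the presence of further
qubits that the computation does not touch. -/
theorem Ren.wp_eq {σ : ℕ → ℕ} (hσ : σ.Injective) {N : ℕ} (hN : ∀ m, N ≤ m → σ (m + 1) = σ m + 1)
    {χ : Mem} (hχ : χ.Avoids σ) {S : α → β → Prop} {T : (ℕ → ℕ) → α → α → Prop}
    {post : α → ℕ → Mem → ℝ} {post' : β → ℕ → Mem → ℝ} {c : Comp α} {d : Comp β} {n : ℕ} {ψ : Mem}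
    (hcd : Ren σ S c d) (hc : c.Scoped T n) (hn : N ≤ n) (hψ : ψ.Below n)
    (hpost : ∀ a b m φ, n ≤ m → φ.Below m → S a b →
      (∀ ρ : ℕ → ℕ, (∀ q < m, ρ q = q) → T ρ a a) →
      post' b (σ m) (Mem.tens σ χ φ) = post a m φ) :
    d.wp post' (σ n) (Mem.tens σ χ ψ) = c.wp post n ψ := by
  induction c generalizing d n ψ with
  | ret a =>
    cases d <;> try exact hcd.elim
    exact hpost _ _ _ _ le_rfl hψ hcd hc
  | tick t k ih =>
    cases d <;> try exact hcd.elim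
    simp only [wp]
    exact ih hcd.2 (fun ρ hρ => (hc ρ hρ).2) hn hψ hpost
  | coin k ih =>
    cases d <;> try exact hcd.elim
    simp only [wp]
    rw [ih false (hcd false) (fun ρ hρ => hc ρ hρ false) hn hψ hpost,
      ih true (hcd true) (fun ρ hρ => hc ρ hρ true) hn hψ hpost]
  | new k ih =>
    cases d <;> try exact hcd.elim
    simp only [wp]
    -- The fresh qubit `n` corresponds to `σ n`, which is the counter on the renamed side; `hN`
    -- keeps the two counters aligned afterwards.
    rw [← hN n hn]
    exact ih n (hcd n) hc.new (by omega) (hψ.mono (by omega))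
      fun a b m φ hm => hpost a b m φ (by omega)
  | gate g k ih =>
    cases d <;> try exact hcd.elim
    simp only [wp]
    rw [hcd.1, Mem.act_tens hσ hχ]
    exact ih hcd.2 hc.gate.2 hn (hψ.act hc.gate.1) hpost
  | meas q k ih =>
    cases d <;> try exact hcd.elim
    simp only [wp]
    rw [hcd.1, Mem.project_tens hσ hχ, Mem.project_tens hσ hχ,
      ih false (hcd.2 false) (fun ρ hρ => (hc ρ hρ).2 false) hn (hψ.project q _) hpost,
      ih true (hcd.2 true) (fun ρ hρ => (hc ρ hρ).2 true) hn (hψ.project q _) hpost]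
  | ask m k ih =>
    cases d <;> try exact hcd.elim
    rfl

/-- When two continuations of a scoped computation are compared, the memory and the result may be
assumed to involve only qubits that have been allocated. -/
theorem Scoped.wp_congr {S : (ℕ → ℕ) → α → α → Prop} {c : Comp α} {n : ℕ} (hc : c.Scoped S n)
    {ψ : Mem} (hψ : ψ.Below n) {f g : α → ℕ → Mem → ℝ}
    (h : ∀ a m φ, n ≤ m → φ.Below m → (∀ ρ : ℕ → ℕ, (∀ q < m, ρ q = q) → S ρ a a) →
      f a m φ = g a m φ) :
    c.wp f n ψ = c.wp g n ψ := by
  induction c generalizing n ψ with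
  | ret a => exact h _ _ _ le_rfl hψ hc
  | tick t k ih => exact ih (fun ρ hρ => (hc ρ hρ).2) hψ h
  | coin k ih =>
    simp only [wp]
    rw [ih false (fun ρ hρ => hc ρ hρ false) hψ h, ih true (fun ρ hρ => hc ρ hρ true) hψ h]
  | new k ih =>
    exact ih n hc.new (hψ.mono (by omega)) fun a m φ hm => h a m φ (by omega)
  | gate g k ih => exact ih hc.gate.2 (hψ.act hc.gate.1) h
  | meas q k ih =>
    simp only [wp]
    rw [ih false (fun ρ hρ => (hc ρ hρ).2 false) (hψ.project q _) h,
      ih true (fun ρ hρ => (hc ρ hρ).2 true) (hψ.project q _) h]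
  | ask m k ih => rfl

/-- The state in which all qubits are `0`. -/
noncomputable abbrev initial : Mem := Finsupp.single ∅ 1

/-- Expectation of a function of the result, for a computation that starts with all qubits in state
`|0⟩`. -/
noncomputable def expect (c : Comp α) (f : α → ℝ) : ℝ :=
  c.wp (fun a _ χ => f a * χ.normSq) 0 initial

/-- A computation with classical results, run in the middle of another computation, is a sampler
that leaves no trace. -/
theorem weight_bind_eq_expect {E : β → Prop} {F : α → Prop} {c : Comp α} (hF : c.All F)
    (hc : ∀ σ, Ren σ Eq c c) {n : ℕ} {ψ : Mem} (hψ : ψ.Below n) {f : α → Comp β}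
    (hf : ∀ a, F a → (f a).Scoped (fun _ => Eq) n) :
    (c.bind f).weight E n ψ = c.expect fun a => (f a).weight E n ψ := by
  classical
  have hinj : (fun q => q + n).Injective := add_left_injective n
  have hav : ψ.Avoids (· + n) := fun s hs q hq => by
    have : q + n < n := hψ s hs _ hq
    omega
  -- For the duration of `c`, the given memory is the environment, next to a blank register shifted
  -- by `n`.
  have hinit : ψ = Mem.tens (· + n) ψ initial := by
    rw [Mem.tens_comm hψ 0, Finsupp.mapDomain_single, Finset.image_empty]
    have : Mem.skip n 0 = _root_.id := by
      funext q
      simp [Mem.skip]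
    rw [this, Mem.tens_single_empty]
  rw [weight_bind]
  conv_lhs => rw [hinit]
  -- `c`, run at counter `n` beside `ψ`, is a renaming of `c` run on blank memory at counter `0`.
  have key := Ren.wp_eq (T := fun _ => Eq) (post := fun a _ χ => (f a).weight E n ψ * χ.normSq)
    (post' := fun a => (f a).weight E) hinj (N := 0) (fun m _ => by omega) hav
    ((hc _).and_all hF)
    (fun ρ _ => hc ρ) le_rfl (Mem.below_initial 0) ?_
  · rwa [zero_add] at key
  rintro a _ j χ - hχ ⟨rfl, ha⟩ -
  have hav' : Mem.Avoids (Finsupp.mapDomain (Finset.image (· + n)) χ) (Mem.skip n j) := by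
    intro t ht q hq
    obtain ⟨s, hs, rfl⟩ := Finset.mem_image.1 (Finsupp.mapDomain_support ht)
    obtain ⟨p, hp, hpq⟩ := Finset.mem_image.1 hq
    have := hχ s hs p hp
    simp only [Mem.skip] at hpq
    split_ifs at hpq <;> omega
  have hskip : j + n = Mem.skip n j n := by simp [Mem.skip, add_comm]
  simp only [weight_eq_wp]
  -- Now the roles change: `f a` acts on `ψ`, while the qubits left by `c` are the environment and
  -- contribute only the factor `χ.normSq`. As `f a` knows only qubits below `n`, running it from
  -- counter `j + n` amounts to renaming it by `skip n j`.
  rw [Mem.tens_comm hψ j, hskip, mul_comm, ← wp_mul_left]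
  refine Ren.wp_eq (T := fun _ => Eq) (Mem.skip_injective n j) (N := n) (fun m hm => ?_) hav'
    (hf a ha _ fun q hq => by simp [Mem.skip, hq]) (hf a ha) le_rfl hψ ?_
  · simp only [Mem.skip]
    split_ifs <;> omega
  · rintro b _ m φ - - rfl -
    rw [Mem.normSq_tens (Mem.skip_injective n j) hav',
      Mem.normSq_mapDomain (Finset.image_injective hinj)]
    split_ifs <;> simp

/-- The sampler `d` runs on a blank memory of its own, so it is independent of `c`, as in `wp_comm`.
-/
theorem wp_expect_comm (f : α → ℕ → Mem → β → ℝ) (c : Comp α) (d : Comp β) (n : ℕ) (ψ : Mem) :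
    c.wp (fun a i φ => d.expect (f a i φ)) n ψ
      = d.expect fun b => c.wp (fun a i φ => f a i φ b) n ψ := by
  simp only [expect]
  rw [wp_comm]
  simp only [mul_comm _ (Mem.normSq _), wp_mul_left]

theorem Silent.expect_const {c : Comp α} (hc : c.Silent) (x : ℝ) : c.expect (fun _ => x) = x := by
  rw [expect, wp_mul_left, hc.wp_normSq, Mem.normSq_single]
  simp

end Comp

/-! ## Programs -/

namespace Comp

variable {α : Type}

theorem timeLE_tick_tick {a b t : ℕ} {k : Comp α} :
    (tick a (tick b k)).TimeLE t ↔ (tick (a + b) k).TimeLE t := by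
  simp only [TimeLE, ← Nat.sub_sub]
  constructor <;> rintro ⟨h₁, h₂⟩
  · exact ⟨by omega, h₂.2⟩
  · exact ⟨by omega, by omega, h₂⟩

theorem TimeLE.tick {a s t : ℕ} {k : Comp α} (h : k.TimeLE s) (hs : a + s ≤ t) :
    (Comp.tick a k).TimeLE t :=
  ⟨by omega, h.mono (by omega)⟩

end Comp

@[simp] theorem Val.fst_pair (x y : Val) : (pair x y).fst = x := rfl
@[simp] theorem Val.snd_pair (x y : Val) : (pair x y).snd = y := rfl

namespace Prog

open CertDel.Comp

/-- Semantics of programs without the time steps. -/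
def sem (p : Prog) (v : Val) : Comp Val := (p.eval v).strip

@[simp] theorem sem_id (v : Val) : id.sem v = ret v := rfl
@[simp] theorem sem_fst (v : Val) : fst.sem v = ret v.fst := rfl
@[simp] theorem sem_snd (v : Val) : snd.sem v = ret v.snd := rfl
@[simp] theorem sem_nil (v : Val) : nil.sem v = ret .nil := rfl
@[simp] theorem sem_bit (b : Bool) (v : Val) : (bit b).sem v = ret (.bit b) := rfl
@[simp] theorem sem_ask (v : Val) : ask.sem v = Comp.ask v ret := rfl
@[simp] theorem sem_isNil_nil : isNil.sem .nil = ret (.bit true) := rfl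
@[simp] theorem sem_isNil_bit (b : Bool) : isNil.sem (.bit b) = ret (.bit false) := rfl

@[simp] theorem sem_seq (p q : Prog) (v : Val) : (seq p q).sem v = (p.sem v).bind q.sem := by
  simp only [sem, eval, strip, strip_bind]
  rfl

@[simp] theorem sem_fork (p q : Prog) (v : Val) :
    (fork p q).sem v = (p.sem v).bind fun x => (q.sem v).bind fun y => ret (.pair x y) := by
  simp only [sem, eval, strip, strip_bind]

@[simp] theorem sem_ite (c p q : Prog) (v : Val) :
    (ite c p q).sem v = (c.sem v).bind fun b => if b.isTrue then p.sem v else q.sem v := by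
  simp only [sem, eval, strip, strip_bind]
  congr 1
  funext b
  split_ifs <;> rfl

@[simp] theorem sem_loop (p : Prog) (v : Val) :
    (loop p).sem v = iterate p.sem v.fst.len v.snd := by
  simp only [sem, eval, strip, strip_iterate]
  rfl

theorem strip_run (p : Prog) (args : List Val) : (p.run args).strip = p.sem (.tuple args) := rfl

theorem IsClosed.silent {p : Prog} (hp : p.IsClosed) (v : Val) : (p.eval v).Silent := by
  induction p generalizing v with
  | ask => exact hp.elim
  | seq p q hp' hq' => exact (hp' hp.1 v).bind (hq' hp.2)
  | fork p q hp' hq' => exact (hp' hp.1 v).bind fun x => (hq' hp.2 v).bind fun y => trivial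
  | ite c p q hc' hp' hq' =>
    refine (hc' hp.1 v).bind fun b => ?_
    split_ifs
    exacts [hp' hp.2.1 v, hq' hp.2.2 v]
  | loop p hp' => exact Silent.iterate (hp' hp) _ _
  | id | fst | snd | nil | bit | coin | new => simp [eval, Silent]
  | _ => cases v <;> try simp [eval, Silent]
         try (rename_i x y; cases x <;> cases y <;> simp [eval, Silent])

theorem IsClosed.silent_sem {p : Prog} (hp : p.IsClosed) (v : Val) : (p.sem v).Silent :=
  (hp.silent v).strip

theorem IsClassical.isClosed {p : Prog} (hp : p.IsClassical) : p.IsClosed := by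
  induction p <;> simp_all [IsClassical, IsClosed]

theorem IsClassical.classic {p : Prog} (hp : p.IsClassical) (v : Val) : (p.eval v).Classic := by
  induction p generalizing v with
  | ask | new | had | phase | cnot | meas => exact hp.elim
  | seq p q hp' hq' => exact (hp' hp.1 v).bind (hq' hp.2)
  | fork p q hp' hq' => exact (hp' hp.1 v).bind fun x => (hq' hp.2 v).bind fun y => trivial
  | ite c p q hc' hp' hq' =>
    refine (hc' hp.1 v).bind fun b => ?_
    split_ifs
    exacts [hp' hp.2.1 v, hq' hp.2.2 v]
  | loop p hp' => exact Classic.iterate (hp' hp) _ _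
  | id | fst | snd | nil | bit | coin => simp [eval, Classic]
  | isNil | isPair => cases v <;> simp [eval, Classic]

theorem IsClassical.classic_sem {p : Prog} (hp : p.IsClassical) (v : Val) : (p.sem v).Classic :=
  (hp.classic v).strip

/-- Classical programs turn classical inputs into classical outputs. -/
theorem IsClassical.all {p : Prog} (hp : p.IsClassical) {v : Val} (hv : v.IsClassical) :
    (p.eval v).All Val.IsClassical := by
  induction p generalizing v with
  | ask | new | had | phase | cnot | meas => exact hp.elim
  | seq p q hp' hq' => exact All.bind (hp' hp.1 hv) fun a ha => hq' hp.2 ha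
  | fork p q hp' hq' =>
    exact All.bind (hp' hp.1 hv) fun x hx => All.bind (hq' hp.2 hv) fun y hy => ⟨hx, hy⟩
  | ite c p q hc' hp' hq' =>
    refine All.bind (hc' hp.1 hv) fun b _ => ?_
    split_ifs
    exacts [hp' hp.2.1 hv, hq' hp.2.2 hv]
  | loop p hp' =>
    refine All.iterate (fun a ha => hp' hp ha) _ ?_
    cases v <;> simp_all [Val.snd, Val.IsClassical]
  | id => exact hv
  | nil | bit | coin => simp [eval, All, Val.IsClassical]
  | fst => cases v <;> simp_all [eval, All, Val.IsClassical, Val.fst]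
  | snd => cases v <;> simp_all [eval, All, Val.IsClassical, Val.snd]
  | isNil | isPair => cases v <;> simp [eval, All, Val.IsClassical]

/-- Programs are oblivious of addresses. -/
theorem ren_eval (σ : ℕ → ℕ) (p : Prog) (v : Val) :
    Ren σ (fun a b => b = a.rename σ) (p.eval v) (p.eval (v.rename σ)) := by
  induction p generalizing v with
  | seq p q hp hq =>
    refine ⟨rfl, (hp v).bind ?_⟩
    rintro a _ rfl
    exact hq a
  | fork p q hp hq =>
    refine ⟨rfl, (hp v).bind ?_⟩
    rintro a _ rfl
    refine (hq v).bind ?_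
    rintro b _ rfl
    rfl
  | ite c p q hc hp hq =>
    refine ⟨rfl, (hc v).bind ?_⟩
    rintro a _ rfl
    simp only [Val.isTrue_rename]
    split_ifs
    exacts [hp v, hq v]
  | loop p hp =>
    simp only [eval, Val.fst_rename, Val.snd_rename, Val.len_rename]
    refine ⟨rfl, Ren.iterate ?_ _ rfl⟩
    rintro a _ rfl
    exact hp a
  | ask =>
    have : (v.rename σ).size = v.size := by
      induction v <;> simp_all [Val.rename, Val.size]
    simp [eval, Ren, this]
  | fst => simp [eval, Ren, Val.fst_rename]
  | snd => simp [eval, Ren, Val.snd_rename]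
  | id | nil | bit | coin | new => simp [eval, Ren, Val.rename]
  | cnot =>
    cases v with
    | pair x y => cases x <;> cases y <;> simp [eval, Ren, Val.rename, Gate.map]
    | _ => simp [eval, Ren, Val.rename]
  | _ => cases v <;> simp [eval, Ren, Val.rename, Gate.map]

theorem ren_sem (σ : ℕ → ℕ) (p : Prog) (v : Val) :
    Ren σ (fun a b => b = a.rename σ) (p.sem v) (p.sem (v.rename σ)) :=
  (ren_eval σ p v).strip

/-! ### Programs that only rearrange data -/

/-- The program only takes apart and builds pairs. -/
def IsPure : Prog → Prop
  | id | fst | snd | nil | bit _ => True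
  | seq p q => p.IsPure ∧ q.IsPure
  | fork p q => p.IsPure ∧ q.IsPure
  | _ => False

/-- Output of a pure program. -/
def out : Prog → Val → Val
  | fst, v => v.fst
  | snd, v => v.snd
  | nil, _ => .nil
  | bit b, _ => .bit b
  | seq p q, v => q.out (p.out v)
  | fork p q, v => .pair (p.out v) (q.out v)
  | _, v => v

/-- Running time of a pure program. -/
def steps : Prog → ℕ
  | seq p q => p.steps + q.steps + 1
  | fork p q => p.steps + q.steps + 1
  | _ => 1

theorem IsPure.bounded {p : Prog} (hp : p.IsPure) (v : Val) :
    (p.eval v).Bounded p.steps (· = p.out v) := by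
  induction p generalizing v with
  | seq p q hp' hq' =>
    refine ((hp' hp.1 v).bind (t := q.steps) fun a ha => ?_).tick.mono ?_ fun _ => _root_.id
    · rw [ha]
      exact hq' hp.2 _
    · simp only [steps]
      omega
  | fork p q hp' hq' =>
    refine ((hp' hp.1 v).bind (t := q.steps) fun a ha =>
      ((hq' hp.2 v).bind (t := 0) fun b hb => ?_)).tick.mono ?_ fun _ => _root_.id
    · rw [ha, hb]
      exact Bounded.ret rfl
    · simp only [steps]
      omega
  | id | fst | snd | nil | bit => exact ⟨⟨le_rfl, trivial⟩, rfl⟩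
  | _ => exact hp.elim

theorem IsPure.sem_eq {p : Prog} (hp : p.IsPure) (v : Val) : p.sem v = ret (p.out v) := by
  induction p generalizing v with
  | seq p q hp' hq' => simp [hp' hp.1, hq' hp.2, out]
  | fork p q hp' hq' => simp [hp' hp.1, hq' hp.2, out]
  | id | fst | snd | nil | bit => rfl
  | _ => exact hp.elim

/-- Run pure programs one after the other, each on the output of the previous one. -/
def path : List Prog → Prog
  | [] => id
  | p :: l => seq p (path l)

/-! ### Simulation of an interactive program -/

/-- Simulation of the program `p`, all of whose messages are answered by the program `h`, which is
run on the pair of its state and the message and returns the pair of its new state and the reply.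
The input is a pair of a state of `h` and an input of `p`, and so is the output. -/
def sim (h : Prog) : Prog → Prog
  | ask => seq h (fork fst snd)
  | seq p q => seq (sim h p) (sim h q)
  | fork p q =>
      seq (fork (sim h p) snd)
        (seq (fork (path [fst, snd]) (seq (fork (path [fst, fst]) snd) (sim h q)))
          (fork (path [snd, fst]) (fork fst (path [snd, snd]))))
  | ite c p q =>
      seq (fork (sim h c) snd)
        (ite (path [fst, snd]) (seq (fork (path [fst, fst]) snd) (sim h p))
          (seq (fork (path [fst, fst]) snd) (sim h q)))
  | loop p => seq (fork (path [snd, fst]) (fork fst (path [snd, snd]))) (loop (sim h p))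
  | p => fork fst (seq snd p)

/-- The answers that the program `h` gives to messages. -/
def respond (h : Prog) (st m : Val) : Comp (Val × Val) :=
  (h.sem (.pair st m)).bind fun w => ret (w.snd, w.fst)

theorem IsClosed.sem_fork_fst_seq_snd {α : Type} {h p : Prog} (hp : p.IsClosed) (v st : Val)
    {k k' : Val → Comp α} (hk : ∀ w st', k' (.pair st' w) = (k w).interact h.respond st') :
    ((fork fst (seq snd p)).sem (.pair st v)).bind k'
      = ((p.sem v).bind k).interact h.respond st := by
  simp [Val.fst_pair, Val.snd_pair, hk, (hp.silent_sem v).interact_bind]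

/-- Stated with continuations, because the handler's state flows from each part of the program into
the next: the continuation of one part is the simulation of everything after it, and the inductive
hypotheses chain without describing intermediate states. -/
theorem sem_sim {α : Type} (h p : Prog) (v st : Val) {k k' : Val → Comp α}
    (hk : ∀ w st', k' (.pair st' w) = (k w).interact h.respond st') :
    ((sim h p).sem (.pair st v)).bind k' = ((p.sem v).bind k).interact h.respond st := by
  induction p generalizing v st k k' with
  | ask => simp [sim, Comp.bind, interact, respond, hk]
  | seq p q hp hq =>
    simp only [sim, sem_seq, Comp.bind_assoc]
    exact hp v st fun w st' => hq w st' hk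
  | fork p q hp hq =>
    simp only [sim, path, sem_seq, sem_fork, Comp.bind_assoc, sem_id, sem_fst, sem_snd, ret_bind]
    refine hp v st fun x st' => ?_
    simp only [Val.fst_pair, Val.snd_pair]
    refine hq v st' fun y st'' => ?_
    exact hk (.pair x y) st''
  | ite c p q hc hp hq =>
    simp only [sim, path, sem_seq, sem_fork, sem_ite, Comp.bind_assoc, sem_id, sem_fst, sem_snd,
      ret_bind]
    refine hc v st fun x st' => ?_
    simp only [Val.fst_pair, Val.snd_pair]
    by_cases hx : x.isTrue
    · simpa only [hx, if_true] using hp v st' hk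
    · simpa only [hx, if_false, Bool.false_eq_true] using hq v st' hk
  | loop p hp =>
    simp only [sim, path, sem_seq, sem_fork, sem_loop, sem_id, sem_fst, sem_snd,
      ret_bind, Val.fst_pair, Val.snd_pair]
    generalize v.fst.len = n
    generalize v.snd = x
    induction n generalizing x st with
    | zero => simp [iterate, hk]
    | succ n ih =>
      simp only [iterate, Comp.bind_assoc]
      exact hp x st fun w st' => ih st' w
  | _ =>
    refine IsClosed.sem_fork_fst_seq_snd ?_ v st hk
    trivial

/-- A computation that takes no time steps and sends no messages. -/
def _root_.CertDel.Comp.Instant {α : Type} : Comp α → Prop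
  | ret _ => True
  | tick _ _ => False
  | Comp.coin k => ∀ b, (k b).Instant
  | Comp.new k => ∀ q, (k q).Instant
  | gate _ k => k.Instant
  | Comp.meas _ k => ∀ b, (k b).Instant
  | Comp.ask _ _ => False

/-- An instantaneous computation consumes no budget, so on every branch the two continuations start
with the full budgets `s` and `t`. -/
theorem _root_.CertDel.Comp.Instant.timeLE_bind {α β γ : Type} {c : Comp α} (hc : c.Instant)
    {k : α → Comp β} {k' : α → Comp γ} {s t : ℕ}
    (h : ∀ a, (k a).TimeLE s → (k' a).TimeLE t) (hk : (c.bind k).TimeLE s) :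
    (c.bind k').TimeLE t := by
  induction c with
  | ret a => exact h a hk
  | tick | ask => exact hc.elim
  | coin k ih => exact fun b => ih b (hc b) (hk b)
  | new k ih => exact fun b => ih b (hc b) (hk b)
  | gate g k ih => exact ih hc hk
  | meas q k ih => exact fun b => ih b (hc b) (hk b)

/-- The elementary instructions other than `ask`. -/
def IsPrim : Prog → Prop
  | seq _ _ | fork _ _ | ite _ _ _ | loop _ | ask => False
  | _ => True

theorem IsPrim.eval_eq {p : Prog} (hp : p.IsPrim) (v : Val) :
    ∃ c, p.eval v = tick 1 c ∧ c.Instant := by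
  cases p with
  | seq | fork | ite | loop | ask => exact hp.elim
  | id | fst | snd | nil | bit | coin | new => exact ⟨_, rfl, by simp [Instant]⟩
  | cnot =>
    cases v with
    | pair x y => cases x <;> cases y <;> exact ⟨_, rfl, by simp [Instant]⟩
    | _ => exact ⟨_, rfl, by simp [Instant]⟩
  | _ => cases v <;> exact ⟨_, rfl, by simp [Instant]⟩

theorem timeLE_fork_fst_seq_snd {α β : Type} {p : Prog} (hp : p.IsPrim) {v st : Val} {k : Val → Comp α} {k' : Val → Comp β}
    {F D T : ℕ} (hF : 40 ≤ F)
    (hk : ∀ w T', T' ≤ T → (k w).TimeLE T' → (k' (.pair st w)).TimeLE (F * T' + D))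
    (h : ((p.eval v).bind k).TimeLE T) :
    (((fork fst (seq snd p)).eval (.pair st v)).bind k').TimeLE (F * T + D) := by
  obtain ⟨c, hpc, hc⟩ := hp.eval_eq v
  simp only [eval, Comp.bind, Val.fst, Val.snd, hpc, Comp.bind_assoc, timeLE_tick_tick] at h ⊢
  obtain ⟨h₁, h₂⟩ := h
  obtain ⟨T, rfl⟩ : ∃ T', T = T' + 1 := ⟨T - 1, by omega⟩
  refine TimeLE.tick (s := F * T + D) ?_ (by rw [mul_add]; omega)
  exact hc.timeLE_bind (fun w hw => hk w T (by omega) hw) h₂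

/-- Amortisation: each simulated step brings a credit of `F`. With the reserve `D` it must pay for
the `a` administrative steps and for the reserve `b` handed to the rest. -/
theorem TimeLE.of_tick {α β : Type} {a b F D T : ℕ} {k : Comp α} {l : Comp β}
    (h : (tick 1 k).TimeLE T) (hF : a + b ≤ F + D)
    (hl : ∀ T', T' ≤ T → k.TimeLE T' → l.TimeLE (F * T' + b)) :
    (tick a l).TimeLE (F * T + D) := by
  obtain ⟨h₁, h₂⟩ := h
  obtain ⟨T, rfl⟩ : ∃ T', T = T' + 1 := ⟨T - 1, by omega⟩
  refine TimeLE.tick (hl T (by omega) h₂) ?_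
  rw [mul_add]
  omega

/-- Running time of a simulation: if the simulated program takes time `T`, and every answer to a
message takes time `H`, then the simulation takes time `O (H * T)`. -/
theorem timeLE_sim {α β : Type} {h : Prog} {Inv : Val → Prop} {H T₀ F : ℕ}
    (hh : ∀ st m, Inv st → m.size ≤ T₀ → (h.eval (.pair st m)).Bounded H fun w => Inv w.fst)
    (hF : H + 80 ≤ F) (p : Prog) {v st : Val} {k : Val → Comp α} {k' : Val → Comp β} {D T : ℕ}
    (hT : T ≤ T₀) (hst : Inv st)
    (hk : ∀ w st' T', T' ≤ T → Inv st' → (k w).TimeLE T' →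
      (k' (.pair st' w)).TimeLE (F * T' + D))
    (hp : ((p.eval v).bind k).TimeLE T) :
    (((sim h p).eval (.pair st v)).bind k').TimeLE (F * T + D) := by
  induction p generalizing v st k k' D T with
  | ask =>
    simp only [sim, eval, Comp.bind, Comp.bind_assoc] at hp ⊢
    obtain ⟨h₁, h₂⟩ := hp
    -- Sending costs `1 + v.size`, so the remaining budget itself certifies that the message has
    -- size at most `T₀`, as `hh` requires.
    obtain ⟨T, rfl⟩ : ∃ T', T = T' + (1 + v.size) := ⟨T - (1 + v.size), by omega⟩
    rw [Nat.add_sub_cancel] at h₂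
    have hb := hh st v hst (by omega)
    refine TimeLE.tick (s := H + (F * T + D + 3)) (hb.1.bind hb.2 fun w hw => ?_) ?_
    · simp only [timeLE_tick_tick]
      exact (hk w.snd w.fst T (by omega) hw (h₂ _)).tick (by omega)
    · rw [mul_add]
      have : F * 1 ≤ F * (1 + v.size) := Nat.mul_le_mul_left _ (by omega)
      omega
  | seq p q hp' hq' =>
    simp only [sim, eval, Comp.bind, Comp.bind_assoc] at hp ⊢
    refine TimeLE.of_tick hp (b := D) (by omega) fun T' hT' h' => ?_
    refine hp' (k := fun x => (q.eval x).bind k) (by omega) hst (fun w st' T'' hT'' hst' hw => ?_) h'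
    exact hq' (by omega) hst' (fun w st' T' hT' => hk w st' T' (by omega)) hw
  | fork p q hp' hq' =>
    simp only [sim, path, eval, Comp.bind, Comp.bind_assoc, timeLE_tick_tick] at hp ⊢
    -- Of the credit `F ≥ 80`, at most 60 steps are reserved for rearranging pairs around the
    -- simulated parts. In the inductive calls this reserve is part of the additive constant.
    refine TimeLE.of_tick hp (b := D + 60) (by omega) fun T' hT' h' => ?_
    refine hp' (k := fun x => (q.eval v).bind fun y => k (.pair x y)) (by omega) hst
      (fun w st' T'' hT'' hst' hw => ?_) h'
    simp only [timeLE_tick_tick, Val.fst_pair, Val.snd_pair]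
    refine TimeLE.tick (s := F * T'' + (D + 30)) ?_ (by omega)
    refine hq' (k := fun y => k (.pair w y)) (by omega) hst'
      (fun y st'' T₃ hT₃ hst'' hy => ?_) hw
    simp only [timeLE_tick_tick, Val.fst_pair, Val.snd_pair]
    exact (hk _ st'' T₃ (by omega) hst'' hy).tick (by omega)
  | ite c p q hc hp' hq' =>
    simp only [sim, path, eval, Comp.bind, Comp.bind_assoc, timeLE_tick_tick] at hp ⊢
    refine TimeLE.of_tick hp (b := D + 60) (by omega) fun T' hT' h' => ?_
    refine hc (k := fun b => Comp.bind (if b.isTrue then p.eval v else q.eval v) k) (by omega) hst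
      (fun w st' T'' hT'' hst' hw => ?_) h'
    simp only [timeLE_tick_tick, Val.fst_pair, Val.snd_pair]
    by_cases hx : w.isTrue
    · simp only [hx, if_true, Comp.bind, timeLE_tick_tick] at hw ⊢
      refine TimeLE.tick (s := F * T'' + D) ?_ (by omega)
      exact hp' (by omega) hst' (fun w st' T' hT' => hk w st' T' (by omega)) hw
    · simp only [hx, if_false, Bool.false_eq_true, Comp.bind, timeLE_tick_tick] at hw ⊢
      refine TimeLE.tick (s := F * T'' + D) ?_ (by omega)
      exact hq' (by omega) hst' (fun w st' T' hT' => hk w st' T' (by omega)) hw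
  | loop p hp' =>
    simp only [sim, path, eval, Comp.bind, timeLE_tick_tick, Val.fst_pair,
      Val.snd_pair] at hp ⊢
    refine TimeLE.of_tick hp (b := D) (by omega) fun T' hT' h' => ?_
    clear hp
    generalize v.fst.len = n at h' ⊢
    generalize v.snd = x at h' ⊢
    -- The original budget is replaced by what is left on entering the loop, which then decreases
    -- from one iteration to the next in the induction.
    replace hk := fun w st' T'' (h : T'' ≤ T') => hk w st' T'' (h.trans hT')
    replace hT := hT'.trans hT
    clear hT'
    induction n generalizing x st T' with
    | zero => exact hk x st T' le_rfl hst h'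
    | succ n ih =>
      simp only [iterate, Comp.bind_assoc] at h' ⊢
      refine hp' (k := fun x => (iterate p.eval n x).bind k) hT hst
        (fun w st' T'' hT'' hst' hw => ?_) h'
      exact ih hst' T'' w hw (fun w st' T₃ h => hk w st' T₃ (by omega)) (by omega)
  | _ =>
    refine timeLE_fork_fst_seq_snd ?_ (by omega)
      (fun w T' hT' hw => hk w st T' hT' hst hw) hp
    trivial

end Prog

/-! ## Polynomial time -/

theorem eval_mono (t : Polynomial ℕ) {a b : ℕ} (h : a ≤ b) : t.eval a ≤ t.eval b := by
  rw [Polynomial.eval_eq_sum_range, Polynomial.eval_eq_sum_range]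
  exact Finset.sum_le_sum fun i _ => Nat.mul_le_mul_left _ (Nat.pow_le_pow_left h i)

namespace Val

theorem size_fst_le (v : Val) : v.fst.size ≤ v.size := by
  cases v <;> simp [fst, size]
  omega

theorem size_snd_le (v : Val) : v.snd.size ≤ v.size := by
  cases v <;> simp [snd, size]
  omega

end Val

namespace Prog

open CertDel.Comp

/-- Explicit form of `PolyTime`. -/
def TimeBound (p : Prog) (t : Polynomial ℕ) : Prop :=
  ∀ (v : Val) (N : ℕ), v.size ≤ N → (p.eval v).Bounded (t.eval N) fun w => w.size ≤ t.eval N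

theorem PolyTime.exists_timeBound {p : Prog} (hp : p.PolyTime) : ∃ t, p.TimeBound t := by
  obtain ⟨t, ht⟩ := hp
  exact ⟨t, fun v N hN => Bounded.mono (ht v) (eval_mono t hN) fun w hw => hw.trans (eval_mono t hN)⟩

theorem PolyTime.seq {p q : Prog} (hp : p.PolyTime) (hq : q.PolyTime) : (seq p q).PolyTime := by
  obtain ⟨s, hs⟩ := hp
  obtain ⟨t, ht⟩ := hq.exists_timeBound
  refine ⟨1 + (s + t.comp s), fun v => ?_⟩
  refine Bounded.tick (t := (s + t.comp s).eval v.size) ?_ |>.mono (by simp) fun _ => _root_.id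
  refine (Bounded.bind (hs v) fun a ha => ht a _ ha).mono (by simp) fun w hw => ?_
  simp only [Polynomial.eval_add, Polynomial.eval_comp, Polynomial.eval_one]
  omega

theorem PolyTime.fork {p q : Prog} (hp : p.PolyTime) (hq : q.PolyTime) : (fork p q).PolyTime := by
  obtain ⟨s, hs⟩ := hp
  obtain ⟨t, ht⟩ := hq
  refine ⟨1 + (s + t), fun v => ?_⟩
  refine Bounded.tick (t := (s + t).eval v.size) ?_ |>.mono (by simp) fun _ => _root_.id
  refine (Bounded.bind (hs v) fun a ha => Bounded.bind (ht v) (t := 0) fun b hb =>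
    Bounded.ret (E := fun w : Val => w.size ≤ (1 + (s + t)).eval v.size) ?_).mono (by simp) fun w hw => hw
  simp only [Polynomial.eval_add, Polynomial.eval_one, Val.size]
  omega

theorem PolyTime.ite {c p q : Prog} (hc : c.PolyTime) (hp : p.PolyTime) (hq : q.PolyTime) :
    (ite c p q).PolyTime := by
  obtain ⟨r, hr⟩ := hc
  obtain ⟨s, hs⟩ := hp
  obtain ⟨t, ht⟩ := hq
  refine ⟨1 + (r + (s + t)), fun v => ?_⟩
  refine Bounded.tick (t := (r + (s + t)).eval v.size) ?_ |>.mono (by simp) fun _ => _root_.id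
  refine (Bounded.bind (hr v) (t := (s + t).eval v.size) fun a _ => ?_).mono (by simp) fun w hw => hw
  simp only [Polynomial.eval_add, Polynomial.eval_one]
  split_ifs
  · exact Bounded.mono (hs v) (by omega) fun w hw => by omega
  · exact Bounded.mono (ht v) (by omega) fun w hw => by omega

theorem IsPure.polyTime {p : Prog} (hp : p.IsPure) : p.PolyTime := by
  induction p with
  | seq p q hp' hq' => exact (hp' hp.1).seq (hq' hp.2)
  | fork p q hp' hq' => exact (hp' hp.1).fork (hq' hp.2)
  | id => exact ⟨Polynomial.X + 1, fun v => ⟨⟨by simp, trivial⟩, by simp [eval, All]⟩⟩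
  | fst =>
    exact ⟨Polynomial.X + 1, fun v => ⟨⟨by simp, trivial⟩, by
      simpa [eval, All] using v.size_fst_le.trans (Nat.le_succ _)⟩⟩
  | snd =>
    exact ⟨Polynomial.X + 1, fun v => ⟨⟨by simp, trivial⟩, by
      simpa [eval, All] using v.size_snd_le.trans (Nat.le_succ _)⟩⟩
  | nil | bit =>
    exact ⟨Polynomial.X + 1, fun v => ⟨⟨by simp, trivial⟩, by simp [eval, All, Val.size]⟩⟩
  | _ => exact hp.elim

theorem IsPure.isClosed {p : Prog} (hp : p.IsPure) : p.IsClosed := by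
  induction p <;> simp_all [IsPure, IsClosed]

theorem IsPure.qpt {p : Prog} (hp : p.IsPure) : p.QPT := ⟨hp.isClosed, hp.polyTime⟩

theorem PPT.qpt {p : Prog} (hp : p.PPT) : p.QPT := ⟨hp.1.isClosed, hp.2⟩

theorem QPT.seq {p q : Prog} (hp : p.QPT) (hq : q.QPT) : (seq p q).QPT :=
  ⟨⟨hp.1, hq.1⟩, hp.2.seq hq.2⟩

theorem QPT.fork {p q : Prog} (hp : p.QPT) (hq : q.QPT) : (fork p q).QPT :=
  ⟨⟨hp.1, hq.1⟩, hp.2.fork hq.2⟩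

theorem QPT.ite {c p q : Prog} (hc : c.QPT) (hp : p.QPT) (hq : q.QPT) : (ite c p q).QPT :=
  ⟨⟨hc.1, hp.1, hq.1⟩, hc.2.ite hp.2 hq.2⟩

end Prog

/-! ## The hybrid scheme -/

namespace Comp

variable {α β : Type}

/-- A classical computation has total mass `1` and does not touch the memory, so it has no effect if
its result is ignored. -/
theorem Classic.wp_drop {c : Comp α} (hc : c.Classic) (f : ℕ → Mem → ℝ) :
    c.wp (fun _ => f) = f := by
  funext n ψ
  rw [hc.wp_eq _ n n ψ ψ, hc.wp_const]

theorem Classic.weight_bind_const {c : Comp α} (hc : c.Classic) (E : β → Prop) (d : Comp β) :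
    (c.bind fun _ => d).weight E = d.weight E := by
  rw [weight_bind, hc.wp_drop]

/-- Its outcome is independent of the memory, which therefore contributes only its norm as a factor.
-/
theorem Classic.weight_eq {c : Comp α} (hc : c.Classic) (E : α → Prop) :
    c.weight E = fun _ ψ => c.prob E * ψ.normSq := by
  classical
  have h (n : ℕ) (ψ : Mem) : c.weight E n ψ
      = ψ.normSq * c.wp (fun a _ _ => if E a then 1 else 0) 0 0 := by
    rw [weight_eq_wp, hc.wp_eq _ n 0 ψ 0, ← wp_mul_left]
    simp
  funext n ψ
  rw [prob, h, h, Mem.normSq_single]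
  simp [mul_comm]

end Comp

theorem Negligible.add {f g : ℕ → ℝ} (hf : Negligible f) (hg : Negligible g) :
    Negligible fun n => f n + g n := by
  intro c
  -- One more power of `n` provides the factor `1 / n ≤ 1 / 2` that absorbs the sum of two terms.
  obtain ⟨N₁, h₁⟩ := hf (c + 1)
  obtain ⟨N₂, h₂⟩ := hg (c + 1)
  refine ⟨max (max N₁ N₂) 1, fun n hn => ?_⟩
  simp only [max_lt_iff] at hn
  have hn2 : (2 : ℝ) ≤ n := by exact_mod_cast hn.2
  have hpos : (0 : ℝ) < (n : ℝ) ^ c := by positivity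
  have key : ((n : ℝ) ^ (c + 1))⁻¹ ≤ ((n : ℝ) ^ c)⁻¹ / 2 := by
    rw [pow_succ, mul_inv, div_eq_mul_inv]
    gcongr
  have := h₁ n hn.1.1
  have := h₂ n hn.1.2
  linarith

theorem Negligible.mono {f g : ℕ → ℝ} (hg : Negligible g) (h : ∀ n, f n ≤ g n) : Negligible f :=
  fun c => (hg c).imp fun _ hN n hn => (h n).trans_lt (hN n hn)

section Hybrid

open Prog CertDel.Comp

variable {nce : NCABE} {ske : SKECD} {V : PolicySystem} {M : Space} {ℓ : ℕ → ℕ}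

@[simp] theorem hybrid_setup : (hybrid nce ske).setup = nce.setup := rfl
@[simp] theorem hybrid_keyGen : (hybrid nce ske).keyGen = nce.keyGen := rfl
@[simp] theorem hybrid_vrfy : (hybrid nce ske).vrfy = ske.vrfy := rfl

theorem sem_hybrid_enc (u pk X m : Val) :
    (hybrid nce ske).enc.sem (.tuple [u, pk, X, m])
      = (ske.gen.sem u).bind fun sk => (nce.enc.sem (.tuple [u, pk, X, sk])).bind fun c =>
        (ske.enc.sem (.tuple [u, sk, m])).bind fun d => ret (.pair sk (.pair c d)) := by
  simp [hybrid, arg, rest, Prog.tuple, Val.tuple]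

theorem sem_hybrid_dec (u k c d : Val) :
    (hybrid nce ske).dec.sem (.tuple [u, k, .pair c d])
      = (nce.dec.sem (.tuple [u, k, c])).bind fun sk =>
        if sk.fst.isTrue then ske.dec.sem (.tuple [u, sk.snd, d]) else ret .bot := by
  simp [hybrid, arg, rest, Prog.tuple, Val.tuple, Val.bot]

theorem sem_hybrid_del (u c d : Val) :
    (hybrid nce ske).del.sem (.tuple [u, .pair c d]) = ske.del.sem (.tuple [u, d]) := by
  simp [hybrid, arg, rest, Prog.tuple, Val.tuple]

/-- The glue consists of pure programs, so the QPT property is inherited from the components. Keys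
are classical because classical programs preserve classicality; the verification key is an output of
`ske.gen`, which is a bit string by assumption even though the algorithm may be quantum. -/
theorem hybrid_wellFormed (hnce : nce.WellFormed) (hske : ske.WellFormed (bitStrings ℓ)) :
    (hybrid nce ske).WellFormed V M where
  setup := hnce.setup.qpt
  keyGen := hnce.keyGen.qpt
  enc := by
    simp only [hybrid, arg, rest, Prog.tuple]
    refine ((QPT.fork (.seq (IsPure.qpt ?_) hske.gen) (IsPure.qpt ?_))).seq
      (.fork (IsPure.qpt ?_) (.fork (.seq (IsPure.qpt ?_) hnce.enc.qpt)
        (.seq (IsPure.qpt ?_) hske.enc))) <;> simp [IsPure]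
  dec := by
    simp only [hybrid, arg, rest, Prog.tuple]
    refine ((QPT.fork (.seq (IsPure.qpt ?_) hnce.dec.qpt) (IsPure.qpt ?_))).seq
      (.ite (IsPure.qpt ?_) (.seq (IsPure.qpt ?_) hske.dec) (IsPure.qpt ?_)) <;> simp [IsPure]
  del := by
    simp only [hybrid, arg, rest, Prog.tuple]
    refine QPT.seq (IsPure.qpt ?_) hske.del
    simp [IsPure]
  vrfy := hske.vrfy
  keys n := hnce.setup.1.all (Val.isClassical_unary n)
  policyKey n msk hmsk P _ :=
    hnce.keyGen.1.all ⟨Val.isClassical_unary n, hmsk, Val.isClassical_str P⟩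
  verificationKey n pk _ X _ m _ := by
    rw [← all_strip, strip_run, sem_hybrid_enc]
    refine All.bind (all_strip.2 (hske.key n)) fun sk hsk => ?_
    refine All.bind (all_true _) fun c _ => All.bind (all_true _) fun d _ => ?_
    obtain ⟨k, -, rfl⟩ := hsk
    exact Val.isClassical_str k
  cert n ct := by
    rw [← all_strip, strip_run]
    have h : (hybrid nce ske).del.sem (.tuple [.unary n, ct])
        = ske.del.sem (.tuple [.unary n, ct.snd]) := by
      simp [hybrid, arg, rest, Prog.tuple, Val.tuple]
    rw [h]
    exact all_strip.2 (hske.cert n ct.snd)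

/-- Verification never looks at the non-committing ciphertext, so setup and `nce.enc` can be
dropped, with no additional error. -/
theorem hybrid_vrfyCorrect (hnce : nce.WellFormed) (h : ske.VrfyCorrect M) :
    (hybrid nce ske).VrfyCorrect V M := by
  obtain ⟨ν, hν, h⟩ := h
  refine ⟨ν, hν, fun n X _ m hm => le_of_eq_of_le ?_ (h n m hm)⟩
  refine (prob_strip _ _).symm.trans (Eq.trans ?_ (prob_strip _ _))
  simp only [monad_bind_eq, strip_bind, strip_run, hybrid_setup, hybrid_vrfy, sem_hybrid_enc,
    Comp.bind_assoc, ret_bind, Val.fst_pair, Val.snd_pair, sem_hybrid_del]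
  simp only [prob]
  rw [weight_bind]
  have h (k sk : Val) (d : Comp Val) :
      ((nce.enc.sem (.tuple [.unary n, k.fst, .str X, sk])).bind fun _ => d).weight
        (fun r => r.isTrue = false) = d.weight fun r => r.isTrue = false :=
    (hnce.enc.1.classic_sem _).weight_bind_const _ d
  simp only [weight_bind _ (ske.gen.sem _), h]
  rw [(hnce.setup.1.classic_sem _).wp_drop]
  rfl

/-- Union bound. In the first term everything quantum except the sampling of the key is removed, and
the correctness of `nce` is applied for each fixed key; in the second the classical steps of `nce`
are removed. -/
theorem hybrid_decCorrect (hnce : nce.WellFormed) (hske : ske.WellFormed (bitStrings ℓ))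
    (h₁ : nce.Correct V (bitStrings ℓ)) (h₂ : ske.DecCorrect M) :
    (hybrid nce ske).DecCorrect V M := by
  classical
  obtain ⟨ν₁, hν₁, h₁⟩ := h₁
  obtain ⟨ν₂, hν₂, h₂⟩ := h₂
  refine ⟨_, hν₁.add hν₂, fun n m hm P hP X hX hPX => ?_⟩
  specialize h₂ n m hm
  replace h₁ := fun k hk => h₁ n k hk P hP X hX hPX
  rw [← prob_strip] at h₂ ⊢
  replace h₁ := fun k hk => (prob_strip _ _).trans_le (h₁ k hk)
  simp only [monad_bind_eq, strip_bind, strip_run, hybrid_setup, hybrid_keyGen, sem_hybrid_enc,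
    Comp.bind_assoc, ret_bind, Val.snd_pair, sem_hybrid_dec] at h₁ h₂ ⊢
  set u := Val.unary n
  have setup := hnce.setup.1.classic_sem (.tuple [u])
  have keyGen (k : Val) := hnce.keyGen.1.classic_sem (.tuple [u, k.snd, .str P])
  have enc (k sk : Val) := hnce.enc.1.classic_sem (.tuple [u, k.fst, .str X, sk])
  have dec (skP c : Val) := hnce.dec.1.classic_sem (.tuple [u, skP, c])
  -- decryption fails only if one of the two schemes fails
  have split : ∀ skP c sk d n ψ,
      ((nce.dec.sem (.tuple [u, skP, c])).bind fun r =>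
        (if r.fst.isTrue then ske.dec.sem (.tuple [u, r.snd, d])
          else ret .bot : Comp Val)).weight (· ≠ .some (.str m)) n ψ
      ≤ (nce.dec.sem (.tuple [u, skP, c])).weight (· ≠ .some sk) n ψ
        + (ske.dec.sem (.tuple [u, sk, d])).weight (· ≠ .some (.str m)) n ψ := by
    intro skP c sk d n ψ
    rw [weight_bind, weight_eq_wp (c := nce.dec.sem _),
      ← congrFun₂ ((dec skP c).wp_drop (Comp.weight _ (ske.dec.sem _))) n ψ, ← wp_add]
    refine wp_mono (fun r n ψ => ?_) _ n ψ
    by_cases hr : r = .some sk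
    · simp [hr, Val.some, Val.isTrue]
    · rw [if_pos hr]
      have h1 := weight_le_normSq (· ≠ .some (.str m)) (if r.fst.isTrue then
        ske.dec.sem (.tuple [u, r.snd, d]) else ret .bot : Comp Val) n ψ
      have h2 := weight_nonneg (· ≠ .some (.str m)) (ske.dec.sem (.tuple [u, sk, d])) n ψ
      linarith
  have total : ∀ k skP n ψ,
      ((ske.gen.sem u).bind fun sk =>
        (nce.enc.sem (.tuple [u, Val.fst k, .str X, sk])).bind fun c =>
        (ske.enc.sem (.tuple [u, sk, .str m])).bind fun d =>
        (nce.dec.sem (.tuple [u, skP, c])).bind fun r =>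
        (if r.fst.isTrue then ske.dec.sem (.tuple [u, r.snd, d])
          else ret .bot : Comp Val)).weight (· ≠ .some (.str m)) n ψ
      ≤ (ske.gen.sem u).wp (fun sk =>
          ((nce.enc.sem (.tuple [u, k.fst, .str X, sk])).bind fun c =>
          nce.dec.sem (.tuple [u, skP, c])).weight (· ≠ .some sk)) n ψ
        + ((ske.gen.sem u).bind fun sk => (ske.enc.sem (.tuple [u, sk, .str m])).bind fun d =>
          ske.dec.sem (.tuple [u, sk, d])).weight (· ≠ .some (.str m)) n ψ := by
    intro k skP n ψ
    rw [weight_bind, weight_bind, ← wp_add]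
    refine wp_mono (fun sk n ψ => ?_) _ n ψ
    rw [weight_bind, weight_bind,
      ← congrFun₂ ((enc k sk).wp_drop (Comp.weight _ (Comp.bind _ _))) n ψ, ← wp_add]
    refine wp_mono (fun c n ψ => ?_) _ n ψ
    -- Inserting `ske.enc` is harmless: failure of the classical decryption is a constant times the
    -- squared norm, which encryption preserves on average.
    have hd : (nce.dec.sem (.tuple [u, skP, c])).weight (· ≠ .some sk) n ψ
        = (ske.enc.sem (.tuple [u, sk, .str m])).wp
          (fun _ => (nce.dec.sem (.tuple [u, skP, c])).weight (· ≠ .some sk)) n ψ := by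
      simp only [(dec skP c).weight_eq, wp_mul_left, (hske.enc.1.silent_sem _).wp_normSq]
    rw [hd, weight_bind, weight_bind, ← wp_add]
    exact wp_mono (fun d n ψ => split skP c sk d n ψ) _ n ψ
  -- Setup and key generation, being classical, move inside the sampling of `sk`, so that for each
  -- `sk` the probability bounded by `nce.Correct` appears.
  have comm : (nce.setup.sem (.tuple [u])).wp (fun k =>
      (nce.keyGen.sem (.tuple [u, k.snd, .str P])).wp fun skP => (ske.gen.sem u).wp fun sk =>
        ((nce.enc.sem (.tuple [u, k.fst, .str X, sk])).bind fun c =>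
          nce.dec.sem (.tuple [u, skP, c])).weight (· ≠ .some sk)) 0 (Finsupp.single ∅ 1)
      = (ske.gen.sem u).wp (fun sk n ψ =>
        ((nce.setup.sem (.tuple [u])).bind fun k =>
        (nce.keyGen.sem (.tuple [u, k.snd, .str P])).bind fun skP =>
        (nce.enc.sem (.tuple [u, k.fst, .str X, sk])).bind fun c =>
          nce.dec.sem (.tuple [u, skP, c])).prob (· ≠ .some sk) * ψ.normSq)
        0 (Finsupp.single ∅ 1) := by
    have h1 : ∀ k : Val, (nce.keyGen.sem (.tuple [u, k.snd, .str P])).wp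
        (fun skP => (ske.gen.sem u).wp fun sk =>
        ((nce.enc.sem (.tuple [u, k.fst, .str X, sk])).bind fun c =>
          nce.dec.sem (.tuple [u, skP, c])).weight (· ≠ .some sk))
        = (ske.gen.sem u).wp fun sk => ((nce.keyGen.sem (.tuple [u, k.snd, .str P])).bind fun skP =>
        (nce.enc.sem (.tuple [u, k.fst, .str X, sk])).bind fun c =>
          nce.dec.sem (.tuple [u, skP, c])).weight (· ≠ .some sk) := by
      intro k
      funext n ψ
      rw [(keyGen k).wp_wp_comm]
      simp only [weight_bind]
    simp only [h1]
    rw [setup.wp_wp_comm]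
    congr 1
    funext sk n ψ
    rw [← weight_bind, Classic.weight_eq]
    exact setup.bind fun k => (keyGen k).bind fun skP => (enc k sk).bind fun c => dec skP c
  have bound : (ske.gen.sem u).wp (fun sk n ψ =>
        ((nce.setup.sem (.tuple [u])).bind fun k =>
        (nce.keyGen.sem (.tuple [u, k.snd, .str P])).bind fun skP =>
        (nce.enc.sem (.tuple [u, k.fst, .str X, sk])).bind fun c =>
          nce.dec.sem (.tuple [u, skP, c])).prob (· ≠ .some sk) * ψ.normSq)
        0 (Finsupp.single ∅ 1) ≤ ν₁ n := by
    refine (wp_mono_of_all (g := fun _ _ ψ => ν₁ n * ψ.normSq) ?_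
      (all_strip.2 (hske.key n)) _ _).trans ?_
    · rintro _ n ψ ⟨k, hk, rfl⟩
      exact mul_le_mul_of_nonneg_right (h₁ k hk) ψ.normSq_nonneg
    · have hn : (ske.gen.sem u).wp (fun _ _ ψ => ψ.normSq) 0 (Finsupp.single ∅ 1) = 1 := by
        rw [(hske.gen.1.silent_sem u).wp_normSq, Mem.normSq_single]
        simp
      rw [wp_mul_left]
      exact ((congrArg (ν₁ n * ·) hn).trans (mul_one _)).le
  refine le_trans ?_ (add_le_add (comm.trans_le bound) h₂)
  rw [prob, prob, weight_bind,
    ← congrFun₂ (setup.wp_drop (Comp.weight _ (Comp.bind (ske.gen.sem _) _))), ← wp_add]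
  refine wp_mono (fun k n ψ => ?_) _ _ _
  rw [weight_bind,
    ← congrFun₂ ((keyGen k).wp_drop (Comp.weight _ (Comp.bind (ske.gen.sem _) _))), ← wp_add]
  exact wp_mono (fun skP n ψ => total k skP n ψ) _ _ _

end Hybrid

/-! ## Rules of protocols -/

namespace Comp

variable {α β σ σ' ρ ρ' : Type}

theorem obeys_strip {move : ρ → Val → ρ → Prop} {c : Comp α} {s : ρ} :
    c.strip.Obeys move s ↔ c.Obeys move s := by
  induction c generalizing s <;> simp_all [Obeys, strip]

/-- The messages obey the rules, and the result and the final situation satisfy `post`. -/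
def ObeysTo (move : ρ → Val → ρ → Prop) (post : α → ρ → Prop) : Comp α → ρ → Prop
  | ret a, s => post a s
  | tick _ k, s => k.ObeysTo move post s
  | coin k, s => ∀ b, (k b).ObeysTo move post s
  | new k, s => ∀ q, (k q).ObeysTo move post s
  | gate _ k, s => k.ObeysTo move post s
  | meas _ k, s => ∀ b, (k b).ObeysTo move post s
  | ask m k, s => ∃ s', move s m s' ∧ ∀ r, (k r).ObeysTo move post s'

theorem ObeysTo.bind_obeys {move : ρ → Val → ρ → Prop} {post : α → ρ → Prop} {c : Comp α}
    {f : α → Comp β} {s : ρ} (hc : c.ObeysTo move post s)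
    (hf : ∀ a s, post a s → (f a).Obeys move s) : (c.bind f).Obeys move s := by
  induction c generalizing s with
  | ask m k ih =>
    obtain ⟨s', hs', hk⟩ := hc
    exact ⟨s', hs', fun r => ih r (hk r)⟩
  | _ => simp_all [Comp.bind, ObeysTo, Obeys]

theorem ObeysTo.bind {move : ρ → Val → ρ → Prop} {post : α → ρ → Prop} {post' : β → ρ → Prop}
    {c : Comp α} {f : α → Comp β} {s : ρ} (hc : c.ObeysTo move post s)
    (hf : ∀ a s, post a s → (f a).ObeysTo move post' s) : (c.bind f).ObeysTo move post' s := by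
  induction c generalizing s with
  | ask m k ih =>
    obtain ⟨s', hs', hk⟩ := hc
    exact ⟨s', hs', fun r => ih r (hk r)⟩
  | _ => simp_all [Comp.bind, ObeysTo]

theorem Silent.obeysTo {move : ρ → Val → ρ → Prop} {E : α → Prop} {c : Comp α} (hc : c.Silent)
    (hE : c.All E) (s : ρ) : c.ObeysTo move (fun a t => E a ∧ t = s) s := by
  induction c <;> simp_all [Silent, All, ObeysTo]

theorem Silent.bind_obeysTo {move : ρ → Val → ρ → Prop} {E : α → Prop} {c : Comp α}
    (hc : c.Silent) (hE : c.All E) {s : ρ} {post : β → ρ → Prop} {f : α → Comp β}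
    (hf : ∀ a, E a → (f a).ObeysTo move post s) : (c.bind f).ObeysTo move post s :=
  (hc.obeysTo hE s).bind fun a _ h => h.2 ▸ hf a h.1

theorem Obeys.bind_ret {move : ρ → Val → ρ → Prop} {c : Comp α} {s : ρ} (hc : c.Obeys move s)
    (f : α → β) : (c.bind fun a => ret (f a)).Obeys move s := by
  induction c generalizing s with
  | ask m k ih =>
    obtain ⟨s', hs', hk⟩ := hc
    exact ⟨s', hs', fun r => ih r (hk r)⟩
  | _ => simp_all [Comp.bind, Obeys]

theorem Silent.bind_obeys {move : ρ → Val → ρ → Prop} {c : Comp α} (hc : c.Silent) {s : ρ}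
    {f : α → Comp β} (hf : ∀ a, (f a).Obeys move s) : (c.bind f).Obeys move s := by
  induction c <;> simp_all [Silent, Obeys, Comp.bind]

/-- It suffices to check one message at a time: a move from `s` to `s'` on the inside has to cause
moves from `f s` to `f s'` on the outside, for handler states satisfying `Inv`. -/
theorem Obeys.interact {move : ρ → Val → ρ → Prop} {move' : ρ' → Val → ρ' → Prop}
    {R : σ → Val → Comp (Val × σ)} {f : ρ → ρ'} {Inv : σ → Prop}
    (hR : ∀ s m s' st, move s m s' → Inv st →
      (R st m).ObeysTo move' (fun x t => Inv x.2 ∧ t = f s') (f s))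
    {c : Comp α} {s : ρ} (hc : c.Obeys move s) {st : σ} (hst : Inv st) :
    (c.interact R st).Obeys move' (f s) := by
  induction c generalizing s st with
  | ask m k ih =>
    obtain ⟨s', hs', hk⟩ := hc
    refine (hR s m s' st hs' hst).bind_obeys ?_
    rintro x _ ⟨hx, rfl⟩
    exact ih _ (hk _) hx
  | _ => simp_all [Comp.interact, Obeys]

theorem bind_congr_of_all {E : α → Prop} {c : Comp α} (hc : c.All E) {f g : α → Comp β}
    (h : ∀ a, E a → f a = g a) : c.bind f = c.bind g := by
  induction c <;> simp_all [-Bool.forall_bool, Comp.bind, All]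

/-- Two challengers that answer all messages in the same way, as far as these messages obey the
rules. -/
theorem Obeys.interact_congr {move : ρ → Val → ρ → Prop} {R : σ → Val → Comp (Val × σ)}
    {R' : σ' → Val → Comp (Val × σ')} {g : σ' → σ} {Inv : ρ → σ' → Prop}
    (h : ∀ s m s' t, move s m s' → Inv s t →
      R (g t) m = (R' t m).bind (fun x => ret (x.1, g x.2)) ∧ (R' t m).All fun x => Inv s' x.2)
    {c : Comp α} {s : ρ} (hc : c.Obeys move s) {t : σ'} (ht : Inv s t) :
    c.interact R (g t) = c.interact R' t := by
  induction c generalizing s t with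
  | ask m k ih =>
    obtain ⟨s', hs', hk⟩ := hc
    obtain ⟨h₁, h₂⟩ := h s m s' t hs' ht
    simp only [Comp.interact, h₁, Comp.bind_assoc, ret_bind]
    exact bind_congr_of_all h₂ fun x hx => ih _ (hk _) hx
  | ret a => rfl
  | tick d k ih => exact congrArg _ (ih hc ht)
  | coin k ih => exact congrArg _ (funext fun b => ih b (hc b) ht)
  | new k ih => exact congrArg _ (funext fun q => ih q (hc q) ht)
  | gate g k ih => exact congrArg _ (ih hc ht)
  | meas q k ih => exact congrArg _ (funext fun b => ih b (hc b) ht)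

end Comp

/-! ## Running times -/

namespace Prog

open CertDel.Comp

theorem bounded_seq {p q : Prog} {v : Val} {s t : ℕ} {E F : Val → Prop}
    (hp : (p.eval v).Bounded s E) (hq : ∀ a, E a → (q.eval a).Bounded t F) :
    ((seq p q).eval v).Bounded (1 + (s + t)) F :=
  (hp.bind hq).tick

theorem bounded_fork {p q : Prog} {v : Val} {s t : ℕ} {E F : Val → Prop}
    (hp : (p.eval v).Bounded s E) (hq : (q.eval v).Bounded t F) :
    ((fork p q).eval v).Bounded (1 + (s + t)) fun w => ∃ x y, w = .pair x y ∧ E x ∧ F y :=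
  (hp.bind fun x hx => hq.bind (t := 0) fun y hy =>
    Bounded.ret (E := fun w : Val => ∃ x y, w = .pair x y ∧ E x ∧ F y) ⟨x, y, rfl, hx, hy⟩).tick

theorem bounded_ite {c p q : Prog} {v : Val} {s t : ℕ} {E F : Val → Prop}
    (hc : (c.eval v).Bounded s E) (hp : (p.eval v).Bounded t F) (hq : (q.eval v).Bounded t F) :
    ((ite c p q).eval v).Bounded (1 + (s + t)) F :=
  (hc.bind fun b _ => show Bounded (if b.isTrue then p.eval v else q.eval v) t F by
    split_ifs <;> assumption).tick

theorem bounded_ask (v : Val) : (ask.eval v).Bounded (1 + v.size) fun _ => True :=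
  ⟨⟨le_rfl, fun _ => trivial⟩, fun _ => trivial⟩

/-- The computation is deterministic: within time `t`, it yields the result `a`. -/
def _root_.CertDel.Comp.Yields {α : Type} (c : Comp α) (t : ℕ) (a : α) : Prop :=
  c.TimeLE t ∧ c.strip = ret a

theorem _root_.CertDel.Comp.Yields.bounded {α : Type} {c : Comp α} {t : ℕ} {a : α}
    (h : c.Yields t a) : c.Bounded t (· = a) :=
  ⟨h.1, all_strip.1 (h.2 ▸ rfl)⟩

theorem _root_.CertDel.Comp.Yields.mono {α : Type} {c : Comp α} {s t : ℕ} {a : α}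
    (h : c.Yields s a) (hst : s ≤ t) : c.Yields t a :=
  ⟨h.1.mono hst, h.2⟩

theorem _root_.CertDel.Comp.Yields.bind {α β : Type} {c : Comp α} {f : α → Comp β} {s t : ℕ}
    {a : α} {b : β} (hc : c.Yields s a) (hf : (f a).Yields t b) : (c.bind f).Yields (s + t) b :=
  ⟨hc.1.bind hc.bounded.2 fun _ h => h ▸ hf.1, by rw [strip_bind, hc.2, ret_bind, hf.2]⟩

theorem _root_.CertDel.Comp.Yields.tick {α : Type} {c : Comp α} {t d : ℕ} {a : α}
    (h : c.Yields t a) : (Comp.tick d c).Yields (d + t) a :=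
  ⟨TimeLE.tick h.1 le_rfl, h.2⟩

theorem IsPure.yields {p : Prog} (hp : p.IsPure) (v : Val) :
    (p.eval v).Yields p.steps (p.out v) :=
  ⟨(hp.bounded v).1, hp.sem_eq v⟩

theorem yields_seq {p q : Prog} {v a b : Val} {s t : ℕ} (hp : (p.eval v).Yields s a)
    (hq : (q.eval a).Yields t b) : ((seq p q).eval v).Yields (1 + (s + t)) b :=
  (hp.bind hq).tick

theorem yields_fork {p q : Prog} {v a b : Val} {s t : ℕ} (hp : (p.eval v).Yields s a)
    (hq : (q.eval v).Yields t b) : ((fork p q).eval v).Yields (1 + (s + (t + 0))) (.pair a b) :=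
  (hp.bind (f := fun x => (q.eval v).bind fun y => ret (Val.pair x y))
    (hq.bind (f := fun y => ret (Val.pair a y)) (b := .pair a b) ⟨trivial, rfl⟩)).tick

@[simp] theorem _root_.CertDel.Val.isTrue_bit (b : Bool) : (Val.bit b).isTrue = b := rfl

/-! ### Copying a bounded prefix of a bit string -/

/-- Move one bit from the front of the first list to the front of the second list. -/
def shift : Prog :=
  ite (path [fst, isPair])
    (fork (path [fst, snd]) (fork (ite (path [fst, fst]) (bit true) (bit false)) snd)) id

/-- What `shift` computes. -/
def shifted : Val → Val
  | .pair (.pair b x) y => .pair x (.pair (.bit b.isTrue) y)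
  | v => v

theorem yields_shift (v : Val) : (shift.eval v).Yields 40 (shifted v) := by
  have key : ∀ b x y : Val, (shift.eval (.pair (.pair b x) y)).Yields 40
      (.pair x (.pair (.bit b.isTrue) y)) := by
    intro b x y
    cases h : b.isTrue <;>
      exact ⟨by simp [shift, path, eval, Comp.bind, TimeLE, h],
        by simp [shift, path, eval, Comp.bind, strip, h]⟩
  match v with
  | .pair (.pair b x) y => exact key b x y
  | .nil | .bit _ | .qubit _ | .pair .nil _ | .pair (.bit _) _ | .pair (.qubit _) _ =>
    exact ⟨by simp [shift, path, eval, Comp.bind, TimeLE, Val.fst],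
      by simp [shift, path, eval, Comp.bind, strip, Val.fst, shifted]⟩

/-- A step adds at most a pair node and a genuine bit: the entry that is moved is replaced by its
truth value, so even entries that are large trees cost two nodes. -/
theorem size_snd_iterate_shifted (N : ℕ) (v : Val) :
    ((shifted^[N] v).snd).size ≤ v.snd.size + 2 * N := by
  induction N generalizing v with
  | zero => rfl
  | succ N ih =>
    refine (ih (shifted v)).trans ?_
    have : (shifted v).snd.size ≤ v.snd.size + 2 := by
      unfold shifted
      split
      · simp [Val.size]
        omega
      · omega
    omega

/-- Shifting reverses the list, and the steps after its exhaustion do nothing; hence any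
sufficiently large number of steps works. -/
theorem iterate_shifted_str (k l : List Bool) (N : ℕ) (h : k.length ≤ N) :
    shifted^[N] (.pair (.str k) (.str l)) = .pair .nil (.str (k.reverse ++ l)) := by
  induction N generalizing k l with
  | zero =>
    rw [List.length_eq_zero_iff.1 (Nat.le_zero.1 h)]
    rfl
  | succ N ih =>
    cases k with
    | nil => exact ih [] l (by simp)
    | cons b k =>
      have hs : shifted (.pair (.str (b :: k)) (.str l)) = .pair (.str k) (.str (b :: l)) := rfl
      rw [Function.iterate_succ_apply, hs, ih k (b :: l) (by simpa using h)]
      simp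

/-- Iterate a program `Lᵈ` times on the second component of the input, where `L` is the length of
the first component. -/
def nest (p : Prog) : ℕ → Prog
  | 0 => fork fst (seq snd p)
  | d + 1 => seq (fork fst id) (loop (nest p d))

/-- Running time of `nest`. -/
noncomputable def nestTime (t : Polynomial ℕ) : ℕ → Polynomial ℕ
  | 0 => t + 5
  | d + 1 => Polynomial.X * nestTime t d + 10

/-- Nested loops over the same counter `u` multiply the numbers of iterations. The counter is
carried along with the data because a loop body sees nothing but its own input. -/
theorem yields_nest {p : Prog} {f : Val → Val} {t : ℕ} (hp : ∀ v, (p.eval v).Yields t (f v))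
    (u : Val) (d : ℕ) (x : Val) :
    ((nest p d).eval (.pair u x)).Yields ((nestTime (Polynomial.C t) d).eval u.len)
      (.pair u (f^[u.len ^ d] x)) := by
  revert x
  induction d with
  | zero =>
    intro x
    refine (yields_fork (IsPure.yields (p := fst) trivial _)
      (yields_seq (IsPure.yields (p := snd) trivial _) (hp x))).mono ?_
    simp [nestTime, steps]
    omega
  | succ d ih =>
    intro x
    have key : ∀ n x, (iterate (nest p d).eval n (.pair u x)).Yields
        (n * (nestTime (Polynomial.C t) d).eval u.len) (.pair u (f^[n * u.len ^ d] x)) := by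
      intro n
      induction n with
      | zero => exact fun x => ⟨trivial, by simp [iterate, strip]⟩
      | succ n ihn =>
        intro x
        have h := ((ih x).bind (ihn _)).mono
          (t := (n + 1) * (nestTime (Polynomial.C t) d).eval u.len) (by rw [add_mul]; omega)
        rwa [← Function.iterate_add_apply, ← Nat.succ_mul] at h
    have h := key u.len x
    rw [← pow_succ'] at h
    have h₁ : ((fork fst id).eval (.pair u x)).Yields 3 (.pair u (.pair u x)) :=
      IsPure.yields (p := fork fst id) ⟨trivial, trivial⟩ _
    have h₂ : ((loop (nest p d)).eval (.pair u (.pair u x))).Yields _ _ := h.tick (d := 1)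
    refine (yields_seq h₁ h₂).mono ?_
    simp [nestTime]
    omega

/-- Nested loops over one list produce powers of its length, so the polynomial bound is replaced by
a power of a padded length. -/
theorem exists_le_pow (t : Polynomial ℕ) : ∃ C : ℕ, ∀ n : ℕ, t.eval n ≤ (n + C) ^ C := by
  induction t using Polynomial.induction_on' with
  | add p q hp hq =>
    obtain ⟨a, ha⟩ := hp
    obtain ⟨b, hb⟩ := hq
    -- Both summands are bounded with exponent `a + b + 1`; the last factor, which is at least `2`,
    -- pays for adding them.
    refine ⟨a + b + 2, fun n => ?_⟩
    have h1 : (n + a) ^ a ≤ (n + (a + b + 2)) ^ (a + b + 1) :=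
      (Nat.pow_le_pow_left (by omega) a).trans (Nat.pow_le_pow_right (by omega) (by omega))
    have h2 : (n + b) ^ b ≤ (n + (a + b + 2)) ^ (a + b + 1) :=
      (Nat.pow_le_pow_left (by omega) b).trans (Nat.pow_le_pow_right (by omega) (by omega))
    have h3 : 2 * (n + (a + b + 2)) ^ (a + b + 1) ≤ (n + (a + b + 2)) ^ (a + b + 2) := by
      rw [pow_succ (n + (a + b + 2)) (a + b + 1), mul_comm]
      exact Nat.mul_le_mul_left _ (by omega)
    have := ha n
    have := hb n
    rw [Polynomial.eval_add]
    omega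
  | monomial d a =>
    refine ⟨d + a + 1, fun n => ?_⟩
    rw [Polynomial.eval_monomial]
    calc a * n ^ d ≤ (n + (d + a + 1)) * (n + (d + a + 1)) ^ d :=
          Nat.mul_le_mul (by omega) (Nat.pow_le_pow_left (by omega) d)
      _ = (n + (d + a + 1)) ^ (d + 1) := by rw [pow_succ, mul_comm]
      _ ≤ (n + (d + a + 1)) ^ (d + a + 1) := Nat.pow_le_pow_right (by omega) (by omega)

/-- Prepend `C` elements to a list. -/
def pad : ℕ → Prog
  | 0 => id
  | C + 1 => seq (pad C) (fork (bit true) id)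

theorem isPure_pad (C : ℕ) : (pad C).IsPure := by
  induction C with
  | zero => trivial
  | succ C ih => exact ⟨ih, trivial, trivial⟩

theorem len_out_pad (C : ℕ) (v : Val) : ((pad C).out v).len = v.len + C := by
  induction C with
  | zero => rfl
  | succ C ih =>
    simp only [pad, out, Val.len, ih]
    omega

/-- On input `(1ⁿ, l)`, copy at most `(n + C) ^ C` bits of `l`. -/
def copy (C : ℕ) : Prog :=
  seq (fork (seq fst (pad C)) (fork snd nil)) (seq (nest shift C)
    (seq (fork fst (fork (path [snd, snd]) nil)) (seq (nest shift C) (path [snd, snd]))))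

theorem _root_.CertDel.Val.len_unary (n : ℕ) : (Val.unary n).len = n := by
  induction n with
  | zero => rfl
  | succ n ih =>
    have : Val.unary (n + 1) = .pair (.bit true) (.unary n) := rfl
    rw [this, Val.len, ih]

theorem _root_.CertDel.Val.size_str (l : List Bool) : (Val.str l).size = 2 * l.length + 1 := by
  induction l with
  | nil => rfl
  | cons b l ih =>
    simp [Val.str, Val.size, ih]
    omega

theorem _root_.CertDel.Val.size_unary (n : ℕ) : (Val.unary n).size = 2 * n + 1 := by
  rw [Val.unary, Val.size_str, List.length_replicate]

theorem yields_copy (C n : ℕ) (l : Val) :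
    ((copy C).eval (.pair (.unary n) l)).Yields
      ((pad C).steps + 100 + 2 * (nestTime (Polynomial.C 40) C).eval (n + C))
      (shifted^[(n + C) ^ C] (.pair (shifted^[(n + C) ^ C] (.pair l .nil)).snd .nil)).snd := by
  set u := (pad C).out (.unary n) with hu
  have hlen : u.len = n + C := by rw [hu, len_out_pad, Val.len_unary]
  have hnest := yields_nest yields_shift u C
  simp only [hlen] at hnest
  set x := (shifted^[(n + C) ^ C] (.pair l .nil)) with hx
  set y := (shifted^[(n + C) ^ C] (.pair x.snd .nil)) with hy
  have h₁ : ((fork (seq fst (pad C)) (fork snd nil)).eval (.pair (.unary n) l)).Yields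
      ((pad C).steps + 6) (.pair u (.pair l .nil)) :=
    (IsPure.yields (p := fork (seq fst (pad C)) (fork snd nil))
      ⟨⟨trivial, isPure_pad C⟩, trivial, trivial⟩ _).mono (by simp only [steps]; omega)
  have h₂ : ((fork fst (fork (path [snd, snd]) nil)).eval (.pair u x)).Yields 10
      (.pair u (.pair x.snd .nil)) :=
    (IsPure.yields (p := fork fst (fork (path [snd, snd]) nil)) (by simp [IsPure, path]) _).mono
      (by simp [steps, path])
  have h₃ : ((path [snd, snd]).eval (.pair u y)).Yields 6 y.snd :=
    (IsPure.yields (p := path [snd, snd]) (by simp [IsPure, path]) _).mono (by simp [steps, path])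
  refine (yields_seq h₁ (yields_seq (hnest _) (yields_seq h₂
    (yields_seq (hnest _) h₃)))).mono ?_
  omega

theorem isClosed_copy (C : ℕ) : (copy C).IsClosed := by
  have h : ∀ d, (nest shift d).IsClosed := fun d => by
    induction d <;> simp_all [nest, shift, path, IsClosed]
  simp [copy, path, IsClosed, h, (isPure_pad C).isClosed]

/-- `copy` leaves short bit strings unchanged, and its running time and the size of its output are
polynomially bounded whatever its input. -/
theorem exists_copy (t : Polynomial ℕ) : ∃ p : Prog,
    p.IsClosed ∧
    (∃ T : Polynomial ℕ, ∀ n l,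
      (p.eval (.pair (.unary n) l)).Bounded (T.eval n) fun w => w.size ≤ T.eval n) ∧
    ∀ n k, k.length ≤ t.eval n → p.sem (.pair (.unary n) (.str k)) = ret (.str k) := by
  obtain ⟨C, hC⟩ := exists_le_pow t
  have hX : ∀ n : ℕ, (Polynomial.X + Polynomial.C C : Polynomial ℕ).eval n = n + C := by simp
  refine ⟨copy C, isClosed_copy C, ⟨Polynomial.C ((pad C).steps + 100)
    + 2 * (nestTime (Polynomial.C 40) C).comp (Polynomial.X + Polynomial.C C)
    + 2 * (Polynomial.X + Polynomial.C C) ^ C, fun n l => ?_⟩, fun n k hk => ?_⟩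
  · refine (yields_copy C n l).bounded.mono ?_ fun w hw => ?_
    · simp [Polynomial.eval_comp]
    · have := size_snd_iterate_shifted ((n + C) ^ C)
        (.pair (shifted^[(n + C) ^ C] (.pair l .nil)).snd .nil)
      rw [hw]
      refine this.trans ?_
      simp [Polynomial.eval_comp, Val.size]
      omega
  · refine (yields_copy C n (.str k)).2.trans ?_
    have hk' := hk.trans (hC n)
    have h1 := iterate_shifted_str k [] _ hk'
    -- The second pass undoes the reversal of the first.
    have h2 := iterate_shifted_str k.reverse [] _ (by simpa using hk')
    simp only [List.append_nil, List.reverse_reverse, Val.str] at h1 h2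
    rw [h1, Val.snd_pair, h2, Val.snd_pair]

end Prog

/-! ## The reductions -/

open CertDel.Comp

namespace Prog

/-- Run `A` on the output of `q`, with all messages answered by `h`, starting in the state that is
the output of `p`. -/
def reduction (p q h A : Prog) : Prog := seq (fork p q) (seq (sim h A) snd)

theorem sem_reduction {α : Type} {p q : Prog} (hp : p.IsPure) (hq : q.IsPure) (h A : Prog) (v : Val)
    (K : Val → α) :
    ((reduction p q h A).sem v).bind (fun w => ret (K w))
      = ((A.sem (q.out v)).bind fun w => ret (K w)).interact h.respond (p.out v) := by
  simp only [reduction, sem_seq, sem_fork, hp.sem_eq, hq.sem_eq, ret_bind, Comp.bind_assoc]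
  exact sem_sim h A _ _ fun w st' => rfl

theorem timeLE_reduction {p q h A : Prog} (hp : p.IsPure) (hq : q.IsPure) {Inv : Val → Prop}
    {H T : ℕ} (hh : ∀ st m, Inv st → m.size ≤ T → (h.eval (.pair st m)).Bounded H fun w => Inv w.fst)
    {v : Val} (hv : Inv (p.out v)) (hA : (A.eval (q.out v)).TimeLE T) :
    ((reduction p q h A).eval v).TimeLE ((H + 80) * T + p.steps + q.steps + 10) := by
  have h1 : ((fork p q).eval v).Bounded (p.steps + q.steps + 1) (· = .pair (p.out v) (q.out v)) :=
    (IsPure.bounded (p := fork p q) ⟨hp, hq⟩ v)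
  have h2 : (((sim h A).eval (.pair (p.out v) (q.out v))).bind snd.eval).TimeLE
      ((H + 80) * T + 1) := by
    refine timeLE_sim hh le_rfl A (k := ret) le_rfl hv ?_ (by rwa [bind_ret])
    intro w st' T' _ _ _
    exact ⟨by omega, trivial⟩
  refine TimeLE.tick (s := (p.steps + q.steps + 1) + ((H + 80) * T + 2)) ?_ (by omega)
  refine h1.1.bind h1.2 ?_
  rintro _ rfl
  exact TimeLE.tick h2 (by omega)

/-- The left component if `b` is false, the right one if `b` is true. -/
def sel (b : Bool) : Prog := if b then snd else fst

theorem isPure_sel (b : Bool) : (sel b).IsPure := by cases b <;> trivial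

@[simp] theorem sem_sel (b : Bool) (v : Val) : (sel b).sem v = ret (if b then v.snd else v.fst) := by
  cases b <;> rfl

theorem out_sel (b : Bool) (v : Val) : (sel b).out v = if b then v.snd else v.fst := by
  cases b <;> rfl

theorem steps_sel (b : Bool) : (sel b).steps = 1 := by
  cases b <;> rfl

theorem bounded_isNil (v : Val) : (isNil.eval v).Bounded 1 fun _ => True := by
  cases v <;> exact ⟨⟨le_rfl, trivial⟩, trivial⟩

/-- Answers to the messages of an IND-CPA-CD adversary, as long as a challenger for the
non-committing scheme answers key queries and encrypts keys of the one-time scheme. The state is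
`(1ⁿ, nil)` and later `(1ⁿ, (sk, msk))`. -/
def nceHandler (ske : SKECD) (b : Bool) : Prog :=
  ite (seq (path [snd, fst]) isNil)
    (fork fst (seq snd ask))
    (ite (path [snd, fst])
      (fork fst
        (ite (seq (tuple [path [fst, fst], path [fst, snd, fst], path [snd, snd]]) ske.vrfy)
          (fork (bit true) (path [fst, snd, snd]))
          (fork (bit false) nil)))
      -- the intermediate results are put in front of the input, one after the other
      (seq (fork (seq (path [fst, fst]) ske.gen) id)
        (seq (fork (seq (fork (bit false) (fork (path [snd, snd, snd, fst]) fst)) ask) id)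
          (seq (fork (seq (tuple [path [snd, snd, fst, fst], path [snd, fst],
              path [snd, snd, snd, snd, snd, sel b]]) ske.enc) id)
            (fork
              (fork (path [snd, snd, snd, fst, fst])
                (fork (path [snd, snd, fst]) (path [snd, fst, snd])))
              (fork (path [snd, fst, fst]) fst))))))

/-- Answers to the messages of an IND-CPA-CD adversary, as long as a challenger for the
one-time scheme encrypts messages and verifies certificates. The state is
`(1ⁿ, ((pk, aux), ct))`. The program `copy` is used to cut down the length of the revealed key. -/
def skeHandler (nce : NCABE) (copy : Prog) : Prog :=
  ite (seq (path [snd, fst]) isNil)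
    (fork fst (seq (tuple [path [fst, fst], path [fst, snd, fst, fst], path [fst, snd, fst, snd],
      path [snd, snd]]) nce.fakeSK))
    (ite (path [snd, fst])
      (seq (fork (seq snd ask) id)
        (fork (path [snd, fst])
          (ite (path [fst, fst])
            (fork (bit true) (seq (tuple [path [snd, fst, fst], path [snd, fst, snd, fst, fst],
              path [snd, fst, snd, fst, snd], path [snd, fst, snd, snd],
              seq (fork (path [snd, fst, fst]) (path [fst, snd])) copy]) nce.reveal))
            (fork (bit false) nil))))
      (seq (fork (seq (tuple [path [fst, fst], path [fst, snd, fst, fst], path [fst, snd, fst, snd],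
          path [snd, snd, fst]]) nce.fakeCT) id)
        (seq (fork (seq (fork (bit false) (path [snd, snd, snd, snd])) ask) id)
          (fork
            (fork (path [snd, snd, fst, fst]) (fork (path [snd, snd, fst, snd, fst]) (path [snd, fst])))
            (fork (path [snd, fst]) fst)))))

/-! ### Semantics of the two handlers -/

section Sem

variable (ske : SKECD) (nce : NCABE) (b : Bool) (copy : Prog) (u y P X m₀ m₁ c sk msk pk aux ct : Val)

theorem nceHandler_keyQuery :
    (nceHandler ske b).respond (.pair u y) (.keyQuery P)
      = Comp.ask (.keyQuery P) fun r => ret (r, .pair u y) := by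
  simp [respond, nceHandler, path, Val.keyQuery, Comp.bind]

theorem nceHandler_challenge :
    (nceHandler ske b).respond (.pair u y) (.challenge (.tuple [X, m₀, m₁]))
      = (ske.gen.sem u).bind fun sk => Comp.ask (.challenge (.tuple [X, sk])) fun r =>
        (ske.enc.sem (.tuple [u, sk, if b then m₁ else m₀])).bind fun d =>
          ret (.pair r.fst d, .pair u (.pair sk r.snd)) := by
  simp [respond, nceHandler, path, Val.challenge, Val.tuple, Prog.tuple, Comp.bind]

theorem nceHandler_certificate :
    (nceHandler ske b).respond (.pair u y) (.certificate c)
      = (ske.vrfy.sem (.tuple [u, y.fst, c])).bind fun v =>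
        ret (if v.isTrue then .some y.snd else .bot, .pair u y) := by
  simp only [respond, nceHandler, path, Val.certificate, Val.tuple, Prog.tuple, sem_ite, sem_seq,
    sem_fork, sem_fst, sem_snd, sem_id, ret_bind, Val.fst_pair, Val.snd_pair, Comp.bind_assoc,
    sem_isNil_bit, Val.isTrue_bit, if_true, sem_bit, sem_nil, Bool.false_eq_true, if_false]
  congr 1
  funext v
  split_ifs <;> rfl

theorem skeHandler_keyQuery :
    (skeHandler nce copy).respond (.pair u (.pair (.pair pk aux) ct)) (.keyQuery P)
      = (nce.fakeSK.sem (.tuple [u, pk, aux, P])).bind fun r =>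
        ret (r, .pair u (.pair (.pair pk aux) ct)) := by
  simp [respond, skeHandler, path, Val.keyQuery, Val.tuple, Prog.tuple]

theorem skeHandler_challenge :
    (skeHandler nce copy).respond (.pair u (.pair (.pair pk aux) ct))
        (.challenge (.tuple [X, m₀, m₁]))
      = (nce.fakeCT.sem (.tuple [u, pk, aux, X])).bind fun c =>
        Comp.ask (.challenge (.tuple [m₀, m₁])) fun d =>
          ret (.pair c d, .pair u (.pair (.pair pk aux) c)) := by
  simp [respond, skeHandler, path, Val.challenge, Val.tuple, Prog.tuple, Comp.bind]

theorem skeHandler_certificate :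
    (skeHandler nce copy).respond (.pair u (.pair (.pair pk aux) ct)) (.certificate c)
      = Comp.ask (.certificate c) fun r =>
        if r.fst.isTrue then (copy.sem (.pair u r.snd)).bind fun sk =>
          (nce.reveal.sem (.tuple [u, pk, aux, ct, sk])).bind fun msk =>
            ret (.some msk, .pair u (.pair (.pair pk aux) ct))
        else ret (.bot, .pair u (.pair (.pair pk aux) ct)) := by
  simp only [respond, skeHandler, path, Val.certificate, Val.tuple, Prog.tuple, sem_ite, sem_seq,
    sem_fork, sem_fst, sem_snd, sem_id, ret_bind, Val.fst_pair, Val.snd_pair, Comp.bind_assoc,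
    sem_isNil_bit, Val.isTrue_bit, if_true, sem_bit, sem_nil, Bool.false_eq_true, if_false, sem_ask,
    Comp.bind]
  congr 1
  funext r
  split_ifs <;> simp [Val.some, Val.bot]

end Sem

/-- The bound must hold whatever the challenger replies, so the invariant covers only the
self-generated key. The master key and the ciphertext received may be huge, but they are only shared
in pairs, never sent and never given to an algorithm. Inputs of `enc` and `vrfy` are triples of
parts of size at most `B`, hence `3 * B + 2`; the numerical constants are slack. -/
theorem bounded_nceHandler {ske : SKECD} {b : Bool} {tg te tv : Polynomial ℕ}
    (hg : ske.gen.TimeBound tg) (he : ske.enc.TimeBound te) (hv : ske.vrfy.TimeBound tv)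
    {n B : ℕ} (hn : 2 * n + 1 ≤ B) (hB : tg.eval (2 * n + 1) ≤ B) {st m : Val}
    (hu : st.fst = .unary n) (hs : st.snd.fst.size ≤ B) (hm : m.size ≤ B) :
    ((nceHandler ske b).eval (.pair st m)).Bounded
      (200 + 3 * B + tg.eval (2 * n + 1) + te.eval (3 * B + 2) + tv.eval (3 * B + 2))
      fun w => w.fst.fst = .unary n ∧ w.fst.snd.fst.size ≤ B := by
  have hus : (Val.unary n).size ≤ 2 * n + 1 := (Val.size_unary n).le
  have hm1 := m.size_fst_le
  have hm2 := m.size_snd_le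
  have hm3 := m.snd.size_fst_le
  have hm4 := m.snd.size_snd_le
  have pure {p : Prog} (hp : p.IsPure) {v w : Val} {k : ℕ} (hw : p.out v = w) (hk : p.steps ≤ k) :
      (p.eval v).Bounded k (· = w) := (hp.bounded v).mono hk fun a ha => ha.trans hw
  refine (bounded_ite (s := 10) (bounded_seq (pure (w := m.fst) (k := 8) (by simp [IsPure, path]) (by simp [out, path])
    (by simp [steps, path])) fun _ _ => bounded_isNil _)
    (t := 180 + 3 * B + tg.eval (2 * n + 1) + te.eval (3 * B + 2) + tv.eval (3 * B + 2))
    ?_ ?_).mono (by omega) fun _ => _root_.id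
  · refine (bounded_fork (pure (p := fst) (w := st) (k := 1) trivial rfl le_rfl) (bounded_seq (t := 1 + m.size)
      (pure (p := snd) (w := m) (k := 1) trivial rfl le_rfl) ?_ (F := fun _ => True))).mono (by omega) ?_
    · rintro _ rfl
      exact bounded_ask _
    · rintro _ ⟨_, _, rfl, rfl, -⟩
      exact ⟨hu, hs⟩
  refine (bounded_ite (s := 10) (pure (w := m.fst) (by simp [IsPure, path]) (by simp [out, path])
    (by simp [steps, path]))
    (t := 160 + 3 * B + tg.eval (2 * n + 1) + te.eval (3 * B + 2) + tv.eval (3 * B + 2))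
    ?_ ?_).mono (by omega) fun _ => _root_.id
  · refine (bounded_fork (pure (p := fst) (w := st) (k := 1) trivial rfl le_rfl)
      (bounded_ite (E := fun _ => True) (F := fun _ => True) (t := 30) (bounded_seq
        (pure (w := .tuple [st.fst, st.snd.fst, m.snd]) (k := 40)
        (by simp [IsPure, path, Prog.tuple]) (by simp [out, path, Prog.tuple, Val.tuple])
        (by simp [steps, path, Prog.tuple])) (t := tv.eval (3 * B + 2)) ?_)
      ?_ ?_)).mono ?_ ?_
    · rintro _ rfl
      refine (hv _ _ ?_).mono le_rfl fun _ _ => trivial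
      simp only [Val.tuple, Val.size, hu]
      omega
    · exact ((IsPure.bounded (by simp [IsPure, path]) _).mono (by simp [steps, path])
        fun _ _ => trivial)
    · exact ((IsPure.bounded (by simp [IsPure]) _).mono (by simp [steps])
        fun _ _ => trivial)
    · omega
    · rintro _ ⟨_, _, rfl, rfl, -⟩
      exact ⟨hu, hs⟩
  · refine (bounded_seq (bounded_fork (E := fun sk => sk.size ≤ tg.eval (2 * n + 1))
      (bounded_seq (t := tg.eval (2 * n + 1))
        (pure (w := .unary n) (k := 10) (by simp [IsPure, path]) (by simp [out, path, hu])
          (by simp [steps, path])) ?_)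
      (pure (p := id) (w := .pair st m) (k := 1) trivial rfl le_rfl))
      (t := 140 + 3 * B + te.eval (3 * B + 2)) ?_).mono (by omega) fun _ => _root_.id
    · rintro _ rfl
      exact hg _ _ hus
    rintro _ ⟨sk, _, rfl, hsk, rfl⟩
    refine (bounded_seq (bounded_fork (E := fun _ => True)
      (bounded_seq (t := 6 + 2 * B)
        (pure (w := .challenge (.tuple [m.snd.fst, sk])) (k := 20) (by simp [IsPure, path])
          (by simp [out, path, Val.challenge, Val.tuple]) (by simp [steps, path])) ?_)
      (pure (p := id) (w := .pair sk (.pair st m)) (k := 1) trivial rfl le_rfl))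
      (t := 110 + B + te.eval (3 * B + 2)) ?_).mono (by omega) fun _ => _root_.id
    · rintro _ rfl
      refine (bounded_ask _).mono ?_ fun _ => _root_.id
      simp only [Val.challenge, Val.tuple, Val.size]
      omega
    rintro _ ⟨r, _, rfl, -, rfl⟩
    refine (bounded_seq (bounded_fork (E := fun _ => True)
      (bounded_seq (t := te.eval (3 * B + 2))
        (pure (w := .tuple [.unary n, sk, if b then m.snd.snd.snd else m.snd.snd.fst]) (k := 50)
          (by simp [IsPure, path, Prog.tuple, isPure_sel])
          (by simp [out, path, Prog.tuple, Val.tuple, out_sel, hu])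
          (by simp [steps, path, Prog.tuple, steps_sel])) ?_)
      (pure (p := id) (w := .pair r (.pair sk (.pair st m))) (k := 1) trivial rfl le_rfl))
      (t := 50) ?_).mono (by omega) fun _ => _root_.id
    · rintro _ rfl
      refine (he _ _ ?_).mono le_rfl fun _ _ => trivial
      have h1 := m.snd.snd.size_fst_le
      have h2 := m.snd.snd.size_snd_le
      have h3 : (if b then m.snd.snd.snd else m.snd.snd.fst).size ≤ B := by
        split_ifs <;> omega
      simp only [Val.tuple, Val.size]
      omega
    rintro _ ⟨d, _, rfl, -, rfl⟩
    refine (IsPure.bounded (by simp [IsPure, path]) _).mono (by simp [steps, path]) ?_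
    rintro _ rfl
    simp only [out, path, Val.fst_pair, Val.snd_pair]
    exact ⟨hu, hsk.trans hB⟩

/-- Here `B` bounds messages, `1ⁿ` and the fake keys, `S` the fake ciphertext and `T` the truncated
key. The input of `reveal` is made of `1ⁿ`, `pk`, `aux`, ciphertext and key, which with four pair
nodes gives `3 * B + S + T + 4`. The released key reaches `reveal` only through `copy`, so its
original size is irrelevant. -/
theorem bounded_skeHandler {nce : NCABE} {copy : Prog} {ts tc tr : Polynomial ℕ}
    (hs : nce.fakeSK.TimeBound ts) (hc : nce.fakeCT.TimeBound tc) (hr : nce.reveal.TimeBound tr)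
    {n B S T : ℕ}
    (hcopy : ∀ l, (copy.eval (.pair (.unary n) l)).Bounded T fun w => w.size ≤ T)
    (hn : 2 * n + 1 ≤ B) (hS : tc.eval (4 * B + 3) ≤ S) {st m : Val} (hu : st.fst = .unary n)
    (hk : st.snd.fst.size ≤ B) (hct : st.snd.snd.size ≤ S) (hm : m.size ≤ B) :
    ((skeHandler nce copy).eval (.pair st m)).Bounded
      (300 + 3 * B + ts.eval (4 * B + 3) + tc.eval (4 * B + 3) + T
        + tr.eval (3 * B + S + T + 4))
      fun w => w.fst.fst = .unary n ∧ w.fst.snd.fst.size ≤ B ∧ w.fst.snd.snd.size ≤ S := by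
  have hus : (Val.unary n).size ≤ 2 * n + 1 := (Val.size_unary n).le
  have hm1 := m.size_fst_le
  have hm2 := m.size_snd_le
  have hm3 := m.snd.size_fst_le
  have hm4 := m.snd.size_snd_le
  have hk1 := st.snd.fst.size_fst_le
  have hk2 := st.snd.fst.size_snd_le
  have pure {p : Prog} (hp : p.IsPure) {v w : Val} {k : ℕ} (hw : p.out v = w) (hk : p.steps ≤ k) :
      (p.eval v).Bounded k (· = w) := (hp.bounded v).mono hk fun a ha => ha.trans hw
  refine (bounded_ite (s := 10) (bounded_seq (pure (w := m.fst) (k := 8) (by simp [IsPure, path])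
    (by simp [out, path]) (by simp [steps, path])) fun _ _ => bounded_isNil _)
    (t := 280 + 3 * B + ts.eval (4 * B + 3) + tc.eval (4 * B + 3) + T
        + tr.eval (3 * B + S + T + 4))
    ?_ ?_).mono (by omega) fun _ => _root_.id
  · refine (bounded_fork (pure (p := fst) (w := st) (k := 1) trivial rfl le_rfl)
      (bounded_seq (t := ts.eval (4 * B + 3))
        (pure (w := .tuple [.unary n, st.snd.fst.fst, st.snd.fst.snd, m.snd]) (k := 50)
        (by simp [IsPure, path, Prog.tuple]) (by simp [out, path, Prog.tuple, Val.tuple, hu])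
        (by simp [steps, path, Prog.tuple])) ?_ (F := fun _ => True))).mono (by omega) ?_
    · rintro _ rfl
      refine (hs _ _ ?_).mono le_rfl fun _ _ => trivial
      simp only [Val.tuple, Val.size]
      omega
    · rintro _ ⟨_, _, rfl, rfl, -⟩
      exact ⟨hu, hk, hct⟩
  refine (bounded_ite (s := 10) (pure (w := m.fst) (by simp [IsPure, path]) (by simp [out, path])
    (by simp [steps, path]))
    (t := 260 + 3 * B + tc.eval (4 * B + 3) + T + tr.eval (3 * B + S + T + 4))
    ?_ ?_).mono (by omega) fun _ => _root_.id
  · refine (bounded_seq (bounded_fork (E := fun _ => True)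
      (bounded_seq (t := 1 + B)
        (pure (p := snd) (w := m) (k := 1) trivial rfl le_rfl) ?_)
      (pure (p := id) (w := .pair st m) (k := 1) trivial rfl le_rfl))
      (t := 240 + T + tr.eval (3 * B + S + T + 4)) ?_).mono (by omega) fun _ => _root_.id
    · rintro _ rfl
      exact (bounded_ask _).mono (by omega) fun _ => _root_.id
    rintro _ ⟨r, _, rfl, -, rfl⟩
    refine (bounded_fork (F := fun _ => True) (t := 220 + T + tr.eval (3 * B + S + T + 4))
      (pure (w := st) (k := 8) (by simp [IsPure, path]) (by simp [out, path])
        (by simp [steps, path])) ?_).mono (by omega) ?_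
    · refine (bounded_ite (s := 10) (t := 200 + T + tr.eval (3 * B + S + T + 4))
        (pure (w := r.fst) (by simp [IsPure, path])
        (by simp [out, path]) (by simp [steps, path])) ?_ ?_).mono (by omega) fun _ => _root_.id
      · have inner : ((seq (fork (path [snd, fst, fst]) (path [fst, snd])) copy).eval
            (.pair r (.pair st m))).Bounded (30 + T) fun w => w.size ≤ T := by
          refine (bounded_seq (pure (w := .pair (.unary n) r.snd) (k := 20)
            (by simp [IsPure, path]) (by simp [out, path, hu]) (by simp [steps, path]))
            (t := T) ?_).mono (by omega) fun _ => _root_.id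
          rintro _ rfl
          exact hcopy _
        have p₁ := pure (p := path [snd, fst, fst]) (v := .pair r (.pair st m)) (w := .unary n)
          (k := 20) (by simp [IsPure, path]) (by simp [out, path, hu]) (by simp [steps, path])
        have p₂ := pure (p := path [snd, fst, snd, fst, fst]) (v := .pair r (.pair st m))
          (w := st.snd.fst.fst) (k := 20) (by simp [IsPure, path]) (by simp [out, path])
          (by simp [steps, path])
        have p₃ := pure (p := path [snd, fst, snd, fst, snd]) (v := .pair r (.pair st m))
          (w := st.snd.fst.snd) (k := 20) (by simp [IsPure, path]) (by simp [out, path])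
          (by simp [steps, path])
        have p₄ := pure (p := path [snd, fst, snd, snd]) (v := .pair r (.pair st m))
          (w := st.snd.snd) (k := 20) (by simp [IsPure, path]) (by simp [out, path])
          (by simp [steps, path])
        refine (bounded_fork (F := fun _ => True) (pure (p := bit true) (w := .bit true) (k := 1)
          trivial rfl le_rfl) (bounded_seq (t := tr.eval (3 * B + S + T + 4))
          (bounded_fork p₁ (bounded_fork p₂ (bounded_fork p₃ (bounded_fork p₄ inner))))
          ?_)).mono (by omega) fun _ _ => trivial
        rintro _ ⟨_, _, rfl, rfl, _, _, rfl, rfl, _, _, rfl, rfl, _, _, rfl, rfl, hsk⟩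
        refine (hr _ _ ?_).mono le_rfl fun _ _ => trivial
        simp only [Val.size]
        omega
      · exact ((IsPure.bounded (by simp [IsPure]) _).mono (by simp [steps]; omega)
          fun _ _ => trivial)
    · rintro _ ⟨_, _, rfl, rfl, -⟩
      exact ⟨hu, hk, hct⟩
  · refine (bounded_seq (bounded_fork (E := fun c => c.size ≤ tc.eval (4 * B + 3))
      (bounded_seq (t := tc.eval (4 * B + 3))
        (pure (w := .tuple [.unary n, st.snd.fst.fst, st.snd.fst.snd, m.snd.fst]) (k := 60)
          (by simp [IsPure, path, Prog.tuple]) (by simp [out, path, Prog.tuple, Val.tuple, hu])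
          (by simp [steps, path, Prog.tuple])) ?_)
      (pure (p := id) (w := .pair st m) (k := 1) trivial rfl le_rfl))
      (t := 180 + 3 * B) ?_).mono (by omega) fun _ => _root_.id
    · rintro _ rfl
      refine hc _ _ ?_
      simp only [Val.tuple, Val.size]
      omega
    rintro _ ⟨c, _, rfl, hc', rfl⟩
    refine (bounded_seq (bounded_fork (E := fun _ => True)
      (bounded_seq (t := 6 + 2 * B)
        (pure (w := .challenge m.snd.snd) (k := 20) (by simp [IsPure, path])
          (by simp [out, path, Val.challenge]) (by simp [steps, path])) ?_)
      (pure (p := id) (w := .pair c (.pair st m)) (k := 1) trivial rfl le_rfl))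
      (t := 120) ?_).mono (by omega) fun _ => _root_.id
    · rintro _ rfl
      refine (bounded_ask _).mono ?_ fun _ => _root_.id
      simp only [Val.challenge, Val.size]
      omega
    rintro _ ⟨r, _, rfl, -, rfl⟩
    refine (IsPure.bounded (by simp [IsPure, path]) _).mono (by simp [steps, path]) ?_
    rintro _ rfl
    simp only [out, path, Val.fst_pair, Val.snd_pair]
    exact ⟨hu, hk, hc'.trans hS⟩

end Prog

/-! ## The adversaries -/

open CertDel.Comp Prog

/-- The adversary against the non-committing scheme. -/
def nceAdversary (ske : SKECD) (b : Bool) (A : Prog) : Prog :=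
  reduction (fork fst nil) id (nceHandler ske b) A

/-- The adversary against the one-time scheme. -/
def skeAdversary (nce : NCABE) (copy A : Prog) : Prog :=
  seq (fork (seq fst nce.fakeSetup) id)
    (reduction
      (fork (path [snd, fst]) (fork (fork (path [fst, fst]) (path [fst, snd])) nil))
      (fork (path [snd, fst]) (path [fst, fst])) (skeHandler nce copy) A)

variable {V : PolicySystem} {M : Space} {ℓ : ℕ → ℕ} {nce : NCABE} {ske : SKECD} {A copy : Prog}
  {b : Bool} {n : ℕ}

theorem sem_nceAdversary {α : Type} (ske : SKECD) (b : Bool) (A : Prog) (u x : Val) (K : Val → α) :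
    ((nceAdversary ske b A).sem (.pair u x)).bind (fun w => ret (K w))
      = ((A.sem (.pair u x)).bind fun w => ret (K w)).interact (nceHandler ske b).respond
        (.pair u .nil) :=
  sem_reduction (p := fork fst nil) (q := id) ⟨trivial, trivial⟩ trivial _ _ _ K

theorem sem_skeAdversary {α : Type} (nce : NCABE) (copy A : Prog) (u x : Val) (K : Val → α) :
    ((skeAdversary nce copy A).sem (.pair u x)).bind (fun w => ret (K w))
      = (nce.fakeSetup.sem u).bind fun k =>
        ((A.sem (.pair u k.fst)).bind fun w => ret (K w)).interact (skeHandler nce copy).respond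
        (.pair u (.pair (.pair k.fst k.snd) .nil)) := by
  simp only [skeAdversary, sem_seq, sem_fork, sem_id, sem_fst, ret_bind, Comp.bind_assoc,
    Val.fst_pair]
  congr 1
  funext k
  refine (sem_reduction (by simp [IsPure, path]) (by simp [IsPure, path]) _ _ _ K).trans ?_
  simp [out, path]

theorem qptAdversary_nceAdversary (hske : ske.WellFormed (bitStrings ℓ)) (hA : A.QPTAdversary)
    (b : Bool) : (nceAdversary ske b A).QPTAdversary := by
  obtain ⟨tA, hA⟩ := hA
  obtain ⟨tg, hg⟩ := hske.gen.2.exists_timeBound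
  obtain ⟨te, he⟩ := hske.enc.2.exists_timeBound
  obtain ⟨tv, hv⟩ := hske.vrfy.2.exists_timeBound
  let s : Polynomial ℕ := 2 * Polynomial.X + 1
  -- The summands bound the messages of `A`, the size of `1ⁿ` and the key output by `ske.gen`.
  let B : Polynomial ℕ := tA + s + tg.comp s
  refine ⟨(280 + 3 * B + tg.comp s + te.comp (3 * B + 2) + tv.comp (3 * B + 2)) * B + 10 + 10 + 10,
    fun n x => ?_⟩
  have hB : B.eval n = tA.eval n + (2 * n + 1) + tg.eval (2 * n + 1) := by
    simp [B, s, Polynomial.eval_comp]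
  refine (timeLE_reduction (p := fork fst nil) (q := id) (v := .pair (.unary n) x)
    (Inv := fun st => st.fst = .unary n ∧ st.snd.fst.size ≤ B.eval n) (T := B.eval n)
    ⟨trivial, trivial⟩ trivial (fun st m hst hm => bounded_nceHandler (n := n) (B := B.eval n)
    hg he hv (by omega) (by omega) hst.1 hst.2 hm) ⟨rfl, ?_⟩ ((hA n x).mono (by omega))).mono ?_
  · simp only [out, Val.snd_pair, Val.fst, Val.size]
    omega
  · simp only [steps, Polynomial.eval_add, Polynomial.eval_mul, Polynomial.eval_comp,
      Polynomial.eval_ofNat, Polynomial.eval_X, Polynomial.eval_one, s]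
    refine Nat.add_le_add (Nat.add_le_add (Nat.add_le_add (Nat.mul_le_mul_right _ ?_) ?_) ?_) le_rfl
        <;> omega

theorem qptAdversary_skeAdversary (hnce : nce.WellFormed) (hA : A.QPTAdversary)
    {T : Polynomial ℕ} (hcopy : ∀ n l,
      (copy.eval (.pair (.unary n) l)).Bounded (T.eval n) fun w => w.size ≤ T.eval n) :
    (skeAdversary nce copy A).QPTAdversary := by
  obtain ⟨tA, hA⟩ := hA
  obtain ⟨tf, hf⟩ := hnce.fakeSetup.2.exists_timeBound
  obtain ⟨ts, hs⟩ := hnce.fakeSK.2.exists_timeBound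
  obtain ⟨tc, hc⟩ := hnce.fakeCT.2.exists_timeBound
  obtain ⟨tr, hr⟩ := hnce.reveal.2.exists_timeBound
  let s : Polynomial ℕ := 2 * Polynomial.X + 1
  -- The `2` is needed because the pair of public key and auxiliary data is rebuilt from its
  -- components: if the output of `fakeSetup` is not a pair, both are `nil` and the new pair has
  -- size `3`.
  let B : Polynomial ℕ := tA + s + tf.comp s + 2
  let S : Polynomial ℕ := tc.comp (4 * B + 3) + 1
  refine ⟨(380 + 3 * B + ts.comp (4 * B + 3) + tc.comp (4 * B + 3) + T
    + tr.comp (3 * B + S + T + 4)) * B + tf.comp s + 100, fun n x => ?_⟩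
  have hB : B.eval n = tA.eval n + (2 * n + 1) + tf.eval (2 * n + 1) + 2 := by
    simp [B, s, Polynomial.eval_comp]
  have hS : S.eval n = tc.eval (4 * B.eval n + 3) + 1 := by
    simp [S, Polynomial.eval_comp]
  have h₁ : ((fork (seq fst nce.fakeSetup) id).eval (.pair (.unary n) x)).Bounded
      (tf.eval (2 * n + 1) + 10) fun w => ∃ k : Val, k.size ≤ tf.eval (2 * n + 1) ∧
        w = .pair k (.pair (.unary n) x) := by
    refine (bounded_fork (E := fun k => k.size ≤ tf.eval (2 * n + 1))
      (bounded_seq (IsPure.bounded (p := fst) trivial _)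
      (t := tf.eval (2 * n + 1)) ?_) (IsPure.bounded (p := id) trivial _)).mono ?_ ?_
    · rintro _ rfl
      exact hf _ _ (Val.size_unary n).le
    · simp only [steps]
      omega
    · rintro _ ⟨k, _, rfl, hk, rfl⟩
      exact ⟨k, hk, rfl⟩
  set H := 380 + 3 * B.eval n + ts.eval (4 * B.eval n + 3) + tc.eval (4 * B.eval n + 3)
    + T.eval n + tr.eval (3 * B.eval n + S.eval n + T.eval n + 4) with hH
  refine TimeLE.tick (h₁.1.bind h₁.2 (t := H * B.eval n + 50 + 20 + 10) ?_) ?_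
  · rintro _ ⟨k, hk, rfl⟩
    have hA' : (A.eval ((fork (path [snd, fst]) (path [fst, fst])).out
        (.pair k (.pair (.unary n) x)))).TimeLE (B.eval n) := (hA n k.fst).mono (by omega)
    refine (timeLE_reduction (Inv := fun st => st.fst = .unary n ∧ st.snd.fst.size ≤ B.eval n ∧
      st.snd.snd.size ≤ S.eval n) (T := B.eval n) (by simp [IsPure, path]) (by simp [IsPure, path])
      (fun st m hst hm => bounded_skeHandler (n := n) (B := B.eval n) (S := S.eval n)
        (T := T.eval n) hs hc hr (hcopy n) (by omega) (by omega) hst.1 hst.2.1 hst.2.2 hm)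
      ⟨rfl, ?_, ?_⟩ hA').mono ?_
    · have : k.fst.size + k.snd.size ≤ k.size + 1 := by
        cases k <;> simp only [Val.size, Val.fst, Val.snd] <;> omega
      simp only [out, path, Val.snd_pair, Val.fst_pair, Val.size]
      omega
    · simp only [out, Val.snd_pair, Val.size]
      omega
    · simp only [steps, path]
      refine Nat.add_le_add (Nat.add_le_add (Nat.add_le_add (Nat.mul_le_mul_right _ ?_) ?_) ?_) le_rfl
        <;> omega
  · simp only [Polynomial.eval_add, Polynomial.eval_mul, Polynomial.eval_comp,
      Polynomial.eval_ofNat, Polynomial.eval_X, Polynomial.eval_one, s]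
    rw [← hH]
    omega

/-- Phases of the experiment for the non-committing scheme, given those of the experiment for
certified deletion. -/
def ABECD.Phase.toNCABE : ABECD.Phase → NCABE.Phase
  | .start Q => .start Q
  | .holding X => .challenged X
  | .deleted X => .challenged X

/-- Phases of the experiment for the one-time scheme, given those of the experiment for
certified deletion. -/
def ABECD.Phase.toSKECD : ABECD.Phase → SKECD.Phase
  | .start _ => .start
  | .holding _ => .holding
  | .deleted _ => .deleted

/-- Key queries are forwarded unchanged and certificates are checked locally, so holding and deleted
phases both appear outside as the challenged phase. The challenge is legal because generated keys
lie in `{0,1}^ℓ`. -/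
theorem obeys_nceAdversary (hske : ske.WellFormed (bitStrings ℓ))
    (hA : ∀ n x, (A.run [.unary n, x]).Obeys (ABECD.Move V M n) (.start [])) (b : Bool) (n : ℕ)
    (x : Val) : ((nceAdversary ske b A).run [.unary n, x]).Obeys
      (NCABE.Move V (bitStrings ℓ) n) (.start []) := by
  rw [← obeys_strip, strip_run, ← bind_ret (sem _ _)]
  refine (sem_nceAdversary ske b A (.unary n) x _root_.id).symm ▸ ?_
  refine Obeys.interact (f := ABECD.Phase.toNCABE) (Inv := fun st => ∃ y, st = .pair (.unary n) y)
    ?_ ((obeys_strip.2 (hA n x)).bind_ret _root_.id) ⟨_, rfl⟩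
  rintro _ _ _ _ (⟨Q, P, hP⟩ | ⟨Q, X, m₀, m₁, hX, hm₀, hm₁, hQ⟩ | ⟨X, P, hP, hS⟩ | ⟨X, c, hc⟩ |
    ⟨X, P, hP, hS⟩) ⟨y, rfl⟩
  · rw [nceHandler_keyQuery]
    exact ⟨_, .key₁ Q P hP, fun r => ⟨⟨_, rfl⟩, rfl⟩⟩
  · rw [nceHandler_challenge]
    refine (hske.gen.1.silent_sem _).bind_obeysTo (all_strip.2 (hske.key n)) ?_
    rintro _ ⟨k, hk, rfl⟩
    refine ⟨_, .challenge Q X k hX hk hQ, fun r => ?_⟩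
    exact (hske.enc.1.silent_sem _).bind_obeysTo (all_true _) fun d _ => ⟨⟨_, rfl⟩, rfl⟩
  · rw [nceHandler_keyQuery]
    exact ⟨_, .key₂ X P hP hS, fun r => ⟨⟨_, rfl⟩, rfl⟩⟩
  · rw [nceHandler_certificate]
    exact (hske.vrfy.1.silent_sem _).bind_obeysTo (all_true _) fun d _ => ⟨⟨_, rfl⟩, rfl⟩
  · rw [nceHandler_keyQuery]
    exact ⟨_, .key₂ X P hP hS, fun r => ⟨⟨_, rfl⟩, rfl⟩⟩

/-- Key queries are answered locally and leave the outer phase unchanged; exactly the challenge and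
the certificate are forwarded. -/
theorem obeys_skeAdversary (hnce : nce.WellFormed) (hcopy : copy.IsClosed)
    (hA : ∀ n x, (A.run [.unary n, x]).Obeys (ABECD.Move V M n) (.start [])) (n : ℕ)
    (x : Val) : ((skeAdversary nce copy A).run [.unary n, x]).Obeys (SKECD.Move M n) .start := by
  rw [← obeys_strip, strip_run, ← bind_ret (sem _ _)]
  refine (sem_skeAdversary nce copy A (.unary n) x _root_.id).symm ▸ ?_
  refine (hnce.fakeSetup.qpt.1.silent_sem _).bind_obeys fun k => ?_
  refine Obeys.interact (f := ABECD.Phase.toSKECD)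
    (Inv := fun st => ∃ ct, st = .pair (.unary n) (.pair (.pair k.fst k.snd) ct))
    ?_ ((obeys_strip.2 (hA n k.fst)).bind_ret _root_.id) ⟨_, rfl⟩
  have key : ∀ (P ct : Val) (s : SKECD.Phase),
      ((skeHandler nce copy).respond (.pair (.unary n) (.pair (.pair k.fst k.snd) ct))
        (.keyQuery P)).ObeysTo (SKECD.Move M n)
        (fun x t => (∃ ct, x.2 = .pair (.unary n) (.pair (.pair k.fst k.snd) ct)) ∧ t = s) s := by
    intro P ct s
    rw [skeHandler_keyQuery]
    exact (hnce.fakeSK.qpt.1.silent_sem _).bind_obeysTo (all_true _) fun d _ => ⟨⟨_, rfl⟩, rfl⟩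
  rintro _ _ _ _ (⟨Q, P, hP⟩ | ⟨Q, X, m₀, m₁, hX, hm₀, hm₁, hQ⟩ | ⟨X, P, hP, hS⟩ | ⟨X, c, hc⟩ |
    ⟨X, P, hP, hS⟩) ⟨ct, rfl⟩
  · exact key _ _ _
  · rw [skeHandler_challenge]
    refine (hnce.fakeCT.qpt.1.silent_sem _).bind_obeysTo (all_true _) fun c _ => ?_
    exact ⟨_, .challenge m₀ m₁ hm₀ hm₁, fun r => ⟨⟨_, rfl⟩, rfl⟩⟩
  · exact key _ _ _
  · rw [skeHandler_certificate]
    refine ⟨_, .certificate c hc, fun r => ?_⟩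
    beta_reduce
    split_ifs
    · refine (hcopy.silent_sem _).bind_obeysTo (all_true _) fun sk _ => ?_
      exact (hnce.reveal.qpt.1.silent_sem _).bind_obeysTo (all_true _) fun d _ => ⟨⟨_, rfl⟩, rfl⟩
    · exact ⟨⟨_, rfl⟩, rfl⟩
  · exact key _ _ _

/-! ## The hybrid games -/

open CertDel.Comp Prog

@[simp] theorem Val.rename_eq_nil {σ : ℕ → ℕ} {v : Val} : v.rename σ = .nil ↔ v = .nil := by
  cases v <;> simp [Val.rename]

section Games

variable (nce : NCABE) (ske : SKECD) (b : Bool) (n : ℕ) (pk aux : Val)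

open Classical in
/-- The challenger that results if the adversary against the non-committing scheme plays the fake
experiment. The state is the pair of the key of the one-time scheme and the fake master secret
key. -/
noncomputable def eagerChallenger (s m : Val) : Comp (Val × Val) :=
  if m.fst = .nil then
    (nce.fakeSK.sem (.tuple [.unary n, pk, aux, m.snd])).bind fun r => ret (r, s)
  else if m.fst.isTrue then
    (ske.vrfy.sem (.tuple [.unary n, s.fst, m.snd])).bind fun v =>
      ret (if v.isTrue then .some s.snd else .bot, s)
  else (ske.gen.sem (.unary n)).bind fun sk =>
    (nce.fakeCT.sem (.tuple [.unary n, pk, aux, m.snd.fst])).bind fun c =>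
    (nce.reveal.sem (.tuple [.unary n, pk, aux, c, sk])).bind fun msk =>
    (ske.enc.sem (.tuple [.unary n, sk, if b then m.snd.snd.snd else m.snd.snd.fst])).bind fun d =>
      ret (.pair c d, .pair sk msk)

open Classical in
/-- The same challenger, except that it computes the fake master secret key only when it reveals
it, and that the key of the one-time scheme is the output of `g`. The state is the pair of this key
and the fake ciphertext. -/
noncomputable def lazyChallenger (g : Comp Val) (s m : Val) : Comp (Val × Val) :=
  if m.fst = .nil then
    (nce.fakeSK.sem (.tuple [.unary n, pk, aux, m.snd])).bind fun r => ret (r, s)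
  else if m.fst.isTrue then
    (ske.vrfy.sem (.tuple [.unary n, s.fst, m.snd])).bind fun v =>
      if v.isTrue then
        (nce.reveal.sem (.tuple [.unary n, pk, aux, s.snd, s.fst])).bind fun msk =>
          ret (.some msk, s)
      else ret (.bot, s)
  else g.bind fun sk =>
    (nce.fakeCT.sem (.tuple [.unary n, pk, aux, m.snd.fst])).bind fun c =>
    (ske.enc.sem (.tuple [.unary n, sk, if b then m.snd.snd.snd else m.snd.snd.fst])).bind fun d =>
      ret (.pair c d, .pair sk c)

variable (g : Comp Val) (s P X m₀ m₁ c : Val)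

theorem eagerChallenger_keyQuery : eagerChallenger nce ske b n pk aux s (.keyQuery P)
    = (nce.fakeSK.sem (.tuple [.unary n, pk, aux, P])).bind fun r => ret (r, s) := by
  simp [eagerChallenger, Val.keyQuery]

theorem eagerChallenger_challenge :
    eagerChallenger nce ske b n pk aux s (.challenge (.tuple [X, m₀, m₁]))
      = (ske.gen.sem (.unary n)).bind fun sk =>
        (nce.fakeCT.sem (.tuple [.unary n, pk, aux, X])).bind fun c =>
        (nce.reveal.sem (.tuple [.unary n, pk, aux, c, sk])).bind fun msk =>
        (ske.enc.sem (.tuple [.unary n, sk, if b then m₁ else m₀])).bind fun d =>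
          ret (.pair c d, .pair sk msk) := by
  simp [eagerChallenger, Val.challenge, Val.tuple]

theorem eagerChallenger_certificate : eagerChallenger nce ske b n pk aux s (.certificate c)
    = (ske.vrfy.sem (.tuple [.unary n, s.fst, c])).bind fun v =>
      ret (if v.isTrue then .some s.snd else .bot, s) := by
  simp [eagerChallenger, Val.certificate]

theorem lazyChallenger_keyQuery : lazyChallenger nce ske b n pk aux g s (.keyQuery P)
    = (nce.fakeSK.sem (.tuple [.unary n, pk, aux, P])).bind fun r => ret (r, s) := by
  simp [lazyChallenger, Val.keyQuery]

theorem lazyChallenger_challenge :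
    lazyChallenger nce ske b n pk aux g s (.challenge (.tuple [X, m₀, m₁]))
      = g.bind fun sk =>
        (nce.fakeCT.sem (.tuple [.unary n, pk, aux, X])).bind fun c =>
        (ske.enc.sem (.tuple [.unary n, sk, if b then m₁ else m₀])).bind fun d =>
          ret (.pair c d, .pair sk c) := by
  simp [lazyChallenger, Val.challenge, Val.tuple]

theorem lazyChallenger_certificate : lazyChallenger nce ske b n pk aux g s (.certificate c)
    = (ske.vrfy.sem (.tuple [.unary n, s.fst, c])).bind fun v =>
      if v.isTrue then
        (nce.reveal.sem (.tuple [.unary n, pk, aux, s.snd, s.fst])).bind fun msk =>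
          ret (.some msk, s)
      else ret (.bot, s) := by
  simp [lazyChallenger, Val.certificate]

end Games

section Hops

variable {V : PolicySystem} {M : Space} {ℓ : ℕ → ℕ} {nce : NCABE} {ske : SKECD}
  {b : Bool} {n : ℕ} {pk aux msk : Val} {α : Type} {c : Comp α} {X : List Bool}
  {Q : List (List Bool)} {g : Comp Val}

/-- Message by message, the handler and the real challenger do what the hybrid challenger does. The
handler's state is recovered from the stored verification key and the fixed `msk`; the invariant
guarantees that this key is present when a certificate arrives. -/
theorem interact_hybrid_challenger (hske : ske.WellFormed (bitStrings ℓ))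
    (hc : c.Obeys (ABECD.Move V M n) (.start Q)) :
    c.interact (fun st m => ((nceHandler ske b).respond st m).interact
        (fun s m => (nce.realChallenger n pk msk s m).strip) ()) (.pair (.unary n) .nil)
      = c.interact (fun s m => ((hybrid nce ske).challenger n b pk msk s m).strip) none := by
  refine hc.interact_congr (g := fun t => Val.pair (.unary n) (t.elim .nil fun sk => .pair sk msk))
    (Inv := fun s t => ∀ X, s = .holding X → ∃ sk, t = some sk) ?_ (t := none) (by simp)
  have key (t : Option Val) (y P : Val) :
      ((nceHandler ske b).respond (.pair (.unary n) y) (.keyQuery P)).interact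
        (fun s m => (nce.realChallenger n pk msk s m).strip) ()
      = (((hybrid nce ske).challenger n b pk msk t (.keyQuery P)).strip).bind
        fun x => ret (x.1, .pair (.unary n) y) := by
    rw [nceHandler_keyQuery]
    cases t <;> simp [interact, NCABE.realChallenger, ABECD.challenger, Val.keyQuery, strip,
      strip_run, Comp.bind_assoc]
  have keyAll (t : Option Val) (P : Val) :
      ((hybrid nce ske).challenger n b pk msk t (.keyQuery P)).strip.All fun x => x.2 = t := by
    refine all_strip.2 ?_
    cases t <;> exact (all_true _).bind fun _ _ => rfl
  rintro _ _ _ t (⟨Q, P, hP⟩ | ⟨Q, X, m₀, m₁, hX, hm₀, hm₁, hQ⟩ | ⟨X, P, hP, hS⟩ | ⟨X, c, hc⟩ |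
    ⟨X, P, hP, hS⟩) ht
  · refine ⟨(key t _ _).trans (bind_congr_of_all (keyAll t _) ?_), (keyAll t _).mono ?_⟩
    · rintro x rfl
      rfl
    · simp
  · have h : (((hybrid nce ske).challenger n b pk msk t
        (.challenge (.tuple [.str X, .str m₀, .str m₁]))).strip)
        = (ske.gen.sem (.unary n)).bind fun sk =>
          (nce.enc.sem (.tuple [.unary n, pk, .str X, sk])).bind fun c =>
          (ske.enc.sem (.tuple [.unary n, sk, if b then .str m₁ else .str m₀])).bind fun d =>
            ret (.pair c d, some sk) := by
      have h₀ : (((hybrid nce ske).challenger n b pk msk t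
          (.challenge (.tuple [.str X, .str m₀, .str m₁]))).strip)
          = ((hybrid nce ske).enc.sem (.tuple [.unary n, pk, .str X,
            if b then .str m₁ else .str m₀])).bind fun r => ret (r.snd, some r.fst) := by
        cases t <;> simp [ABECD.challenger, Val.challenge, Val.tuple, strip, strip_run]
      rw [h₀, sem_hybrid_enc]
      simp only [Comp.bind_assoc, ret_bind, Val.fst_pair, Val.snd_pair]
    rw [h]
    refine ⟨?_, (all_true _).bind fun _ _ => (all_true _).bind fun _ _ =>
      (all_true _).bind fun _ _ X _ => ⟨_, rfl⟩⟩
    rw [nceHandler_challenge, (hske.gen.1.silent_sem _).interact_bind]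
    simp only [Comp.bind_assoc, ret_bind, interact]
    congr 1
    funext sk
    simp only [NCABE.realChallenger, Val.challenge, Val.tuple, monad_bind_eq, monad_pure_eq,
      strip_bind, strip, strip_run, Comp.bind_assoc, ret_bind, Val.fst_pair, Val.snd_pair,
      (hske.enc.1.silent_sem _).interact_bind, interact, Option.elim]
  · refine ⟨(key t _ _).trans (bind_congr_of_all (keyAll t _) ?_), (keyAll t _).mono ?_⟩
    · rintro x rfl
      rfl
    · rintro x rfl
      exact ht
  · obtain ⟨sk, rfl⟩ := ht X rfl
    have h : ((hybrid nce ske).challenger n b pk msk (some sk) (.certificate c)).strip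
        = (ske.vrfy.sem (.tuple [.unary n, sk, c])).bind fun v =>
          ret (if v.isTrue then .some msk else .bot, some sk) := by
      simp [ABECD.challenger, Val.certificate, strip, strip_run]
    rw [h]
    refine ⟨?_, (all_true _).bind fun _ _ X _ => ⟨_, rfl⟩⟩
    simp only [nceHandler_certificate, (hske.vrfy.1.silent_sem _).interact_bind, interact,
      Comp.bind_assoc, ret_bind, Option.elim, Val.fst_pair, Val.snd_pair]
  · refine ⟨(key t _ _).trans (bind_congr_of_all (keyAll t _) ?_), (keyAll t _).mono ?_⟩
    · rintro x rfl
      rfl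
    · simp

/-- The eager challenger is the handler composed with the fake challenger, with `1ⁿ` removed from
the state; this serves as the starting point for the changes of order. -/
theorem interact_fakeChallenger (hske : ske.WellFormed (bitStrings ℓ))
    (hc : c.Obeys (ABECD.Move V M n) (.start Q)) :
    c.interact (fun st m => ((nceHandler ske b).respond st m).interact
        (fun s m => (nce.fakeChallenger n pk aux s m).strip) ()) (.pair (.unary n) .nil)
      = c.interact (eagerChallenger nce ske b n pk aux) .nil := by
  refine hc.interact_congr (g := fun y => Val.pair (.unary n) y) (Inv := fun _ _ => True) ?_
    (t := Val.nil) trivial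
  have key (y P : Val) :
      ((nceHandler ske b).respond (.pair (.unary n) y) (.keyQuery P)).interact
        (fun s m => (nce.fakeChallenger n pk aux s m).strip) ()
      = (eagerChallenger nce ske b n pk aux y (.keyQuery P)).bind
        fun x => ret (x.1, .pair (.unary n) x.2) := by
    rw [nceHandler_keyQuery, eagerChallenger_keyQuery]
    simp [interact, NCABE.fakeChallenger, Val.keyQuery, strip, strip_run, Comp.bind_assoc]
  rintro _ _ _ y (⟨Q, P, hP⟩ | ⟨Q, X, m₀, m₁, hX, hm₀, hm₁, hQ⟩ | ⟨X, P, hP, hS⟩ | ⟨X, c, hc⟩ |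
    ⟨X, P, hP, hS⟩) - <;> refine ⟨?_, all_true _⟩
  · exact key _ _
  · rw [nceHandler_challenge, eagerChallenger_challenge, (hske.gen.1.silent_sem _).interact_bind]
    simp only [Comp.bind_assoc, ret_bind, interact]
    congr 1
    funext sk
    simp only [NCABE.fakeChallenger, Val.challenge, Val.tuple, monad_bind_eq, monad_pure_eq,
      strip_bind, strip, strip_run, Comp.bind_assoc, ret_bind, Val.fst_pair, Val.snd_pair,
      (hske.enc.1.silent_sem _).interact_bind, interact]
  · exact key _ _
  · simp only [nceHandler_certificate, eagerChallenger_certificate,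
      (hske.vrfy.1.silent_sem _).interact_bind, interact, Comp.bind_assoc, ret_bind]
  · exact key _ _

/-- For a fixed key that `copy` leaves intact, the handler computes `reveal` on the same data as the
lazy challenger, merely learning the key at that moment. The invariant says that during the holding
phase the lazy state contains that key. -/
theorem interact_ske_challenger (hnce : nce.WellFormed) {copy : Prog}
    {sk : Val} (hsk : copy.sem (.pair (.unary n) sk) = ret sk)
    (hc : c.Obeys (ABECD.Move V M n) (.start Q)) :
    c.interact (fun st m => ((skeHandler nce copy).respond st m).interact
        (fun s m => (ske.challenger n b sk s m).strip) ())
        (.pair (.unary n) (.pair (.pair pk aux) .nil))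
      = c.interact (lazyChallenger nce ske b n pk aux (ret sk)) .nil := by
  refine hc.interact_congr (g := fun y => Val.pair (.unary n) (.pair (.pair pk aux) y.snd))
    (Inv := fun s t => ∀ X, s = .holding X → t.fst = sk) ?_ (t := Val.nil) (by simp)
  have key (y P : Val) :
      ((skeHandler nce copy).respond (.pair (.unary n) (.pair (.pair pk aux) y.snd))
        (.keyQuery P)).interact (fun s m => (ske.challenger n b sk s m).strip) ()
      = (lazyChallenger nce ske b n pk aux (ret sk) y (.keyQuery P)).bind
        fun x => ret (x.1, .pair (.unary n) (.pair (.pair pk aux) x.2.snd)) := by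
    rw [skeHandler_keyQuery, lazyChallenger_keyQuery,
      (hnce.fakeSK.1.classic_sem _).silent.interact_bind]
    simp only [interact, Comp.bind_assoc, ret_bind]
  have keyAll (y P : Val) : (lazyChallenger nce ske b n pk aux (ret sk) y (.keyQuery P)).All
      fun x => x.2 = y := by
    rw [lazyChallenger_keyQuery]
    exact (all_true _).bind fun _ _ => rfl
  rintro _ _ _ y (⟨Q, P, hP⟩ | ⟨Q, X, m₀, m₁, hX, hm₀, hm₁, hQ⟩ | ⟨X, P, hP, hS⟩ | ⟨X, c, hc⟩ |
    ⟨X, P, hP, hS⟩) hy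
  · exact ⟨key _ _, (all_true _).mono (by simp)⟩
  · rw [skeHandler_challenge, lazyChallenger_challenge, ret_bind,
      (hnce.fakeCT.1.classic_sem _).silent.interact_bind]
    refine ⟨?_, (all_true _).bind fun _ _ => (all_true _).bind fun _ _ X _ => rfl⟩
    simp only [Comp.bind_assoc, ret_bind, interact]
    congr 1
    funext ct
    simp only [SKECD.challenger, Val.challenge, Val.tuple, monad_bind_eq, monad_pure_eq,
      strip_bind, strip, strip_run, Comp.bind_assoc, ret_bind, Val.snd_pair]
  · exact ⟨key _ _, (keyAll _ _).mono fun x hx => hx ▸ hy⟩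
  · refine ⟨?_, (all_true _).mono (by simp)⟩
    rw [skeHandler_certificate, lazyChallenger_certificate, hy X rfl]
    simp only [SKECD.challenger, Val.certificate, monad_bind_eq, monad_pure_eq, interact,
      strip_bind, strip, strip_run, Comp.bind_assoc, ret_bind]
    congr 1
    funext v
    by_cases hv : v.isTrue
    · simp only [hv, Val.some, Val.fst_pair, Val.snd_pair, Val.isTrue_bit, if_true, hsk, ret_bind,
        (hnce.reveal.1.classic_sem _).silent.interact_bind, interact, Comp.bind_assoc]
    · simp only [hv, Val.bot, Val.fst_pair, Val.isTrue_bit, Bool.false_eq_true, if_false, ret_bind,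
        interact]
  · exact ⟨key _ _, (all_true _).mono (by simp)⟩

/-! ### Postponing the computation of the fake master secret key -/

/-- After the certificate only key queries are allowed, and their answers do not depend on the
state. -/
theorem interact_eager_deleted (hc : c.Obeys (ABECD.Move V M n) (.deleted X)) (s t : Val) :
    c.interact (eagerChallenger nce ske b n pk aux) s
      = c.interact (lazyChallenger nce ske b n pk aux g) t := by
  refine hc.interact_congr (g := fun _ => s) (Inv := fun s _ => ∃ X, s = .deleted X) ?_ ⟨X, rfl⟩
  rintro _ _ _ y (_ | _ | _ | _ | ⟨X, P, hP, hS⟩) ⟨_, hX⟩ <;> cases hX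
  rw [eagerChallenger_keyQuery, lazyChallenger_keyQuery]
  exact ⟨by simp only [Comp.bind_assoc, ret_bind], (all_true _).mono fun _ _ => ⟨X, rfl⟩⟩

theorem _root_.CertDel.Comp.Classic.wp_swap {β γ : Type} {c : Comp β} (hc : c.Classic)
    (d : Comp γ) (f : β → γ → ℕ → Mem → ℝ) :
    c.wp (fun a => d.wp (f a)) = d.wp fun b => c.wp fun a => f a b := by
  funext n ψ
  exact hc.wp_wp_comm d f n ψ

/-- Nothing depends on `msk` until a certificate is accepted. So sampling it when the holding phase
begins and sampling it on acceptance give the same weight: the classical `reveal` commutes with each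
intermediate event, and is dropped if it is never needed. -/
theorem weight_lazy_holding (hnce : nce.WellFormed) (E : α → Prop)
    (hc : c.Obeys (ABECD.Move V M n) (.holding X)) (sk ct : Val) :
    (c.interact (lazyChallenger nce ske b n pk aux g) (.pair sk ct)).weight E
      = (nce.reveal.sem (.tuple [.unary n, pk, aux, ct, sk])).wp fun msk =>
        (c.interact (eagerChallenger nce ske b n pk aux) (.pair sk msk)).weight E := by
  have hr := hnce.reveal.1.classic_sem (.tuple [.unary n, pk, aux, ct, sk])
  induction c with
  | ret a => exact (hr.wp_drop _).symm
  | tick d k ih => exact ih hc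
  | coin k ih =>
    -- Each node is viewed as a one-event computation followed by its continuation, so that `reveal`
    -- can be moved past it.
    refine Eq.trans ?_ (hr.wp_swap (Comp.coin ret) fun msk b' =>
      ((k b').interact (eagerChallenger nce ske b n pk aux) (.pair sk msk)).weight E).symm
    exact congrArg (fun f => (Comp.coin ret).wp f) (funext fun b' => ih b' (hc b'))
  | new k ih =>
    refine Eq.trans ?_ (hr.wp_swap (Comp.new ret) fun msk b' =>
      ((k b').interact (eagerChallenger nce ske b n pk aux) (.pair sk msk)).weight E).symm
    exact congrArg (fun f => (Comp.new ret).wp f) (funext fun b' => ih b' (hc b'))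
  | gate q k ih =>
    refine Eq.trans ?_ (hr.wp_swap (Comp.gate q (ret ())) fun msk _ =>
      (k.interact (eagerChallenger nce ske b n pk aux) (.pair sk msk)).weight E).symm
    exact congrArg (fun f => (Comp.gate q (ret ())).wp f) (funext fun _ => ih hc)
  | meas q k ih =>
    refine Eq.trans ?_ (hr.wp_swap (Comp.meas q ret) fun msk b' =>
      ((k b').interact (eagerChallenger nce ske b n pk aux) (.pair sk msk)).weight E).symm
    exact congrArg (fun f => (Comp.meas q ret).wp f) (funext fun b' => ih b' (hc b'))
  | ask m k ih =>
    obtain ⟨s', hs', hk⟩ := hc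
    cases hs' with
    | key₂ X P hP hS =>
      simp only [interact, lazyChallenger_keyQuery, eagerChallenger_keyQuery, Comp.bind_assoc,
        ret_bind, weight_bind]
      rw [hr.wp_swap]
      exact congrArg (fun f => Comp.wp f _) (funext fun r => ih r (hk r))
    | certificate X c hc =>
      simp only [interact, lazyChallenger_certificate, eagerChallenger_certificate,
        Comp.bind_assoc, ret_bind, weight_bind, Val.fst_pair, Val.snd_pair]
      rw [hr.wp_swap]
      refine congrArg (fun f => Comp.wp f _) (funext fun v => ?_)
      split_ifs
      -- On acceptance both sides have sampled `msk` and answer the same; the differing states no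
      -- longer matter.
      · simp only [wp_bind,
          interact_eager_deleted (g := g) (hk _) (.pair sk _) (.pair sk ct)]
        rfl
      · simp only [interact_eager_deleted (g := g) (hk _) (.pair sk _) (.pair sk ct)]
        exact (hr.wp_drop _).symm

/-- Up to the challenge the two challengers agree. There, `reveal` is first moved past `ske.enc`,
and then into the holding phase by `weight_lazy_holding`. -/
theorem weight_eager_start (hnce : nce.WellFormed) (E : α → Prop)
    (hc : c.Obeys (ABECD.Move V M n) (.start Q)) (s : Val) :
    (c.interact (eagerChallenger nce ske b n pk aux) s).weight E
      = (c.interact (lazyChallenger nce ske b n pk aux (ske.gen.sem (.unary n))) s).weight E := by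
  induction c generalizing Q with
  | ret a => rfl
  | tick d k ih => exact ih hc
  | coin k ih =>
    exact congrArg (fun f => (Comp.coin ret).wp f) (funext fun b' => ih b' (hc b'))
  | new k ih =>
    exact congrArg (fun f => (Comp.new ret).wp f) (funext fun b' => ih b' (hc b'))
  | gate q k ih =>
    exact congrArg (fun f => (Comp.gate q (ret ())).wp f) (funext fun _ => ih hc)
  | meas q k ih =>
    exact congrArg (fun f => (Comp.meas q ret).wp f) (funext fun b' => ih b' (hc b'))
  | ask m k ih =>
    obtain ⟨s', hs', hk⟩ := hc
    cases hs' with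
    | key₁ Q P hP =>
      simp only [interact, lazyChallenger_keyQuery, eagerChallenger_keyQuery, Comp.bind_assoc,
        ret_bind, weight_bind]
      exact congrArg (fun f => Comp.wp f _) (funext fun r => ih r (hk r))
    | challenge Q X m₀ m₁ hX hm₀ hm₁ hQ =>
      simp only [interact, lazyChallenger_challenge, eagerChallenger_challenge, Comp.bind_assoc,
        ret_bind, weight_bind]
      refine congrArg (fun f => Comp.wp f _) (funext fun sk => ?_)
      refine congrArg (fun f => Comp.wp f _) (funext fun ct => ?_)
      rw [(hnce.reveal.1.classic_sem _).wp_swap]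
      exact congrArg (fun f => Comp.wp f _) (funext fun d =>
        (weight_lazy_holding hnce E (hk _) sk ct).symm)

/-! ### Sampling the key of the one-time scheme in advance -/

/-- The sampler is used only at the challenge, which cannot be repeated. -/
theorem interact_lazy_holding (hc : c.Obeys (ABECD.Move V M n) (.holding X)) (g g' : Comp Val)
    (s : Val) : c.interact (lazyChallenger nce ske b n pk aux g) s
      = c.interact (lazyChallenger nce ske b n pk aux g') s := by
  refine hc.interact_congr (g := _root_.id) (Inv := fun s _ => ∀ Q, s ≠ .start Q) ?_ (by simp)
  rintro _ _ _ y (⟨Q, P, hP⟩ | ⟨Q, X, m₀, m₁, hX, hm₀, hm₁, hQ⟩ | ⟨X, P, hP, hS⟩ | ⟨X, c, hc⟩ |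
    ⟨X, P, hP, hS⟩) hs
  · exact absurd rfl (hs _)
  · exact absurd rfl (hs _)
  · refine ⟨?_, (all_true _).mono (by simp)⟩
    rw [lazyChallenger_keyQuery, lazyChallenger_keyQuery]
    exact (bind_ret _).symm
  · refine ⟨?_, (all_true _).mono (by simp)⟩
    rw [lazyChallenger_certificate, lazyChallenger_certificate]
    exact (bind_ret _).symm
  · refine ⟨?_, (all_true _).mono (by simp)⟩
    rw [lazyChallenger_keyQuery, lazyChallenger_keyQuery]
    exact (bind_ret _).symm

/-- Supplies the obliviousness of addresses needed to treat the rest of the game as the continuation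
of a sampler. -/
theorem ren_lazyChallenger {σ : ℕ → ℕ} {g : Comp Val}
    (hg : Ren σ (fun a b => b = a.rename σ) g g) (s m : Val) :
    Ren σ (fun x y => y.1 = x.1.rename σ ∧ y.2 = x.2.rename σ)
      (lazyChallenger nce ske b n pk aux g s m)
      (lazyChallenger nce ske b n (pk.rename σ) (aux.rename σ) g (s.rename σ) (m.rename σ)) := by
  have sem (p : Prog) {v w : Val} (h : w = v.rename σ) :
      Ren σ (fun a b => b = a.rename σ) (p.sem v) (p.sem w) := h ▸ ren_sem σ p v
  by_cases h₁ : m.fst = .nil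
  · have h₁' : (m.rename σ).fst = .nil := by rwa [Val.fst_rename, Val.rename_eq_nil]
    simp only [lazyChallenger, if_pos h₁, if_pos h₁', Val.snd_rename]
    refine Ren.bind (sem _ (by simp [Val.rename_tuple])) ?_
    rintro r _ rfl
    exact ⟨rfl, rfl⟩
  have h₁' : ¬(m.rename σ).fst = .nil := by rwa [Val.fst_rename, Val.rename_eq_nil]
  by_cases h₂ : m.fst.isTrue
  · have h₂' : (m.fst.rename σ).isTrue := by rwa [Val.isTrue_rename]
    simp only [lazyChallenger, if_neg h₁, if_neg h₁', if_pos h₂, if_pos h₂', Val.fst_rename,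
      Val.snd_rename]
    refine Ren.bind (sem _ (by simp [Val.rename_tuple])) ?_
    rintro v _ rfl
    rw [Val.isTrue_rename]
    split_ifs
    · refine Ren.bind (sem _ (by simp [Val.rename_tuple])) ?_
      rintro r _ rfl
      exact ⟨rfl, rfl⟩
    · exact ⟨rfl, rfl⟩
  · have h₂' : ¬(m.fst.rename σ).isTrue := by rwa [Val.isTrue_rename]
    simp only [lazyChallenger, if_neg h₁, if_neg h₁', if_neg h₂, if_neg h₂', Val.fst_rename,
      Val.snd_rename]
    refine hg.bind ?_
    rintro sk _ rfl
    refine Ren.bind (sem _ (by simp [Val.rename_tuple])) ?_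
    rintro ct _ rfl
    refine Ren.bind (sem _ (by cases b <;> simp [Val.rename_tuple])) ?_
    rintro d _ rfl
    exact ⟨rfl, rfl⟩

/-- Before the challenge the one-time key is not used, so its expectation passes through every event
by linearity. At the challenge, `weight_bind_eq_expect` turns the run of `ske.gen` inside the game
into that expectation. The scope bounds ensure that the remainder refers to no qubit allocated by
`ske.gen`. -/
theorem weight_lazy_start (hske : ske.WellFormed (bitStrings ℓ)) (E : α → Prop)
    (hc : c.Obeys (ABECD.Move V M n) (.start Q)) {i : ℕ} (hi : c.Scoped (fun _ => Eq) i)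
    (hpk : pk.Below i) (haux : aux.Below i) {ψ : Mem} (hψ : ψ.Below i) :
    (c.interact (lazyChallenger nce ske b n pk aux (ske.gen.sem (.unary n))) .nil).weight E i ψ
      = (ske.gen.sem (.unary n)).expect fun sk =>
        (c.interact (lazyChallenger nce ske b n pk aux (ret sk)) .nil).weight E i ψ := by
  have hgen := hske.gen.1.silent_sem (.unary n)
  have hkey := all_strip.2 (hske.key n)
  rw [strip_run] at hkey
  induction c generalizing Q i ψ with
  | ret a => exact (hgen.expect_const _).symm
  | tick d k ih => exact ih hc (fun ρ hρ => (hi ρ hρ).2) hpk haux hψ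
  | coin k ih =>
    refine Eq.trans ?_ (wp_expect_comm (fun b' j φ sk => ((k b').interact
      (lazyChallenger nce ske b n pk aux (ret sk)) .nil).weight E j φ) (Comp.coin ret) _ i ψ)
    simp only [interact, weight, wp]
    rw [ih false (hc false) (fun ρ hρ => hi ρ hρ false) hpk haux hψ,
      ih true (hc true) (fun ρ hρ => hi ρ hρ true) hpk haux hψ]
  | new k ih =>
    exact ih i (hc i) hi.new (hpk.mono (by omega)) (haux.mono (by omega)) (hψ.mono (by omega))
  | gate q k ih => exact ih hc hi.gate.2 hpk haux (hψ.act hi.gate.1)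
  | meas q k ih =>
    refine Eq.trans ?_ (wp_expect_comm (fun b' j φ sk => ((k b').interact
      (lazyChallenger nce ske b n pk aux (ret sk)) .nil).weight E j φ) (Comp.meas q ret) _ i ψ)
    simp only [interact, weight, wp]
    rw [ih false (hc false) (fun ρ hρ => (hi ρ hρ).2 false) hpk haux (hψ.project q _),
      ih true (hc true) (fun ρ hρ => (hi ρ hρ).2 true) hpk haux (hψ.project q _)]
  | ask m k ih =>
    obtain ⟨s', hs', hk⟩ := hc
    obtain ⟨-, hik⟩ := hi.ask
    cases hs' with
    | key₁ Q P hP =>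
      simp only [interact, lazyChallenger_keyQuery, Comp.bind_assoc, ret_bind, weight_bind]
      rw [← wp_expect_comm]
      refine Scoped.wp_congr (S := fun ρ a b => b = a.rename ρ) (fun ρ hρ => ?_) hψ ?_
      · have h := ren_sem ρ nce.fakeSK (.tuple [.unary n, pk, aux, .str P])
        simpa only [Val.rename_tuple, List.map, Val.rename_unary, hpk ρ hρ, haux ρ hρ,
          (Val.isClassical_str P).rename] using h
      · intro r j φ hj hφ hr
        exact ih r (hk r) (hik j r hj fun ρ hρ => (hr ρ hρ).symm) (hpk.mono hj) (haux.mono hj) hφ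
    | challenge Q X m₀ m₁ hX hm₀ hm₁ hQ =>
      simp only [interact, lazyChallenger_challenge, Comp.bind_assoc, ret_bind]
      -- With the key already sampled, the sampler may be replaced by the constant `ret sk`, as in
      -- the game with a key fixed in advance.
      have h (sk : Val) : ((nce.fakeCT.sem (.tuple [.unary n, pk, aux, .str X])).bind fun ct =>
          (ske.enc.sem (.tuple [.unary n, sk, if b then .str m₁ else .str m₀])).bind fun d =>
            (k (.pair ct d)).interact (lazyChallenger nce ske b n pk aux
              (ske.gen.sem (.unary n))) (.pair sk ct))
          = (nce.fakeCT.sem (.tuple [.unary n, pk, aux, .str X])).bind fun ct =>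
          (ske.enc.sem (.tuple [.unary n, sk, if b then .str m₁ else .str m₀])).bind fun d =>
            (k (.pair ct d)).interact (lazyChallenger nce ske b n pk aux (ret sk))
              (.pair sk ct) := by
        congr 1
        funext ct
        congr 1
        funext d
        exact interact_lazy_holding (hk _) _ _ _
      simp only [← h]
      refine weight_bind_eq_expect hkey (fun σ => ?_) hψ ?_
      · have hr := ren_sem σ ske.gen (.unary n)
        rw [Val.rename_unary] at hr
        refine (hr.and_all hkey).mono ?_
        rintro _ _ ⟨rfl, k, -, rfl⟩
        exact ((Val.isClassical_str k).rename σ).symm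
      · rintro _ ⟨sk, -, rfl⟩ ρ hρ
        have h₁ := ren_sem ρ nce.fakeCT (.tuple [.unary n, pk, aux, .str X])
        have h₂ := ren_sem ρ ske.enc
          (.tuple [.unary n, .str sk, if b then .str m₁ else .str m₀])
        have hm : (if b then Val.str m₁ else Val.str m₀).IsClassical := by
          split_ifs <;> exact Val.isClassical_str _
        simp only [Val.rename_tuple, List.map, Val.rename_unary, hpk ρ hρ, haux ρ hρ,
          (Val.isClassical_str _).rename, hm.rename] at h₁ h₂
        refine h₁.bind ?_
        rintro ct _ rfl
        refine h₂.bind ?_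
        rintro d _ rfl
        have hg := ren_sem ρ ske.gen (.unary n)
        rw [Val.rename_unary] at hg
        refine Ren.interact (T := fun s s' => s' = s.rename ρ) ?_ ((hi ρ hρ).2 (.pair ct d)) ?_
        · rintro s _ m rfl
          have := ren_lazyChallenger (nce := nce) (ske := ske) (b := b) (n := n) (pk := pk)
            (aux := aux) hg s m
          rwa [hpk ρ hρ, haux ρ hρ] at this
        · exact congrArg (fun v => Val.pair v _) ((Val.isClassical_str sk).rename ρ).symm

end Hops

/-! ## Security -/

open CertDel.Comp Prog

variable {V : PolicySystem} {M : Space} {ℓ : ℕ → ℕ} {nce : NCABE} {ske : SKECD} {A : Prog}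

/-- The reduction plays perfectly against the real challenger: two layers of interaction collapse
into one, which is the hybrid challenger. -/
theorem prob_hybrid_experiment (hske : ske.WellFormed (bitStrings ℓ))
    (hA : ∀ n x, (A.run [.unary n, x]).Obeys (ABECD.Move V M n) (.start [])) (b : Bool) (n : ℕ) :
    ((hybrid nce ske).experiment A n b).prob (· = true)
      = (nce.experiment (nceAdversary ske b A) n false).prob (· = true) := by
  rw [← prob_strip, ← prob_strip _ (nce.experiment _ _ _)]
  simp only [ABECD.experiment, NCABE.experiment, monad_bind_eq, monad_pure_eq, strip_bind,
    strip_interact, strip_run, strip, hybrid_setup]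
  congr 2
  funext k
  rw [← interact_bind_ret, ← interact_bind_ret]
  simp only [Val.tuple]
  rw [sem_nceAdversary, interact_interact, interact_hybrid_challenger hske]
  exact (obeys_strip.2 (hA n k.fst)).bind_ret _

/-- The fake experiment for the non-committing scheme is the experiment for the one-time scheme. -/
theorem prob_fake_experiment (hnce : nce.WellFormed) (hske : ske.WellFormed (bitStrings ℓ))
    (hA : ∀ n x, (A.run [.unary n, x]).Obeys (ABECD.Move V M n) (.start [])) {copy : Prog} {n : ℕ}
    (hcopy : (ske.gen.sem (.unary n)).All fun sk => copy.sem (.pair (.unary n) sk) = ret sk)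
    (b : Bool) :
    (nce.experiment (nceAdversary ske b A) n true).prob (· = true)
      = (ske.experiment (skeAdversary nce copy A) n b).prob (· = true) := by
  have hA' (x : Val) : ((A.sem (.pair (.unary n) x)).bind fun w => ret w.isTrue).Obeys
      (ABECD.Move V M n) (.start []) := (obeys_strip.2 (hA n x)).bind_ret _
  have hkey : (ske.gen.sem (.unary n)).All fun sk => ∃ k ∈ bitStrings ℓ n, sk = .str k :=
    all_strip.2 (hske.key n)
  have hren (p : Prog) (v : Val) (n : ℕ) (hv : v.Below n) :
      (p.sem v).Scoped (fun ρ a b => b = a.rename ρ) n := fun ρ hρ => by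
    have h := ren_sem ρ p v
    rwa [hv ρ hρ] at h
  have hu (i : ℕ) : (Val.unary n).Below i := (Val.isClassical_unary n).below i
  have hres (σ : ℕ → ℕ) (v : Val) : Ren σ Eq ((A.sem v).bind fun w => ret w.isTrue)
      ((A.sem (v.rename σ)).bind fun w => ret w.isTrue) := by
    refine (ren_sem σ A v).bind ?_
    rintro w _ rfl
    exact (w.isTrue_rename σ).symm
  rw [← prob_strip, ← prob_strip _ (ske.experiment _ _ _)]
  simp only [SKECD.experiment, NCABE.experiment, monad_bind_eq, monad_pure_eq, strip_bind,
    strip_interact, strip_run, strip]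
  have h₁ (k : Val) : (((nceAdversary ske b A).sem (.tuple [.unary n, k.fst])).interact
        (fun s m => (nce.fakeChallenger n k.fst k.snd s m).strip) ()).bind
        (fun r => ret r.isTrue)
      = ((A.sem (.pair (.unary n) k.fst)).bind fun w => ret w.isTrue).interact
        (eagerChallenger nce ske b n k.fst k.snd) .nil := by
    rw [← interact_bind_ret]
    simp only [Val.tuple]
    rw [sem_nceAdversary, interact_interact, interact_fakeChallenger hske (hA' _)]
  have h₂ (sk : Val) (hsk : copy.sem (.pair (.unary n) sk) = ret sk) :
      (((skeAdversary nce copy A).sem (.tuple [.unary n, .nil])).interact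
        (fun s m => (ske.challenger n b sk s m).strip) ()).bind (fun r => ret r.isTrue)
      = (nce.fakeSetup.sem (.unary n)).bind fun k =>
        ((A.sem (.pair (.unary n) k.fst)).bind fun w => ret w.isTrue).interact
        (lazyChallenger nce ske b n k.fst k.snd (ret sk)) .nil := by
    rw [← interact_bind_ret]
    simp only [Val.tuple]
    rw [sem_skeAdversary, (hnce.fakeSetup.1.classic_sem _).silent.interact_bind]
    congr 1
    funext k
    rw [interact_interact, interact_ske_challenger hnce hsk (hA' _)]
  simp only [Val.tuple] at h₁ h₂ ⊢
  simp only [h₁]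
  rw [bind_congr_of_all hcopy h₂]
  simp only [prob]
  -- The key generated at the start of the OT-CD game becomes an expectation, which is then moved
  -- past `fakeSetup`. It remains to compare the games for a fixed output of `fakeSetup`: first
  -- `reveal` is postponed, then key generation is advanced.
  rw [weight_bind_eq_expect hkey (fun σ => ?_) (Mem.below_initial 0)]
  · rw [weight_bind]
    simp only [weight_bind _ (nce.fakeSetup.sem _)]
    rw [← wp_expect_comm]
    refine Scoped.wp_congr (hren _ _ 0 (hu 0)) (Mem.below_initial 0) fun k i φ _ hφ hk => ?_
    have hfst : k.fst.Below i := fun ρ hρ => by rw [← Val.fst_rename, ← hk ρ hρ]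
    have hsnd : k.snd.Below i := fun ρ hρ => by rw [← Val.snd_rename, ← hk ρ hρ]
    rw [weight_eager_start hnce _ (hA' _)]
    refine weight_lazy_start hske _ (hA' _) (fun ρ hρ => ?_) hfst hsnd hφ
    have h := hres ρ (.pair (.unary n) k.fst)
    simpa only [Val.rename, hu i ρ hρ, hfst ρ hρ] using h
  · rintro _ ⟨sk, -, rfl⟩ ρ -
    refine (hren nce.fakeSetup (.unary n) 0 (hu 0) ρ (by simp)).bind ?_
    rintro k _ rfl
    have h := hres ρ (.pair (.unary n) k.fst)
    simp only [Val.rename, Val.rename_unary] at h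
    rw [Val.fst_rename, Val.snd_rename]
    refine Ren.interact (T := fun s s' => s' = s.rename ρ) ?_ h rfl
    rintro s _ m rfl
    exact ren_lazyChallenger (g := ret (.str sk))
      (show Val.str sk = _ from ((Val.isClassical_str sk).rename ρ).symm) s m
  · have hr := hren ske.gen (.unary n) 0 (hu 0) σ (by simp)
    refine (hr.and_all hkey).mono ?_
    rintro _ _ ⟨rfl, k, -, rfl⟩
    exact ((Val.isClassical_str k).rename σ).symm

/-- One OT-CD adversary serves both bits, since its challenger chooses the plaintext, whereas the
RNC adversary encrypts `m_b` itself and so exists once for each bit. -/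
theorem hybrid_secure (hnce : nce.WellFormed) (hske : ske.WellFormed (bitStrings ℓ))
    (hRNC : nce.RNCSecure V (bitStrings ℓ)) (hOTCD : ske.OTCDSecure M) :
    (hybrid nce ske).INDCPACDSecure V M := by
  intro A hA hobeys
  obtain ⟨tg, hg⟩ := hske.gen.2.exists_timeBound
  -- The cut-off is the size bound for outputs of `ske.gen` on `1ⁿ`, which has `2n + 1` nodes;
  -- honest keys therefore survive the truncation.
  obtain ⟨copy, hclosed, ⟨T, hT⟩, hcopy⟩ := exists_copy (tg.comp (2 * Polynomial.X + 1))
  have hkey (n : ℕ) : (ske.gen.sem (.unary n)).All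
      fun sk => copy.sem (.pair (.unary n) sk) = ret sk := by
    have h₁ := all_strip.2 (hske.key n)
    have h₂ := all_strip.2 (hg (.unary n) (2 * n + 1) (Val.size_unary n).le).2
    refine (h₁.and h₂).mono ?_
    rintro _ ⟨⟨k, -, rfl⟩, hk⟩
    refine hcopy n k ?_
    rw [Val.size_str] at hk
    simp only [Polynomial.eval_comp, Polynomial.eval_add, Polynomial.eval_mul,
      Polynomial.eval_ofNat, Polynomial.eval_X, Polynomial.eval_one]
    omega
  have hnceAdv (b : Bool) := hRNC _ (qptAdversary_nceAdversary hske hA b)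
    (obeys_nceAdversary hske hobeys b)
  have hskeAdv := hOTCD _ (qptAdversary_skeAdversary hnce hA hT)
    (obeys_skeAdversary hnce hclosed hobeys)
  -- Triangle inequality along the path: real game for `0`, fake game for `0`, fake game for `1`,
  -- real game for `1`.
  refine (((hnceAdv false).add hskeAdv).add (hnceAdv true)).mono fun n => ?_
  simp only [prob_hybrid_experiment hske hobeys, prob_fake_experiment hnce hske hobeys (hkey n)]
  refine (abs_sub_le _ ((ske.experiment (skeAdversary nce copy A) n true).prob (· = true)) _).trans
    (add_le_add (abs_sub_le _ _ _) (abs_sub_comm _ _).le)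

end CertDel

theorem mainTheorem6 (V : PolicySystem) (M : Space) (ℓ : ℕ → ℕ) (nce : NCABE) (ske : SKECD)
    (hnce : nce.WellFormed) (hske : ske.WellFormed (bitStrings ℓ))
    (hRNC : nce.RNCSecure V (bitStrings ℓ)) (hOTCD : ske.OTCDSecure M) :
    (hybrid nce ske).WellFormed V M ∧
    (nce.Correct V (bitStrings ℓ) → ske.DecCorrect M → (hybrid nce ske).DecCorrect V M) ∧
    (ske.VrfyCorrect M → (hybrid nce ske).VrfyCorrect V M) ∧
    (hybrid nce ske).INDCPACDSecure V M :=
  ⟨hybrid_wellFormed hnce hske, hybrid_decCorrect hnce hske, hybrid_vrfyCorrect hnce,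
    hybrid_secure hnce hske hRNC hOTCD⟩
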